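/- Let $(W,S)$ be a Coxeter system with $S$ finite, length function $\ell$ and Coxeter matrix $(M_{st})$. A root is a subset $w\alpha_s$ of $W$, where $w\in W$, $s\in S$ and $\alpha_s=\{v\in W:\ell(sv)>\ell(v)\}$; $\Phi$ is the set of roots, $-\alpha:=W\setminus\alpha$, and $\alpha$ is positive if $1\in\alpha$, negative otherwise. Two distinct roots $\alpha,\beta$ form a prenilpotent pair if $\alpha\cap\beta$ and $(-\alpha)\cap(-\beta)$ are nonempty; then $]\alpha,\beta[$ is the set of roots $\gamma\ne\alpha,\beta$ with $\gamma\supset\alpha\cap\beta$ and $-\gamma\supset(-\alpha)\cap(-\beta)$. Letting $W$ act on the real vector space with basis $(e_s)_{s\in S}$ by $\sigma_s(v)=v-2B(e_s,v)e_s$, $B(e_s,e_t)=-\cos(\pi/M_{st})$, and identifying the root $w\alpha_s$ with the vector $we_s$, let $]\alpha,\beta[_{\rm lin}$ be the set of roots other than $\alpha,\beta$ that are linear combinations of $\alpha$ and $\beta$ with nonnegative coefficients. Let $G$ be a group with a subgroup $H$ and subgroups $(U_\alpha)_{\alpha\in\Phi}$, and let $U_\pm$ be the subgroup generated by the $U_\alpha$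 with $\alpha$ positive (resp. negative). $G$ is a (TRD)-group if: (TRD0) each $U_\alpha$ is nontrivial and normalized by $H$; (TRD1) for each prenilpotent pair, $[U_\alpha,U_\beta]$ is contained in the subgroup generated by the $U_\gamma$, $\gamma\in\,]\alpha,\beta[$; (TRD2) for $s\in S$ and $u\in U_{\alpha_s}\setminus\{1\}$ there are unique $u',u''\in U_{-\alpha_s}\setminus\{1\}$ such that $m(u):=u'uu''$ conjugates $U_\beta$ onto $U_{s\beta}$ for every root $\beta$, and $m(u)H=m(v)H$ for all $u,v\in U_{\alpha_s}\setminus\{1\}$; (TRD3) $U_{\alpha_s}\not\subset U_-$ and $U_{-\alpha_s}\not\subset U_+$ for $s\in S$; (TRD4) $G$ is generated by $H$ and the $U_\alpha$. It is a (TRD)$_{\rm lin}$-group if moreover (TRD1) holds with $]\alpha,\beta[_{\rm lin}$ in place of $]\alpha,\beta[$. For a (TRD)-group put $B_\pm=HU_\pm$ and let $N$ be generated by $H$ and all the $m(u)$, with its epimorphism $\nu:N\to W$ with kernel $H$ sending $m(u)$ to $s$ for $u\in U_{\alpha_s}\setminus\{1\}$; write $wB_\pm$ for $nB_\pm$ where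 $\nu(n)=w$. Chambers of sign $\epsilon$ are the cosets $gB_\epsilon$; facets of sign $\epsilon$ and type $J\subset S$ are the cosets $gP_{\epsilon,J}$ with $P_{\epsilon,J}=B_\epsilon W_JB_\epsilon$, $W_J=\langle J\rangle$, and such a facet is spherical if $W_J$ is finite; a facet is a face of the chambers it contains as a subset of $G$; ${\rm Fix}_G(F)=\{x\in G: xF=F\}$. Apartments of sign $\epsilon$ are the $G$-translates of the set of chambers $\{wB_\epsilon\}_{w\in W}$. Chambers $gB_\epsilon$, $hB_{-\epsilon}$ are opposite if $g^{-1}h\in B_\epsilon B_{-\epsilon}$. A pair ${\bf A}=({\bf A}_+,{\bf A}_-)$ of apartments of opposite signs is a pair of opposite apartments if each chamber of either one is opposite to exactly one chamber of the other. It contains the facet $F$ of sign $\epsilon$ if $F$ is a face of a chamber of ${\bf A}_\epsilon$; then $-F$ denotes the facet of sign $-\epsilon$ and of the same type that is a face of the chamber of ${\bf A}_{-\epsilon}$ opposite to a chamber of ${\bf A}_\epsilon$ having $F$ as a face. If ${\bf A}$ is the image under $g$ of the standard pair $(\{wB_+\},\{wB_-\})$, the roots of ${\bf A}$ are the half-apartments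 $g\alpha$, $\alpha\in\Phi$, consisting of the $gwB_+$ with $w\in\alpha$ and the $gwB_-$ with $w\notin\alpha$, and the root group of $g\alpha$ is $gU_\alpha g^{-1}$. We write $g\alpha\supset F$ if all chambers of ${\bf A}_\epsilon$ having $F$ as a face lie in $g\alpha$, and $\partial(g\alpha)\supset F$ if some of them lie in $g\alpha$ and some do not. **Theorem (Levi decomposition for parabolic subgroups).** Let $G$ be a (TRD)-group and $F$ a facet. Suppose that $F$ is spherical or that $G$ is a (TRD)$_{\rm lin}$-group. Then there is a subgroup $U(F)$ of $G$, depending only on $F$, such that for every pair ${\bf A}$ of opposite apartments containing $F$ the facet $-F$ is well defined and $${\rm Fix}_G(F)=M(F,{\bf A})\ltimes U(F),$$ where $M(F,{\bf A})$ is the fixator of $F\cup -F$. Moreover ${\bf A}=g{\bf A}_{\rm std}$ for some $g\in G$, and for each such $g$, $M(F,{\bf A})$ is generated by $gHg^{-1}$ and the root groups $gU_\alpha g^{-1}$ with $\partial(g\alpha)\supset F$, and $U(F)$ is the normal closure in ${\rm Fix}_G(F)$ of the root groups $gU_\alpha g^{-1}$ with $g\alpha\supset F$. Finally, if $F$ has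 sign $\epsilon$ and type $J$, then $g$ can be chosen so that also $F=gP_{\epsilon,J}$, and for each such $g$ the pair $(W_J,J)$ is a Coxeter system and $M(F,{\bf A})$, with the subgroup $gHg^{-1}$ and the groups $gU_\alpha g^{-1}$ with $\partial(g\alpha)\supset F$, the one for $\alpha$ being indexed by the root $\alpha\cap W_J$ of $(W_J,J)$, satisfies the (TRD) axioms, and the (TRD)$_{\rm lin}$ axioms if $G$ does. -/

import Mathlib

open Pointwise

/-! ### Coxeter groups: roots, prenilpotent pairs, intervals -/

namespace CoxeterMatrix

/-- The submatrix of a Coxeter matrix indexed by a subset `J` of the index set. -/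
def restrict {S : Type*} (M : CoxeterMatrix S) (J : Set S) : CoxeterMatrix J where
  M := fun s t => M s t
  isSymm := by
    ext s t
    exact M.symmetric t s
  diagonal := fun s => M.diagonal s
  off_diagonal := fun s t h => M.off_diagonal s t (fun e => h (Subtype.ext e))

/-- The linear form `v ↦ B(α_s, v)` on the real vector space with basis `(α_s)`, where
`B(α_s, α_t) = -cos (π / M_{st})`. The entry `M_{st} = ∞` is encoded by `0` in Mathlib; then
`π / 0 = 0` in Lean and the formula gives `-1`, as it should. -/
noncomputable def cosForm {S : Type*} (M : CoxeterMatrix S) (s : S) : (S →₀ ℝ) →ₗ[ℝ] ℝ :=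
  Finsupp.linearCombination ℝ (fun t => -Real.cos (Real.pi / M s t))

theorem cosForm_single {S : Type*} (M : CoxeterMatrix S) (s t : S) :
    M.cosForm s (Finsupp.single t 1) = -Real.cos (Real.pi / M s t) := by
  simp [cosForm]

theorem two_cosForm_self {S : Type*} (M : CoxeterMatrix S) (s : S) :
    ((2 : ℝ) • M.cosForm s) (Finsupp.single s 1) = 2 := by
  simp [cosForm_single]

/-- The involution `σ_s : v ↦ v - 2 B(α_s, v) α_s`. -/
noncomputable def simpleReflection {S : Type*} (M : CoxeterMatrix S) (s : S) :
    (S →₀ ℝ) ≃ₗ[ℝ] (S →₀ ℝ) :=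
  Module.reflection (M.two_cosForm_self s)

theorem simpleReflection_apply {S : Type*} (M : CoxeterMatrix S) (s : S) (v : S →₀ ℝ) :
    M.simpleReflection s v = v - (2 * M.cosForm s v) • Finsupp.single s 1 := by
  simp [simpleReflection, Module.reflection_apply]

/-- The involutions `σ_s` satisfy the Coxeter relations. -/
theorem isLiftable_simpleReflection {S : Type*} (M : CoxeterMatrix S) :
    M.IsLiftable M.simpleReflection := by
  intro s t
  rcases eq_or_ne s t with rfl | hst
  · rw [M.diagonal, pow_one]
    ext1 v
    exact Module.involutive_reflection (M.two_cosForm_self s) v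
  obtain h0 | h0 := Nat.eq_zero_or_pos (M s t)
  · rw [h0, pow_zero]
  have h1 : M s t ≠ 1 := M.off_diagonal s t hst
  have hsym : M t s = M s t := M.symmetric t s
  generalize hm : M s t = m at *
  have hmr : (0 : ℝ) < m := by exact_mod_cast h0
  set θ : ℝ := 2 * Real.pi / m with hθ
  have hf : ((2 : ℝ) • M.cosForm s) (Finsupp.single t 1) = -2 * Real.cos (Real.pi / m) := by
    simp [cosForm_single, hm]
  have hg : ((2 : ℝ) • M.cosForm t) (Finsupp.single s 1) = -2 * Real.cos (Real.pi / m) := by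
    simp [cosForm_single, hsym]
  have ht : 2 * Real.cos θ = ((2 : ℝ) • M.cosForm s) (Finsupp.single t 1) *
      ((2 : ℝ) • M.cosForm t) (Finsupp.single s 1) - 2 := by
    rw [hf, hg, hθ, mul_div_assoc, Real.cos_two_mul]
    ring
  ext1 v
  have key := Module.reflection_mul_reflection_pow_apply (M.two_cosForm_self s)
    (M.two_cosForm_self t) m v (2 * Real.cos θ) ht
  refine key.trans ?_
  rw [LinearEquiv.coe_one, id_eq]
  have hS : ∀ k : ℤ, ((Polynomial.Chebyshev.S ℝ k).eval (2 * Real.cos θ)) * Real.sin θ =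
      Real.sin ((k + 1) * θ) := fun k => Polynomial.Chebyshev.S_two_mul_real_cos θ k
  obtain h2 | h2 : m = 2 ∨ 3 ≤ m := by omega
  · subst h2
    have e1 : ((2 : ℝ) • M.cosForm s) (Finsupp.single t 1) = 0 := by rw [hf]; simp
    have e2 : ((2 : ℝ) • M.cosForm t) (Finsupp.single s 1) = 0 := by rw [hg]; simp
    have e3 : 2 * Real.cos θ = -2 := by rw [ht, e1, e2]; simp
    rw [e1, e2, e3]
    norm_num
    abel
  · have hsin : Real.sin θ ≠ 0 := by
      apply ne_of_gt
      apply Real.sin_pos_of_pos_of_lt_pi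
      · positivity
      · rw [hθ, div_lt_iff₀ hmr]
        have : (3 : ℝ) ≤ m := by exact_mod_cast h2
        nlinarith [Real.pi_pos]
    have hmθ : (m : ℝ) * θ = 2 * Real.pi := by
      rw [hθ]
      field_simp
    obtain ⟨k, rfl | rfl⟩ := Nat.even_or_odd' m
    · have z : (Polynomial.Chebyshev.S ℝ ((k : ℤ) - 1)).eval (2 * Real.cos θ) = 0 := by
        have := hS ((k : ℤ) - 1)
        have e : (((k : ℤ) - 1 : ℤ) + 1 : ℝ) * θ = Real.pi := by
          push_cast at hmθ ⊢
          linarith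
        rw [e, Real.sin_pi] at this
        exact (mul_eq_zero.mp this).resolve_right hsin
      have i1 : ((2 * k : ℕ) - 2 : ℤ) / 2 = (k : ℤ) - 1 := by omega
      have i2 : ((2 * k : ℕ) - 1 : ℤ) / 2 = (k : ℤ) - 1 := by omega
      rw [i1, i2, z]
      simp
    · have z : (Polynomial.Chebyshev.S ℝ (k : ℤ)).eval (2 * Real.cos θ) +
          (Polynomial.Chebyshev.S ℝ ((k : ℤ) - 1)).eval (2 * Real.cos θ) = 0 := by
        have a := hS (k : ℤ)
        have b := hS ((k : ℤ) - 1)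
        have e : (((k : ℤ) : ℝ) + 1) * θ = 2 * Real.pi - (((k : ℤ) - 1 : ℤ) + 1 : ℝ) * θ := by
          push_cast at hmθ ⊢
          linarith
        rw [e, Real.sin_two_pi_sub] at a
        have : ((Polynomial.Chebyshev.S ℝ (k : ℤ)).eval (2 * Real.cos θ) +
          (Polynomial.Chebyshev.S ℝ ((k : ℤ) - 1)).eval (2 * Real.cos θ)) * Real.sin θ = 0 := by
          rw [add_mul, a, b]
          ring
        exact (mul_eq_zero.mp this).resolve_right hsin
      have i1 : ((2 * k + 1 : ℕ) - 2 : ℤ) / 2 = (k : ℤ) - 1 := by omega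
      have i2 : ((2 * k + 1 : ℕ) - 1 : ℤ) / 2 = (k : ℤ) := by omega
      have i3 : ((2 * k + 1 : ℕ) - 3 : ℤ) / 2 = (k : ℤ) - 1 := by omega
      have i4 : ((2 * k + 1 : ℕ) : ℤ) / 2 = (k : ℤ) := by omega
      rw [i1, i2, i3, i4, z]
      simp

end CoxeterMatrix

namespace CoxeterSystem

section

variable {S : Type*} {W : Type*} [Group W] {M : CoxeterMatrix S} (cs : CoxeterSystem M W)

/-- The simple root `α_s = {w ∈ W | ℓ(sw) > ℓ(w)}`. -/
def simpleHalf (s : S) : Set W := {w | cs.length w < cs.length (cs.simple s * w)}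

/-- A root is a subset of `W` of the form `w α_s`. -/
def IsRoot (α : Set W) : Prop := ∃ (w : W) (s : S), α = w • cs.simpleHalf s

/-- The set `Φ` of roots. -/
def Root : Type _ := {α : Set W // cs.IsRoot α}

/-- The underlying subset of `W`. -/
def Root.half {cs : CoxeterSystem M W} (α : cs.Root) : Set W := α.1

/-- The simple root of index `s`. -/
def simpleRoot (s : S) : cs.Root := ⟨cs.simpleHalf s, 1, s, (one_smul _ _).symm⟩

/-- `W` acts on roots by left translation. -/
instance : SMul W cs.Root where
  smul w α := ⟨w • α.1, by
    obtain ⟨v, s, h⟩ := α.2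
    exact ⟨w * v, s, by rw [h, mul_smul]⟩⟩

theorem simple_smul_simpleHalf (s : S) :
    cs.simple s • cs.simpleHalf s = (cs.simpleHalf s)ᶜ := by
  ext w
  rw [Set.mem_smul_set_iff_inv_smul_mem]
  simp only [simpleHalf, Set.mem_ofPred_eq, Set.mem_compl_iff, smul_eq_mul, cs.inv_simple,
    cs.simple_mul_simple_cancel_left]
  have := cs.length_simple_mul_ne w s
  omega

/-- The opposite of a root is its complement. -/
instance : Neg cs.Root where
  neg α := ⟨α.1ᶜ, by
    obtain ⟨w, s, h⟩ := α.2
    exact ⟨w * cs.simple s, s, by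
      rw [h, mul_smul, simple_smul_simpleHalf, Set.smul_set_compl]⟩⟩

/-- The pair `{α, β}` is prenilpotent. -/
def Prenilpotent (α β : cs.Root) : Prop :=
  (α.half ∩ β.half).Nonempty ∧ ((-α).half ∩ (-β).half).Nonempty

/-- The open interval `]α, β[ = [α, β] \ {α, β}`. -/
def openInterval (α β : cs.Root) : Set cs.Root :=
  {γ | α.half ∩ β.half ⊆ γ.half ∧ (-α).half ∩ (-β).half ⊆ (-γ).half ∧ γ ≠ α ∧ γ ≠ β}

/-- The representation of `W` on the real vector space with basis `(α_s)`, with `s` acting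
as `σ_s`. -/
noncomputable def geometricRep : W →* ((S →₀ ℝ) ≃ₗ[ℝ] (S →₀ ℝ)) :=
  cs.lift ⟨M.simpleReflection, M.isLiftable_simpleReflection⟩

/-- The vector `v` is the root `α` seen as a linear form: `α = w α_s` and `v` is the image under
`w` of the basis vector of index `s`. -/
def IsLinearForm (α : cs.Root) (v : S →₀ ℝ) : Prop :=
  ∃ (w : W) (s : S), α = w • cs.simpleRoot s ∧ v = cs.geometricRep w (Finsupp.single s 1)

/-- The open linear interval: the roots other than `α` and `β` which, seen as linear forms,
are nonnegative linear combinations of `α` and `β`. -/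
def openLinearInterval (α β : cs.Root) : Set cs.Root :=
  {γ | (∃ a b c : S →₀ ℝ, cs.IsLinearForm α a ∧ cs.IsLinearForm β b ∧ cs.IsLinearForm γ c ∧
    ∃ x y : ℝ, 0 ≤ x ∧ 0 ≤ y ∧ c = x • a + y • b) ∧ γ ≠ α ∧ γ ≠ β}

/-- The special subgroup `W_J` generated by `J`. -/
def specialSubgroup (J : Set S) : Subgroup W := Subgroup.closure (cs.simple '' J)

end

end CoxeterSystem

/-! ### Groups with root subgroups -/

/-- The two signs indexing the two halves of a twin building. -/
inductive TwinSign where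
  | pos : TwinSign
  | neg : TwinSign

namespace TwinSign

/-- The opposite sign. -/
def opp : TwinSign → TwinSign
  | pos => neg
  | neg => pos

end TwinSign

namespace CoxeterSystem

/-- In a pair of opposite apartments, both identified with `W`, the root `α` determines the half
`α` of the positive apartment and the half `W \ α` (the chambers opposite to those of `-α`) of the
negative apartment. `α.Contains ε w`: the chamber `w` of sign `ε` lies in that half. In particular
`α.Contains .pos 1` says that `α` is positive and `α.Contains .neg 1` that it is negative. -/
def Root.Contains {S : Type*} {W : Type*} [Group W] {M : CoxeterMatrix S}
    {cs : CoxeterSystem M W} (α : cs.Root) : TwinSign → W → Prop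
  | .pos, w => w ∈ α.half
  | .neg, w => w ∉ α.half

end CoxeterSystem

/-- The data to which the (TRD) axioms apply: a group `G` with a subgroup `H` and a family of
subgroups indexed by the roots of a Coxeter system. -/
structure RootGroupData {S : Type*} {W : Type*} [Group W] {M : CoxeterMatrix S}
    (cs : CoxeterSystem M W) (G : Type*) [Group G] where
  H : Subgroup G
  U : cs.Root → Subgroup G

namespace RootGroupData

section

variable {S : Type*} {W : Type*} [Group W] {M : CoxeterMatrix S} {cs : CoxeterSystem M W}
  {G : Type*} [Group G] (D : RootGroupData cs G)

/-- The group `U_ε` generated by the root groups of sign `ε`. -/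
def unipotent (ε : TwinSign) : Subgroup G :=
  ⨆ (α : cs.Root) (_ : α.Contains ε 1), D.U α

/-- `x.1` and `x.2` are nontrivial elements of `U_{-α_s}` and `x.1 * u * x.2` conjugates `U_β`
onto `U_{sβ}` for every root `β`. -/
def IsReflectionPair (s : S) (u : G) (x : G × G) : Prop :=
  x.1 ∈ D.U (-cs.simpleRoot s) ∧ x.1 ≠ 1 ∧ x.2 ∈ D.U (-cs.simpleRoot s) ∧ x.2 ≠ 1 ∧
    ∀ β : cs.Root, MulAut.conj (x.1 * u * x.2) • D.U β = D.U (cs.simple s • β)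

/-- `m` is the element `m(u) = u' u u''`, where `u` is a nontrivial element of `U_{α_s}`. -/
def IsReflectionLift (s : S) (u m : G) : Prop :=
  u ∈ D.U (cs.simpleRoot s) ∧ u ≠ 1 ∧ ∃ x, D.IsReflectionPair s u x ∧ m = x.1 * u * x.2

/-- The axioms (TRD0), ..., (TRD4). In (TRD1) the pair consists of two distinct roots. -/
structure IsTRD : Prop where
  nontrivial : ∀ α, D.U α ≠ ⊥
  normalized : ∀ α, D.H ≤ Subgroup.normalizer (D.U α : Set G)
  commutator : ∀ α β, α ≠ β → cs.Prenilpotent α β →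
    ⁅D.U α, D.U β⁆ ≤ ⨆ γ ∈ cs.openInterval α β, D.U γ
  existsUnique_reflection : ∀ s, ∀ u ∈ D.U (cs.simpleRoot s), u ≠ 1 →
    ∃! x, D.IsReflectionPair s u x
  reflection_coset : ∀ s u v m m', D.IsReflectionLift s u m → D.IsReflectionLift s v m' →
    m⁻¹ * m' ∈ D.H
  not_le_neg : ∀ s, ¬ D.U (cs.simpleRoot s) ≤ D.unipotent .neg
  not_le_pos : ∀ s, ¬ D.U (-cs.simpleRoot s) ≤ D.unipotent .pos
  generated : D.H ⊔ ⨆ α, D.U α = ⊤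

/-- The (TRD) axioms, where (TRD1) also holds with linear intervals. -/
structure IsTRDLin : Prop extends D.IsTRD where
  commutator_lin : ∀ α β, α ≠ β → cs.Prenilpotent α β →
    ⁅D.U α, D.U β⁆ ≤ ⨆ γ ∈ cs.openLinearInterval α β, D.U γ

/-! ### The twin building -/

/-- The standard Borel subgroup `B_ε = H U_ε` (a subgroup, since `H` normalizes the root
groups). -/
def borel (ε : TwinSign) : Subgroup G := D.H ⊔ D.unipotent ε

/-- The graph of the epimorphism `ν : N → W`, where `N` is generated by `H` and the `m(u)`;
it is trivial on `H` and maps `m(u)` to `s` for `u` in `U_{α_s}`. -/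
def weylGraph : Subgroup (G × W) :=
  Subgroup.closure ({x | x.1 ∈ D.H ∧ x.2 = 1} ∪
    {x | ∃ s u, D.IsReflectionLift s u x.1 ∧ x.2 = cs.simple s})

/-- `n` is an element of `N` that lifts `w`. -/
def Lifts (n : G) (w : W) : Prop := (n, w) ∈ D.weylGraph

/-- The standard parabolic subgroup `P_{ε,J} = B_ε W_J B_ε`. -/
def parabolic (ε : TwinSign) (J : Set S) : Set G :=
  {x | ∃ b ∈ D.borel ε, ∃ n, ∃ w ∈ cs.specialSubgroup J, D.Lifts n w ∧
    ∃ b' ∈ D.borel ε, x = b * n * b'}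

/-- The chamber `g B_ε` of sign `ε`. -/
def chamber (ε : TwinSign) (g : G) : Set G := g • (D.borel ε : Set G)

/-- `F` is a facet of sign `ε` and type `J`: a translate of the standard parabolic subgroup.
A facet `F` is a face of a chamber `c` when `c ⊆ F` as subsets of `G`. The group `G` acts by left
translation. -/
def IsFacet (ε : TwinSign) (J : Set S) (F : Set G) : Prop :=
  ∃ g : G, F = g • D.parabolic ε J

/-- The set of chambers of the standard apartment of sign `ε`. -/
def stdApartment (ε : TwinSign) : Set (Set G) := {c | ∃ n w, D.Lifts n w ∧ c = D.chamber ε n}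

/-- Opposition of chambers of signs `ε` and `-ε`: `g B_ε` and `h B_{-ε}` are at codistance `1`,
that is `g⁻¹ h ∈ B_ε B_{-ε}`. -/
def ChambersOpposite (ε : TwinSign) (c d : Set G) : Prop :=
  ∃ g h : G, c = D.chamber ε g ∧ d = D.chamber ε.opp h ∧
    g⁻¹ * h ∈ (D.borel ε : Set G) * (D.borel ε.opp : Set G)

/-- `A` (the sets of chambers `A .pos` and `A .neg`) is a pair of opposite apartments: each is a
`G`-translate of the standard apartment of its sign, and each chamber of either one is opposite
to exactly one chamber of the other. -/
def IsOppositeApartments (A : TwinSign → Set (Set G)) : Prop :=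
  (∀ ε, ∃ g : G, A ε = g • D.stdApartment ε) ∧
    ∀ ε, ∀ c ∈ A ε, ∃! d, d ∈ A ε.opp ∧ D.ChambersOpposite ε c d

/-- `A` is the image under `g` of the standard pair of opposite apartments. Then
`g w B_ε ↦ w` identifies it with two copies of `W`, the roots of `A` are the `g α`, for `α` in
`Φ`, and the root group of `g α` is `g U_α g⁻¹`. -/
def IsTranslateOfStd (A : TwinSign → Set (Set G)) (g : G) : Prop :=
  ∀ ε, A ε = g • D.stdApartment ε

/-- The facet `F` of sign `ε` lies in the pair of apartments `A`. -/
def FacetIn (A : TwinSign → Set (Set G)) (ε : TwinSign) (F : Set G) : Prop :=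
  ∃ c ∈ A ε, c ⊆ F

/-- `F'` is the opposite `-F` in `A` of the facet `F` of sign `ε` and type `J`: the facet of
type `J` and sign `-ε` in `A` that is a face of the opposite of a chamber of `A` having `F` as
a face. -/
def IsOppositeFacet (A : TwinSign → Set (Set G)) (ε : TwinSign) (J : Set S) (F F' : Set G) :
    Prop :=
  D.IsFacet ε.opp J F' ∧
    ∃ c ∈ A ε, ∃ d ∈ A ε.opp, c ⊆ F ∧ d ⊆ F' ∧ D.ChambersOpposite ε c d

/-- `∂(gα) ⊃ F`: the wall of the root `g α` of the apartments `g A_std` contains the facet `F` of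
sign `ε`, i.e. `F` is a face of a chamber in `g α` and of a chamber in `-g α`. -/
def WallContains (g : G) (ε : TwinSign) (α : cs.Root) (F : Set G) : Prop :=
  (∃ n w, D.Lifts n w ∧ D.chamber ε (g * n) ⊆ F ∧ α.Contains ε w) ∧
    ∃ n w, D.Lifts n w ∧ D.chamber ε (g * n) ⊆ F ∧ ¬ α.Contains ε w

/-- `gα ⊃ F`: the facet `F` of sign `ε` lies in the open half-apartment `g α`, i.e. all chambers
of the apartment that have `F` as a face lie in `g α`. -/
def RootContains (g : G) (ε : TwinSign) (α : cs.Root) (F : Set G) : Prop :=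
  ∀ n w, D.Lifts n w → D.chamber ε (g * n) ⊆ F → α.Contains ε w

/-! ### Fixators and Levi factors -/

/-- The fixator in `G` of a facet. -/
def fixator (_D : RootGroupData cs G) (F : Set G) : Subgroup G := MulAction.stabilizer G F

/-- The data induced on a subgroup `L` by `g H g⁻¹` and the root groups `g U_α g⁻¹`, indexed by
the roots of the Coxeter system `(W_J, J)`: the root `β` of `W_J` corresponds to the root `α` of
`W` with `α ∩ W_J = β`. -/
def leviData (J : Set S) (csJ : CoxeterSystem (M.restrict J) (cs.specialSubgroup J)) (g : G)
    (L : Subgroup G) : RootGroupData csJ L where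
  H := (MulAut.conj g • D.H).subgroupOf L
  U := fun β => (⨆ (α : cs.Root) (_ : Subtype.val ⁻¹' α.half = β.half),
    MulAut.conj g • D.U α).subgroupOf L

end

end RootGroupData

/-- `P` is the internal semidirect product `L ⋉ U` of its subgroups `L` and `U`, with `U`
normal. -/
def IsInternalSemidirectProduct {G : Type*} [Group G] (P L U : Subgroup G) : Prop :=
  L ≤ P ∧ U ≤ P ∧ (U.subgroupOf P).Normal ∧ (L.subgroupOf P).IsComplement' (U.subgroupOf P)

/-!
Up to conjugation and a change of sign, `F` is the standard positive facet `P_J = B_+ W_J B_+`, whose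
fixator is `P_J` itself. Say that a root crosses `W_J` if it contains some but not all elements of
`W_J`. The Levi factor `L = D.levi J` is generated by `H` and the root groups of the roots that cross
`W_J`; the radical `V = D.radical J` is generated by the `L`-conjugates of the root groups of the
roots containing `W_J`. The claim amounts to `P_J = L ⋉ V`, with `L` satisfying (TRD) and equal to
the intersection of `P_J` with its opposite.

**Invariance of the radical.** Let `α` cross `W_J` and let `β ⊇ W_J`. All roots in `]α, β[` contain
`W_J` if `W_J` is finite, by counting (`CoxeterSystem.Root.Crosses.special_subset_of_finite`), and
all roots in `]α, β[` in the linear sense contain `W_J` in general, because of a coordinate outside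
`J` (`CoxeterSystem.special_subset_of_mem_openLinearInterval`). This is the only use of the
hypothesis that `F` is spherical or `G` is a (TRD)`_lin`-group (`RootGroupData.LeviCondition`). For a
prenilpotent pair `{α, β}` the commutator condition then keeps `[U_α, U_β]` inside `V`. If
`{-α_s, β}` with `s ∈ J` is not prenilpotent, then `{α_s, β}` is, and an element of `U_{-α_s}` can
be written as `x n x'` with `x, x' ∈ U_{α_s}` and `n` a lift of `s`
(`RootGroupData.IsTRD.conj_outerUnipotent_mem_radical`). Hence `L` normalizes `V`
(`RootGroupData.IsTRD.levi_conj_radical`), and `P_J = L V`.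

**The Birkhoff decomposition.** That `L` meets `V` trivially rests on `U_- ∩ B_+ = 1` and on the
disjointness of the double cosets `B_- w B_+` (`RootGroupData.IsTRD.birkhoff_unique`), for which the
axioms offer only `U_{α_s} ⊄ U_-` and `U_{-α_s} ⊄ U_+`. These give the Bruhat decomposition, hence
the building with chambers `g B_+`. Consider the pairs `(w, u U_w)` with `u ∈ U_-`, where `U_w` is
generated by the root groups of the negative roots containing `w`; such a pair lies over the chamber
`u w B_+`. With a suitable adjacency relation these pairs cover the building, and the covering
is an isomorphism on residues with a longest element. As a building is simply connected with respect
to its residues of rank two, lifting minimal galleries from `B_+` gives a well-defined section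
(`RootGroupData.IsTRD.reach_unique`). The section is equivariant under `U_-`
(`RootGroupData.IsTRD.isSection_smul`) and maps `w B_+` to `(w, U_w)`, so that the chamber `u w B_+`
determines `w` and `u U_w`.

**The Levi factor.** By faithfulness of the geometric representation `(W_J, J)` is a Coxeter system,
and intersecting with `W_J` is a bijection from the roots that cross `W_J` to the roots of `W_J`
(`CoxeterSystem.exists_crosses_of_specialRoot`). The axioms for `L` follow from those for `G`
(`RootGroupData.IsLeviModel.isTRD`); in the linear case one needs in addition that a root whose
vector is supported on `J` crosses `W_J` (`CoxeterSystem.IsLinearForm.crosses_of_support`). The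
Birkhoff decomposition of `L` itself now yields `L ∩ V = 1`
(`RootGroupData.IsTRD.eq_one_of_mem_levi_of_mem_radical`) and that `L` is the intersection of the two
opposite parabolic subgroups (`RootGroupData.IsTRD.mem_levi_of_mem_parabolic`).

**Opposite apartments.** Every pair of opposite apartments is a translate of the standard one
(`RootGroupData.IsTRD.exists_isTranslateOfStd`): if `b ∈ B_+` and the apartment `{b w B_+}` has only
one chamber opposite to `B_-`, then by descending induction `b w B_+` has codistance `w` from
`B_-`, which forces `b w B_+ = w B_+`
(`RootGroupData.IsTRD.inv_mul_mul_mem_borel_of_forall`).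
-/

/-! ### The geometric representation -/

namespace CoxeterSystem

open Polynomial

section Geometry

variable {S : Type*} {W : Type*} [Group W] {M : CoxeterMatrix S} (cs : CoxeterSystem M W)

theorem geometricRep_simple_apply (s : S) (v : S →₀ ℝ) :
    cs.geometricRep (cs.simple s) v = v - (2 * M.cosForm s v) • Finsupp.single s 1 := by
  rw [geometricRep, cs.lift_apply_simple, M.simpleReflection_apply]

theorem geometricRep_mul_apply (w w' : W) (v : S →₀ ℝ) :
    cs.geometricRep (w * w') v = cs.geometricRep w (cs.geometricRep w' v) := by
  rw [map_mul]; rfl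

theorem geometricRep_one_apply (v : S →₀ ℝ) : cs.geometricRep 1 v = v := by
  rw [map_one]; rfl

theorem geometricRep_simple_self (s : S) :
    cs.geometricRep (cs.simple s) (Finsupp.single s 1) = -Finsupp.single s 1 := by
  rw [geometricRep_simple_apply, M.cosForm_single, M.diagonal]
  simp only [Nat.cast_one, div_one, Real.cos_pi, neg_neg, mul_one]
  rw [two_smul]; abel

theorem geometricRep_apply_simple_ne_zero (w : W) (s : S) :
    cs.geometricRep w (Finsupp.single s 1) ≠ 0 := by
  simp

theorem chebyshev_eval_two_cos_nonneg {m k : ℕ} (h : m = 0 ∨ k ≤ m) :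
    0 ≤ (Chebyshev.S ℝ ((k : ℤ) - 1)).eval (2 * Real.cos (Real.pi / m)) := by
  obtain rfl | hm := Nat.eq_zero_or_pos m
  · simp
  obtain rfl | hm1 := eq_or_ne m 1
  · have hk : k = 0 ∨ k = 1 := by omega
    rcases hk with rfl | rfl <;> simp
  have hkm : k ≤ m := by omega
  have hm2 : (2 : ℝ) ≤ m := by exact_mod_cast (by omega : 2 ≤ m)
  have hsin : 0 < Real.sin (Real.pi / m) := by
    apply Real.sin_pos_of_pos_of_lt_pi
    · positivity
    · rw [div_lt_iff₀ (by linarith)]; nlinarith [Real.pi_pos]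
  have e := Chebyshev.S_two_mul_real_cos (Real.pi / m) ((k : ℤ) - 1)
  have h1 : 0 ≤ Real.sin (((((k : ℤ) - 1 : ℤ) : ℝ) + 1) * (Real.pi / m)) := by
    push_cast
    apply Real.sin_nonneg_of_nonneg_of_le_pi
    · simp; positivity
    · have : (k : ℝ) ≤ m := by exact_mod_cast hkm
      rw [sub_add_cancel, mul_div_assoc', div_le_iff₀ (by linarith)]
      nlinarith [Real.pi_pos]
  rw [← e] at h1
  exact nonneg_of_mul_nonneg_left h1 hsin

/-- The action of an alternating word on the basis vector of index `s`: the coefficients are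
the values `sin (kθ) / sin θ` of Chebyshev polynomials, with `θ = π / M_{st}`. -/
theorem geometricRep_alternatingWord (s t : S) (k : ℕ) :
    cs.geometricRep (cs.wordProd (alternatingWord s t k)) (Finsupp.single s 1) =
      (Chebyshev.S ℝ (k : ℤ)).eval (2 * Real.cos (Real.pi / M s t)) •
        Finsupp.single (if Even k then s else t) 1 +
      (Chebyshev.S ℝ ((k : ℤ) - 1)).eval (2 * Real.cos (Real.pi / M s t)) •
        Finsupp.single (if Even k then t else s) (1 : ℝ) := by
  induction k with
  | zero => simp [alternatingWord]
  | succ k ih =>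
    have hrec : (Chebyshev.S ℝ ((k : ℤ) + 1)).eval (2 * Real.cos (Real.pi / M s t)) =
        2 * Real.cos (Real.pi / M s t) *
          (Chebyshev.S ℝ (k : ℤ)).eval (2 * Real.cos (Real.pi / M s t)) -
        (Chebyshev.S ℝ ((k : ℤ) - 1)).eval (2 * Real.cos (Real.pi / M s t)) := by
      have := Chebyshev.S_add_two ℝ ((k : ℤ) - 1)
      rw [show (k : ℤ) - 1 + 2 = k + 1 by ring, show (k : ℤ) - 1 + 1 = k by ring] at this
      rw [this]; simp
    rw [alternatingWord_succ', cs.wordProd_cons, geometricRep_mul_apply, ih]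
    push_cast
    rw [add_sub_cancel_right, hrec]
    simp only [map_add, map_smul, geometricRep_simple_apply, M.cosForm_single]
    by_cases hk : Even k
    · have hk' : ¬ Even (k + 1) := by simpa [Nat.even_add_one] using hk
      simp only [hk, hk', if_true, if_false, M.diagonal, M.symmetric t s, Nat.cast_one,
        div_one, Real.cos_pi]
      module
    · have hk' : Even (k + 1) := by simpa [Nat.even_add_one] using hk
      simp only [hk, hk', if_true, if_false, M.diagonal, Nat.cast_one,
        div_one, Real.cos_pi]
      module

/-- The fundamental property of the geometric representation: if `ℓ(ws) > ℓ(w)` then `w` sends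
the basis vector of index `s` to a vector with nonnegative coordinates. -/
theorem geometricRep_nonneg {w : W} {s : S} (h : cs.length w < cs.length (w * cs.simple s)) :
    0 ≤ cs.geometricRep w (Finsupp.single s 1) := by
  induction hn : cs.length w using Nat.strong_induction_on generalizing w s with
  | _ n ih =>
  subst hn
  obtain rfl | hw := eq_or_ne w 1
  · rw [geometricRep_one_apply]; exact Finsupp.single_nonneg.2 zero_le_one
  obtain ⟨t, ht⟩ := cs.exists_rightDescent_of_ne_one hw
  have hst : s ≠ t := by rintro rfl; exact absurd ht (by simp [IsRightDescent]; omega)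
  -- a factorisation of `w` with a longest possible alternating suffix ending in `t`
  let P : ℕ → Prop := fun k => ∃ v, w = v * cs.wordProd (alternatingWord s t k) ∧
    cs.length w = cs.length v + k
  have hP1 : P 1 := ⟨w * cs.simple t, by simp [alternatingWord], by
    rw [cs.isRightDescent_iff] at ht; omega⟩
  obtain ⟨k, ⟨v, hwv, hl⟩, hmax, hk1⟩ : ∃ k, P k ∧ ¬ P (k + 1) ∧ 1 ≤ k := by
    by_contra hcon
    push Not at hcon
    have : ∀ k, 1 ≤ k → P k := by
      intro k hk
      induction k, hk using Nat.le_induction with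
      | base => exact hP1
      | succ k hk ihk =>
        by_contra h'
        have := hcon k ihk h'
        omega
    obtain ⟨v, -, hv⟩ := this (cs.length w + 1) (by omega)
    omega
  have key : ∀ r, r = s ∨ r = t → cs.length v < cs.length (v * cs.simple r) := by
    intro r hr
    by_contra hcon
    have hne := cs.length_mul_simple v r
    have hr' : r = (if Even k then t else s) ∨ r ≠ (if Even k then t else s) := em _
    rcases hr' with hr' | hr'
    · refine hmax ⟨v * cs.simple r, ?_, by omega⟩
      rw [alternatingWord_succ', ← hr', cs.wordProd_cons, mul_assoc,
        cs.simple_mul_simple_cancel_left, ← hwv]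
    · obtain ⟨j, rfl⟩ : ∃ j, k = j + 1 := ⟨k - 1, by omega⟩
      have hr2 : r = (if Even j then t else s) := by
        by_cases hj : Even j
        · have : ¬ Even (j + 1) := by simpa [Nat.even_add_one] using hj
          simp only [this, hj, if_true, if_false] at hr' ⊢
          tauto
        · have : Even (j + 1) := by simpa [Nat.even_add_one] using hj
          simp only [this, hj, if_true, if_false] at hr' ⊢
          tauto
      rw [alternatingWord_succ', ← hr2, cs.wordProd_cons, ← mul_assoc] at hwv
      have h1 := cs.length_mul_le (v * cs.simple r) (cs.wordProd (alternatingWord s t j))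
      have h2 := cs.length_wordProd_le (alternatingWord s t j)
      rw [length_alternatingWord] at h2
      rw [← hwv] at h1
      omega
  have hv : cs.length v < cs.length w := by omega
  have hvs := ih _ hv (key s (Or.inl rfl)) rfl
  have hvt := ih _ hv (key t (Or.inr rfl)) rfl
  have hkm : M s t = 0 ∨ k + 1 ≤ M s t := by
    by_contra hcon
    push Not at hcon
    have hred := cs.not_isReduced_alternatingWord t s (m := k + 1)
      (by rw [M.symmetric t s]; exact hcon.1) (by rw [M.symmetric t s]; omega)
    rw [alternatingWord_succ, IsReduced] at hred
    have h0 := cs.length_wordProd_le ((alternatingWord s t k).concat s)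
    have h1 := cs.length_mul_le v (cs.wordProd ((alternatingWord s t k).concat s))
    rw [cs.wordProd_concat, ← mul_assoc, ← hwv] at h1
    simp only [List.length_concat, length_alternatingWord] at h0 hred
    rw [cs.wordProd_concat] at h0 hred
    omega
  have e : cs.geometricRep w (Finsupp.single s 1) = cs.geometricRep v
      (cs.geometricRep (cs.wordProd (alternatingWord s t k)) (Finsupp.single s 1)) := by
    rw [← geometricRep_mul_apply, ← hwv]
  rw [e, geometricRep_alternatingWord, map_add, map_smul, map_smul]
  have c1 := chebyshev_eval_two_cos_nonneg (m := M s t) (k := k + 1) hkm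
  have c2 := chebyshev_eval_two_cos_nonneg (m := M s t) (k := k) (by omega)
  push_cast at c1
  rw [add_sub_cancel_right] at c1
  have hv1 : ∀ r, r = s ∨ r = t → 0 ≤ cs.geometricRep v (Finsupp.single r 1) := by
    rintro r (rfl | rfl) <;> assumption
  exact add_nonneg (smul_nonneg c1 (hv1 _ (by split_ifs <;> simp)))
    (smul_nonneg c2 (hv1 _ (by split_ifs <;> simp)))

end Geometry
end CoxeterSystem

/-! ### Roots as half-spaces -/

namespace CoxeterSystem

section Roots

variable {S : Type*} {W : Type*} [Group W] {M : CoxeterMatrix S} (cs : CoxeterSystem M W)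

theorem geometricRep_nonpos {w : W} {s : S} (h : cs.length (w * cs.simple s) < cs.length w) :
    cs.geometricRep w (Finsupp.single s 1) ≤ 0 := by
  have h1 : cs.length (w * cs.simple s) < cs.length (w * cs.simple s * cs.simple s) := by
    rwa [cs.simple_mul_simple_cancel_right]
  have h2 := cs.geometricRep_nonneg h1
  rw [geometricRep_mul_apply, geometricRep_simple_self, map_neg] at h2
  exact neg_nonneg.1 h2

theorem geometricRep_nonneg_iff (w : W) (s : S) :
    0 ≤ cs.geometricRep w (Finsupp.single s 1) ↔ cs.length w < cs.length (w * cs.simple s) := by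
  refine ⟨fun h => ?_, cs.geometricRep_nonneg⟩
  by_contra hcon
  have hne := cs.length_mul_simple_ne w s
  exact cs.geometricRep_apply_simple_ne_zero w s
    (le_antisymm (cs.geometricRep_nonpos (by omega)) h)

theorem geometricRep_nonpos_iff (w : W) (s : S) :
    cs.geometricRep w (Finsupp.single s 1) ≤ 0 ↔ cs.length (w * cs.simple s) < cs.length w := by
  refine ⟨fun h => ?_, cs.geometricRep_nonpos⟩
  by_contra hcon
  have hne := cs.length_mul_simple_ne w s
  exact cs.geometricRep_apply_simple_ne_zero w s
    (le_antisymm h (cs.geometricRep_nonneg (by omega)))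

theorem mem_simpleHalf_iff_length (w : W) (s : S) :
    w ∈ cs.simpleHalf s ↔ cs.length w⁻¹ < cs.length (w⁻¹ * cs.simple s) := by
  have h : w⁻¹ * cs.simple s = (cs.simple s * w)⁻¹ := by rw [mul_inv_rev, cs.inv_simple]
  rw [h, cs.length_inv, cs.length_inv]
  rfl

theorem mem_simpleHalf_iff (w : W) (s : S) :
    w ∈ cs.simpleHalf s ↔ 0 ≤ cs.geometricRep w⁻¹ (Finsupp.single s 1) := by
  rw [mem_simpleHalf_iff_length, geometricRep_nonneg_iff]

variable {cs}

theorem Root.ext_half {α β : cs.Root} (h : α.half = β.half) : α = β := Subtype.ext h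

theorem half_neg (α : cs.Root) : (-α).half = α.halfᶜ := rfl

theorem mem_half_neg {α : cs.Root} {w : W} : w ∈ (-α).half ↔ w ∉ α.half := Iff.rfl

theorem half_smul (w : W) (α : cs.Root) : (w • α).half = w • α.half := rfl

theorem mem_half_smul {w v : W} {α : cs.Root} : v ∈ (w • α).half ↔ w⁻¹ * v ∈ α.half := by
  rw [half_smul, Set.mem_smul_set_iff_inv_smul_mem, smul_eq_mul]

instance : MulAction W cs.Root where
  one_smul α := Root.ext_half (one_smul W α.half)
  mul_smul v w α := Root.ext_half (mul_smul v w α.half)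

instance : InvolutiveNeg cs.Root where
  neg_neg α := Root.ext_half (compl_compl α.half)

theorem smul_neg_root (w : W) (α : cs.Root) : w • (-α) = -(w • α) :=
  Root.ext_half (Set.smul_set_compl (a := w) (s := α.half))

variable (cs)

theorem half_simpleRoot (s : S) : (cs.simpleRoot s).half = cs.simpleHalf s := rfl

theorem one_mem_simpleRoot (s : S) : 1 ∈ (cs.simpleRoot s).half := by
  simp [half_simpleRoot, simpleHalf]

theorem simple_notMem_simpleRoot (s : S) : cs.simple s ∉ (cs.simpleRoot s).half := by
  simp [half_simpleRoot, simpleHalf]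

theorem simple_smul_simpleRoot (s : S) : cs.simple s • cs.simpleRoot s = -cs.simpleRoot s :=
  Root.ext_half (cs.simple_smul_simpleHalf s)

theorem simple_smul_neg_simpleRoot (s : S) :
    cs.simple s • (-cs.simpleRoot s) = cs.simpleRoot s := by
  rw [smul_neg_root, simple_smul_simpleRoot, neg_neg]

theorem exists_eq_smul_simpleRoot (α : cs.Root) : ∃ (w : W) (s : S), α = w • cs.simpleRoot s := by
  obtain ⟨w, s, h⟩ := α.2
  exact ⟨w, s, Root.ext_half h⟩

theorem one_mem_smul_simpleRoot_iff (w : W) (s : S) :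
    1 ∈ (w • cs.simpleRoot s).half ↔ cs.length w < cs.length (w * cs.simple s) := by
  rw [mem_half_smul, half_simpleRoot, mem_simpleHalf_iff_length]
  simp

variable {cs}

theorem exists_isLinearForm (α : cs.Root) : ∃ a, cs.IsLinearForm α a := by
  obtain ⟨w, s, h⟩ := cs.exists_eq_smul_simpleRoot α
  exact ⟨_, w, s, h, rfl⟩

theorem IsLinearForm.smul {α : cs.Root} {a : S →₀ ℝ} (h : cs.IsLinearForm α a) (w : W) :
    cs.IsLinearForm (w • α) (cs.geometricRep w a) := by
  obtain ⟨v, s, rfl, rfl⟩ := h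
  exact ⟨w * v, s, by rw [mul_smul], by rw [geometricRep_mul_apply]⟩

theorem IsLinearForm.neg {α : cs.Root} {a : S →₀ ℝ} (h : cs.IsLinearForm α a) :
    cs.IsLinearForm (-α) (-a) := by
  obtain ⟨v, s, rfl, rfl⟩ := h
  exact ⟨v * cs.simple s, s, by rw [mul_smul, simple_smul_simpleRoot, smul_neg_root], by
    rw [geometricRep_mul_apply, geometricRep_simple_self, map_neg]⟩

theorem IsLinearForm.ne_zero {α : cs.Root} {a : S →₀ ℝ} (h : cs.IsLinearForm α a) : a ≠ 0 := by
  obtain ⟨v, s, rfl, rfl⟩ := h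
  exact cs.geometricRep_apply_simple_ne_zero v s

theorem IsLinearForm.mem_iff {α : cs.Root} {a : S →₀ ℝ} (h : cs.IsLinearForm α a) (w : W) :
    w ∈ α.half ↔ 0 ≤ cs.geometricRep w⁻¹ a := by
  obtain ⟨v, s, rfl, rfl⟩ := h
  rw [mem_half_smul, half_simpleRoot, mem_simpleHalf_iff, ← geometricRep_mul_apply]
  simp

theorem IsLinearForm.notMem_iff {α : cs.Root} {a : S →₀ ℝ} (h : cs.IsLinearForm α a) (w : W) :
    w ∉ α.half ↔ cs.geometricRep w⁻¹ a ≤ 0 := by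
  rw [← mem_half_neg, h.neg.mem_iff, map_neg, neg_nonneg]

/-- A vector between nonnegative and its image under `σ_s` nonpositive is a multiple of the basis
vector of index `s`, because `σ_s` changes only the coordinate of index `s`. -/
theorem eq_smul_single_of_nonneg_of_nonpos {a : S →₀ ℝ} {s : S} (h0 : 0 ≤ a)
    (h1 : cs.geometricRep (cs.simple s) a ≤ 0) : a = a s • Finsupp.single s 1 := by
  ext i
  obtain rfl | hi := eq_or_ne i s
  · simp
  · have h2 := h1 i
    have h3 := h0 i
    simp only [geometricRep_simple_apply, Finsupp.coe_sub, Pi.sub_apply, Finsupp.coe_smul,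
      Pi.smul_apply, Finsupp.single_eq_of_ne hi, Finsupp.coe_zero, Pi.zero_apply, smul_eq_mul,
      mul_zero, sub_zero] at h2 h3 ⊢
    exact le_antisymm h2 h3

/-- A root is determined by any pair of adjacent chambers that it separates. -/
theorem eq_smul_simpleRoot_of_separates {α : cs.Root} {w : W} {s : S} (h0 : w ∈ α.half)
    (h1 : w * cs.simple s ∉ α.half) : α = w • cs.simpleRoot s := by
  obtain ⟨a, ha⟩ := exists_isLinearForm α
  have ha' := ha.smul w⁻¹
  rw [ha.mem_iff] at h0
  rw [ha.notMem_iff, mul_inv_rev, cs.inv_simple, geometricRep_mul_apply] at h1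
  have e := eq_smul_single_of_nonneg_of_nonpos h0 h1
  set c := cs.geometricRep w⁻¹ a s
  have hc : 0 < c := by
    rcases (h0 s).lt_or_eq with h | h
    · exact h
    · exact absurd (by rw [e, show c = 0 from h.symm, zero_smul]) ha'.ne_zero
  rw [← inv_smul_eq_iff]
  apply Root.ext_half
  ext v
  rw [ha'.mem_iff, half_simpleRoot, mem_simpleHalf_iff, e, map_smul]
  exact ⟨fun h => (by simpa [smul_smul, hc.ne'] using smul_nonneg (inv_nonneg.2 hc.le) h),
    fun h => smul_nonneg hc.le h⟩

theorem smul_simpleRoot_eq_or_eq_neg {w : W} {s t : S}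
    (h : w * cs.simple s = cs.simple t * w) :
    w • cs.simpleRoot s = cs.simpleRoot t ∨ w • cs.simpleRoot s = -cs.simpleRoot t := by
  have hneg : cs.simple t • w • cs.simpleRoot s = -(w • cs.simpleRoot s) := by
    rw [← mul_smul, ← h, mul_smul, simple_smul_simpleRoot, smul_neg_root]
  have key : ∀ α : cs.Root, cs.simple t • α = -α → 1 ∈ α.half → α = cs.simpleRoot t := by
    intro α hα h1
    have h2 : 1 * cs.simple t ∉ α.half := by
      rw [← mem_half_neg, ← hα, mem_half_smul]
      simpa using h1
    rw [eq_smul_simpleRoot_of_separates h1 h2, one_smul]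
  by_cases h1 : 1 ∈ (w • cs.simpleRoot s).half
  · exact Or.inl (key _ hneg h1)
  · right
    rw [← key (-(w • cs.simpleRoot s)) (by rw [smul_neg_root, hneg]) h1, neg_neg]

/-- A set containing `w` but not the element `v` of `w W_J` separates two adjacent elements of
`w W_J`. -/
theorem exists_adjacent_separated {A : Set W} {J : Set S} {w v : W}
    (hwv : w⁻¹ * v ∈ cs.specialSubgroup J) (hw : w ∈ A) (hv : v ∉ A) :
    ∃ x, w⁻¹ * x ∈ cs.specialSubgroup J ∧ ∃ j ∈ J, x ∈ A ∧ x * cs.simple j ∉ A := by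
  by_contra hcon
  push Not at hcon
  have key : ∀ y ∈ cs.specialSubgroup J, w * y ∈ A := by
    intro y hy
    induction hy using Subgroup.closure_induction_right with
    | one => simpa using hw
    | mul_right x hx y hy ih =>
      obtain ⟨j, hj, rfl⟩ := hy
      rw [← mul_assoc]
      exact hcon _ (by rw [inv_mul_cancel_left]; exact hx) j hj ih
    | mul_inv_cancel x hx y hy ih =>
      obtain ⟨j, hj, rfl⟩ := hy
      rw [← mul_assoc, cs.inv_simple]
      exact hcon _ (by rw [inv_mul_cancel_left]; exact hx) j hj ih
  exact hv (by simpa using key _ hwv)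

theorem exists_eq_smul_simpleRoot_of_crosses {α : cs.Root} {J : Set S} {w v : W}
    (hwv : w⁻¹ * v ∈ cs.specialSubgroup J) (hw : w ∈ α.half) (hv : v ∉ α.half) :
    ∃ x, w⁻¹ * x ∈ cs.specialSubgroup J ∧ ∃ j ∈ J, α = x • cs.simpleRoot j := by
  obtain ⟨x, hx, j, hj, h1, h2⟩ := exists_adjacent_separated hwv hw hv
  exact ⟨x, hx, j, hj, eq_smul_simpleRoot_of_separates h1 h2⟩

/-- A root is determined by its intersection with a special subgroup that it crosses. -/
theorem eq_of_half_inter_special_eq {α β : cs.Root} {J : Set S} {w v : W}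
    (hw : w ∈ cs.specialSubgroup J) (hv : v ∈ cs.specialSubgroup J) (hwα : w ∈ α.half)
    (hvα : v ∉ α.half) (h : ∀ x ∈ cs.specialSubgroup J, x ∈ α.half ↔ x ∈ β.half) : α = β := by
  obtain ⟨x, hx, j, hj, h1, h2⟩ :=
    exists_adjacent_separated (mul_mem (inv_mem hw) hv) hwα hvα
  have hx' : x ∈ cs.specialSubgroup J := by simpa using mul_mem hw hx
  have hxj : x * cs.simple j ∈ cs.specialSubgroup J :=
    mul_mem hx' (Subgroup.subset_closure ⟨j, hj, rfl⟩)
  rw [eq_smul_simpleRoot_of_separates h1 h2,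
    eq_smul_simpleRoot_of_separates ((h _ hx').1 h1) (fun h' => h2 ((h _ hxj).2 h'))]

end Roots
end CoxeterSystem

/-! ### Special subgroups -/

namespace CoxeterSystem

section Special

variable {S : Type*} {W : Type*} [Group W] {M : CoxeterMatrix S} (cs : CoxeterSystem M W)
  (J : Set S)

/-- The inclusion of the span of the basis vectors with index in `J`. -/
noncomputable def spanEmbedding (J : Set S) : (J →₀ ℝ) →ₗ[ℝ] (S →₀ ℝ) :=
  Finsupp.lmapDomain ℝ ℝ Subtype.val

theorem spanEmbedding_single (j : J) (c : ℝ) :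
    spanEmbedding J (Finsupp.single j c) = Finsupp.single (j : S) c := by
  simp [spanEmbedding]

theorem spanEmbedding_apply_mem (v : J →₀ ℝ) (j : J) : spanEmbedding J v j = v j :=
  Finsupp.mapDomain_apply Subtype.val_injective v j

theorem spanEmbedding_apply_notMem (v : J →₀ ℝ) {i : S} (hi : i ∉ J) :
    spanEmbedding J v i = 0 :=
  Finsupp.mapDomain_of_notMem_range v i (by simpa using hi)

theorem spanEmbedding_injective : Function.Injective (spanEmbedding J) :=
  Finsupp.mapDomain_injective Subtype.val_injective

theorem spanEmbedding_nonneg_iff (v : J →₀ ℝ) : 0 ≤ spanEmbedding J v ↔ 0 ≤ v := by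
  constructor
  · intro h j
    have := h j
    rwa [spanEmbedding_apply_mem] at this
  · intro h i
    by_cases hi : i ∈ J
    · rw [show i = ((⟨i, hi⟩ : J) : S) from rfl, spanEmbedding_apply_mem]
      exact h _
    · rw [spanEmbedding_apply_notMem J v hi]
      exact le_rfl

theorem cosForm_restrict (j : J) (v : J →₀ ℝ) :
    (M.restrict J).cosForm j v = M.cosForm j (spanEmbedding J v) := by
  have : (M.restrict J).cosForm j = (M.cosForm j).comp (spanEmbedding J) := by
    ext k
    simp only [LinearMap.comp_apply, Finsupp.lsingle_apply, spanEmbedding_single]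
    rw [CoxeterMatrix.cosForm_single, CoxeterMatrix.cosForm_single]
    rfl
  rw [this]; rfl

variable {J}

theorem spanEmbedding_geometricRep {W' : Type*} [Group W'] (csJ : CoxeterSystem (M.restrict J) W')
    (f : W' →* W) (hf : ∀ j, f (csJ.simple j) = cs.simple j) (x : W') (v : J →₀ ℝ) :
    spanEmbedding J (csJ.geometricRep x v) = cs.geometricRep (f x) (spanEmbedding J v) := by
  induction x using csJ.simple_induction_left with
  | one => simp
  | mul_simple_left w i ih =>
    rw [map_mul f, geometricRep_mul_apply, geometricRep_mul_apply, ← ih, hf,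
      geometricRep_simple_apply, geometricRep_simple_apply, map_sub, map_smul,
      spanEmbedding_single, cosForm_restrict]

variable (J)

theorem isLiftable_simple_restrict :
    (M.restrict J).IsLiftable (fun j : J => cs.simple j) :=
  fun s t => cs.simple_mul_simple_pow s t

/-- The homomorphism from the Coxeter group of the restricted matrix. -/
noncomputable def restrictHom : (M.restrict J).Group →* W :=
  (M.restrict J).toCoxeterSystem.lift ⟨_, cs.isLiftable_simple_restrict J⟩

theorem restrictHom_simple (j : J) :
    cs.restrictHom J ((M.restrict J).toCoxeterSystem.simple j) = cs.simple j :=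
  (M.restrict J).toCoxeterSystem.lift_apply_simple (cs.isLiftable_simple_restrict J) j

/-- Injectivity follows from the faithfulness of the geometric representation, because the
geometric representation of the restricted matrix is a subrepresentation. -/
theorem restrictHom_injective : Function.Injective (cs.restrictHom J) := by
  rw [injective_iff_map_eq_one]
  intro x hx
  by_contra hne
  obtain ⟨j, hj⟩ := (M.restrict J).toCoxeterSystem.exists_rightDescent_of_ne_one hne
  have h1 := (M.restrict J).toCoxeterSystem.geometricRep_nonpos hj
  have h2 := cs.spanEmbedding_geometricRep _ _ (cs.restrictHom_simple J) x
    (Finsupp.single j (1 : ℝ))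
  rw [hx, geometricRep_one_apply] at h2
  rw [spanEmbedding_injective J h2] at h1
  have := h1 j
  norm_num at this

theorem range_restrictHom : (cs.restrictHom J).range = cs.specialSubgroup J := by
  rw [MonoidHom.range_eq_map, ← (M.restrict J).toCoxeterSystem.subgroup_closure_range_simple,
    MonoidHom.map_closure, specialSubgroup]
  congr 1
  ext w
  simp only [Set.mem_image, Set.mem_range, exists_exists_eq_and, restrictHom_simple]
  simp

/-- The Coxeter system `(W_J, J)`. -/
noncomputable def specialSystem : CoxeterSystem (M.restrict J) (cs.specialSubgroup J) :=
  (M.restrict J).toCoxeterSystem.map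
    ((MonoidHom.ofInjective (cs.restrictHom_injective J)).trans
      (MulEquiv.subgroupCongr (cs.range_restrictHom J)))

theorem coe_specialSystem_simple (j : J) :
    ((cs.specialSystem J).simple j : W) = cs.simple j := by
  rw [specialSystem, map_simple]
  exact cs.restrictHom_simple J j

theorem spanEmbedding_specialSystem (x : cs.specialSubgroup J) (v : J →₀ ℝ) :
    spanEmbedding J ((cs.specialSystem J).geometricRep x v) =
      cs.geometricRep (x : W) (spanEmbedding J v) :=
  cs.spanEmbedding_geometricRep (cs.specialSystem J) (cs.specialSubgroup J).subtype
    (cs.coe_specialSystem_simple J) x v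

theorem mem_specialSystem_simpleHalf (x : cs.specialSubgroup J) (j : J) :
    x ∈ (cs.specialSystem J).simpleHalf j ↔ (x : W) ∈ cs.simpleHalf j := by
  rw [mem_simpleHalf_iff, mem_simpleHalf_iff, ← spanEmbedding_nonneg_iff,
    spanEmbedding_specialSystem, spanEmbedding_single]
  rfl

variable {J} {cs}

theorem simple_mem_special {j : S} (hj : j ∈ J) : cs.simple j ∈ cs.specialSubgroup J :=
  Subgroup.subset_closure ⟨j, hj, rfl⟩

theorem mem_specialSubgroup_singleton {s : S} {w : W} (hw : w ∈ cs.specialSubgroup {s}) :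
    w = 1 ∨ w = cs.simple s := by
  rw [specialSubgroup, Set.image_singleton, ← Subgroup.zpowers_eq_closure,
    Subgroup.mem_zpowers_iff] at hw
  obtain ⟨k, rfl⟩ := hw
  have h2 : cs.simple s ^ (2 : ℤ) = 1 := by simp [zpow_ofNat]
  obtain ⟨k, rfl | rfl⟩ := Int.even_or_odd' k
  · left; rw [zpow_mul, h2, one_zpow]
  · right; rw [zpow_add, zpow_mul, h2, one_zpow, one_mul, zpow_one]

theorem geometricRep_single_mem_span {y : W} (hy : y ∈ cs.specialSubgroup J) (j : J) :
    cs.geometricRep y (Finsupp.single (j : S) 1) = spanEmbedding J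
      ((cs.specialSystem J).geometricRep ⟨y, hy⟩ (Finsupp.single j 1)) := by
  rw [spanEmbedding_specialSystem, spanEmbedding_single]

/-- Elements of `W_J` change only the coordinates with index in `J`. -/
theorem geometricRep_apply_of_notMem {x : W} (hx : x ∈ cs.specialSubgroup J) (v : S →₀ ℝ)
    {i : S} (hi : i ∉ J) : cs.geometricRep x v i = v i := by
  induction hx using Subgroup.closure_induction generalizing v with
  | mem y hy =>
    obtain ⟨j, hj, rfl⟩ := hy
    have : i ≠ j := by rintro rfl; exact hi hj
    simp [geometricRep_simple_apply, Finsupp.single_eq_of_ne this]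
  | one => simp
  | mul x y _ _ hx hy => rw [geometricRep_mul_apply, hx, hy]
  | inv x _ hx =>
    have := hx (cs.geometricRep x⁻¹ v)
    rw [← geometricRep_mul_apply, mul_inv_cancel, geometricRep_one_apply] at this
    exact this.symm

variable (cs)

/-- `z` is the shortest element of its coset `z W_J`. -/
def IsMinimalIn (J : Set S) (z : W) : Prop := ∀ j ∈ J, cs.length z < cs.length (z * cs.simple j)

/-- `z` is the longest element of its coset `z W_J`. -/
def IsMaximalIn (J : Set S) (z : W) : Prop := ∀ j ∈ J, cs.length (z * cs.simple j) < cs.length z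

variable {cs}

theorem IsMinimalIn.geometricRep_nonneg {z : W} (hz : cs.IsMinimalIn J z) {c : J →₀ ℝ}
    (hc : 0 ≤ c) : 0 ≤ cs.geometricRep z (spanEmbedding J c) := by
  conv_rhs => rw [← Finsupp.sum_single c, Finsupp.sum, map_sum, map_sum]
  refine Finset.sum_nonneg fun j _ => ?_
  rw [spanEmbedding_single, ← mul_one (c j), ← smul_eq_mul, ← Finsupp.smul_single, map_smul]
  exact smul_nonneg (hc j) (cs.geometricRep_nonneg (hz j j.2))

theorem IsMaximalIn.geometricRep_nonpos {z : W} (hz : cs.IsMaximalIn J z) {c : J →₀ ℝ}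
    (hc : 0 ≤ c) : cs.geometricRep z (spanEmbedding J c) ≤ 0 := by
  conv_lhs => rw [← Finsupp.sum_single c, Finsupp.sum, map_sum, map_sum]
  refine Finset.sum_nonpos fun j _ => ?_
  rw [spanEmbedding_single, ← mul_one (c j), ← smul_eq_mul, ← Finsupp.smul_single, map_smul]
  exact smul_nonpos_of_nonneg_of_nonpos (hc j) (cs.geometricRep_nonpos (hz j j.2))

theorem exists_isMinimalIn (J : Set S) (w : W) :
    ∃ z, z⁻¹ * w ∈ cs.specialSubgroup J ∧ cs.IsMinimalIn J z := by
  have hne : ∃ n, ∃ z, z⁻¹ * w ∈ cs.specialSubgroup J ∧ cs.length z = n :=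
    ⟨_, w, by simp [one_mem], rfl⟩
  classical
  obtain ⟨z, hz, hl⟩ := Nat.find_spec hne
  refine ⟨z, hz, fun j hj => ?_⟩
  have := Nat.find_min' hne ⟨z * cs.simple j, by
    rw [mul_inv_rev, mul_assoc]
    exact mul_mem (inv_mem (simple_mem_special hj)) hz, rfl⟩
  have := cs.length_mul_simple_ne z j
  omega

/-- Left multiplication by the shortest element of a coset of `W_J` carries a longest element of
`W_J` to a longest element of the coset. -/
theorem IsMinimalIn.mul_isMaximalIn {z w : W} (hz : cs.IsMinimalIn J z)
    (hw : cs.IsMaximalIn J w) (hwJ : w ∈ cs.specialSubgroup J) : cs.IsMaximalIn J (z * w) := by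
  intro j hj
  have h1 := cs.geometricRep_nonpos (hw j hj)
  rw [geometricRep_single_mem_span hwJ ⟨j, hj⟩, ← neg_nonneg, ← map_neg,
    spanEmbedding_nonneg_iff] at h1
  have h2 := hz.geometricRep_nonneg h1
  rwa [map_neg, ← geometricRep_single_mem_span hwJ ⟨j, hj⟩, map_neg, ← geometricRep_mul_apply,
    neg_nonneg, geometricRep_nonpos_iff] at h2

theorem IsMinimalIn.isMaximalIn_of_mul {z w : W} (hz : cs.IsMinimalIn J z)
    (hwJ : w ∈ cs.specialSubgroup J) (hw : cs.IsMaximalIn J (z * w)) : cs.IsMaximalIn J w := by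
  intro j hj
  by_contra hcon
  have h0 := cs.length_mul_simple_ne w j
  have h1 := cs.geometricRep_nonneg (w := w) (s := j) (by omega)
  rw [geometricRep_single_mem_span hwJ ⟨j, hj⟩, spanEmbedding_nonneg_iff] at h1
  have h2 := hz.geometricRep_nonneg h1
  rw [← geometricRep_single_mem_span hwJ ⟨j, hj⟩, ← geometricRep_mul_apply,
    geometricRep_nonneg_iff] at h2
  exact absurd (hw j hj) (by simp only [not_lt]; exact h2.le)

theorem IsMaximalIn.exists_in_coset {w : W} (hw : cs.IsMaximalIn J w) (v : W) :
    ∃ v', v⁻¹ * v' ∈ cs.specialSubgroup J ∧ cs.IsMaximalIn J v' := by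
  obtain ⟨z, hz, hzm⟩ := exists_isMinimalIn J w
  have hw0 : cs.IsMaximalIn J (z⁻¹ * w) :=
    hzm.isMaximalIn_of_mul hz (by rwa [mul_inv_cancel_left])
  obtain ⟨y, hy, hym⟩ := exists_isMinimalIn J v
  refine ⟨y * (z⁻¹ * w), ?_, hym.mul_isMaximalIn hw0 hz⟩
  rw [← mul_assoc]
  refine mul_mem ?_ hz
  simpa using inv_mem hy

theorem IsMinimalIn.exists_descent {z y : W} (hz : cs.IsMinimalIn J z)
    (hy : y ∈ cs.specialSubgroup J) (hne : y ≠ 1) :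
    ∃ j ∈ J, cs.length (z * y * cs.simple j) < cs.length (z * y) := by
  obtain ⟨j, hj⟩ := (cs.specialSystem J).exists_rightDescent_of_ne_one (w := ⟨y, hy⟩)
    (fun h => hne (congrArg Subtype.val h))
  refine ⟨j, j.2, ?_⟩
  have h1 := (cs.specialSystem J).geometricRep_nonpos hj
  rw [← neg_nonneg] at h1
  have h2 := hz.geometricRep_nonneg h1
  rwa [map_neg, ← geometricRep_single_mem_span hy, map_neg, ← geometricRep_mul_apply,
    neg_nonneg, geometricRep_nonpos_iff] at h2

/-- If `v` is longest in `v W_J`, every root separating `1` from some element of `v W_J`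
separates `1` from `v`. -/
theorem IsMaximalIn.notMem_of_notMem {v x : W} (hv : cs.IsMaximalIn J v)
    (hx : v⁻¹ * x ∈ cs.specialSubgroup J) {α : cs.Root} (h1 : 1 ∈ α.half) (hxα : x ∉ α.half) :
    v ∉ α.half := by
  intro hvα
  obtain ⟨y, hy, j, hj, rfl⟩ := exists_eq_smul_simpleRoot_of_crosses hx hvα hxα
  set y' := v⁻¹ * y with hy'
  have hyv : y = v * y' := by rw [hy', mul_inv_cancel_left]
  have h2 : 0 ≤ cs.geometricRep y' (Finsupp.single j 1) := by
    rw [geometricRep_nonneg_iff, ← one_mem_smul_simpleRoot_iff, mem_half_smul, mul_one]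
    rwa [mem_half_smul, hyv, mul_inv_rev, inv_mul_cancel_right] at hvα
  rw [geometricRep_single_mem_span hy ⟨j, hj⟩, spanEmbedding_nonneg_iff] at h2
  have h3 := hv.geometricRep_nonpos h2
  rw [← geometricRep_single_mem_span hy ⟨j, hj⟩, ← geometricRep_mul_apply, ← hyv,
    geometricRep_nonpos_iff] at h3
  rw [one_mem_smul_simpleRoot_iff] at h1
  exact absurd h1 (by simp only [not_lt]; exact h3.le)

/-! ### Roots of special subgroups -/

theorem half_specialSystem (y : cs.specialSubgroup J) (j : J) :
    (y • (cs.specialSystem J).simpleRoot j).half =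
      Subtype.val ⁻¹' ((y : W) • cs.simpleRoot j).half := by
  ext x
  rw [Set.mem_preimage, mem_half_smul, mem_half_smul, half_simpleRoot, half_simpleRoot,
    mem_specialSystem_simpleHalf]
  rfl

/-- The root `α` crosses `W_J`: it contains some but not all elements of `W_J`. -/
def Root.Crosses (α : cs.Root) (J : Set S) : Prop :=
  (∃ x ∈ cs.specialSubgroup J, x ∈ α.half) ∧ ∃ x ∈ cs.specialSubgroup J, x ∉ α.half

theorem Root.Crosses.exists_eq {α : cs.Root} (h : α.Crosses J) :
    ∃ y ∈ cs.specialSubgroup J, ∃ j ∈ J, α = y • cs.simpleRoot j := by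
  obtain ⟨⟨x, hx, hxα⟩, z, hz, hzα⟩ := h
  obtain ⟨y, hy, j, hj, e⟩ :=
    exists_eq_smul_simpleRoot_of_crosses (mul_mem (inv_mem hx) hz) hxα hzα
  exact ⟨y, by simpa using mul_mem hx hy, j, hj, e⟩

theorem crosses_smul_simpleRoot {y : W} (hy : y ∈ cs.specialSubgroup J) {j : S} (hj : j ∈ J) :
    (y • cs.simpleRoot j).Crosses J := by
  refine ⟨⟨y, hy, ?_⟩, y * cs.simple j, mul_mem hy (simple_mem_special hj), ?_⟩
  · rw [mem_half_smul, inv_mul_cancel]; exact cs.one_mem_simpleRoot j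
  · rw [mem_half_smul, inv_mul_cancel_left]; exact cs.simple_notMem_simpleRoot j

theorem crosses_simpleRoot {j : S} (hj : j ∈ J) : (cs.simpleRoot j).Crosses J := by
  simpa using crosses_smul_simpleRoot (cs := cs) (one_mem _) hj

theorem Root.Crosses.neg {α : cs.Root} (h : α.Crosses J) : (-α).Crosses J :=
  ⟨h.2, h.1.imp fun _ hx => ⟨hx.1, fun h' => h' hx.2⟩⟩

theorem Root.Crosses.eq_of_forall {α β : cs.Root} (h : α.Crosses J)
    (hαβ : ∀ x ∈ cs.specialSubgroup J, x ∈ α.half ↔ x ∈ β.half) : α = β := by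
  obtain ⟨⟨x, hx, hxα⟩, z, hz, hzα⟩ := h
  exact eq_of_half_inter_special_eq hx hz hxα hzα hαβ

/-- The roots of `W_J` are the traces of the roots of `W` that cross `W_J`. -/
theorem exists_crosses_of_specialRoot (β : (cs.specialSystem J).Root) :
    ∃ α : cs.Root, α.Crosses J ∧ Subtype.val ⁻¹' α.half = β.half := by
  obtain ⟨y, j, rfl⟩ := (cs.specialSystem J).exists_eq_smul_simpleRoot β
  exact ⟨_, crosses_smul_simpleRoot y.2 j.2, (half_specialSystem y j).symm⟩

theorem exists_specialRoot_of_crosses {α : cs.Root} (h : α.Crosses J) :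
    ∃ β : (cs.specialSystem J).Root, Subtype.val ⁻¹' α.half = β.half := by
  obtain ⟨y, hy, j, hj, rfl⟩ := h.exists_eq
  exact ⟨(⟨y, hy⟩ : cs.specialSubgroup J) • (cs.specialSystem J).simpleRoot ⟨j, hj⟩,
    (half_specialSystem ⟨y, hy⟩ ⟨j, hj⟩).symm⟩

theorem crosses_of_preimage_half_eq {α : cs.Root} {β : (cs.specialSystem J).Root}
    (h : Subtype.val ⁻¹' α.half = β.half) : α.Crosses J := by
  obtain ⟨α', hα', h'⟩ := exists_crosses_of_specialRoot β
  rw [← hα'.eq_of_forall (β := α)]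
  · exact hα'
  · intro x hx
    have : (⟨x, hx⟩ : cs.specialSubgroup J) ∈ Subtype.val ⁻¹' α'.half ↔
      (⟨x, hx⟩ : cs.specialSubgroup J) ∈ Subtype.val ⁻¹' α.half := by rw [h, h']
    exact this

/-- For finite `W_J`, all roots crossing `W_J` contain exactly half of its elements, so that a
root containing the trace of a crossing root `α ≠ γ` contains `W_J`. -/
theorem Root.Crosses.special_subset_of_finite [Finite (cs.specialSubgroup J)] {α γ : cs.Root}
    (hα : α.Crosses J) (hne : γ ≠ α)
    (h : ∀ x ∈ cs.specialSubgroup J, x ∈ α.half → x ∈ γ.half) :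
    ∀ x ∈ cs.specialSubgroup J, x ∈ γ.half := by
  by_contra hcon
  push Not at hcon
  obtain ⟨x, hx, hxα⟩ := hα.1
  have hγ : γ.Crosses J := ⟨⟨x, hx, h x hx hxα⟩, hcon⟩
  have key : ∀ δ : cs.Root, δ.Crosses J →
      (Subtype.val ⁻¹' δ.half : Set (cs.specialSubgroup J)).ncard =
        (Subtype.val ⁻¹' δ.half : Set (cs.specialSubgroup J))ᶜ.ncard := by
    intro δ hδ
    obtain ⟨y, hy, j, hj, rfl⟩ := hδ.exists_eq
    let r : cs.specialSubgroup J :=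
      ⟨y * cs.simple j * y⁻¹, mul_mem (mul_mem hy (simple_mem_special hj)) (inv_mem hy)⟩
    have hr : (Subtype.val ⁻¹' (y • cs.simpleRoot j).half : Set (cs.specialSubgroup J))ᶜ =
        (fun x => r * x) '' (Subtype.val ⁻¹' (y • cs.simpleRoot j).half) := by
      ext x
      constructor
      · intro hx'
        refine ⟨r⁻¹ * x, ?_, by simp⟩
        rw [Set.mem_compl_iff, Set.mem_preimage, mem_half_smul, ← mem_half_neg,
          ← simple_smul_simpleRoot, mem_half_smul] at hx'
        rw [Set.mem_preimage, mem_half_smul]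
        simpa [r, mul_assoc] using hx'
      · rintro ⟨x', hx', rfl⟩
        rw [Set.mem_preimage, mem_half_smul] at hx'
        rw [Set.mem_compl_iff, Set.mem_preimage, mem_half_smul, ← mem_half_neg,
          ← simple_smul_simpleRoot, mem_half_smul]
        simpa [r, mul_assoc] using hx'
    rw [hr, Set.ncard_image_of_injective _ (mul_right_injective r)]
  have h1 := Set.ncard_add_ncard_compl (Subtype.val ⁻¹' α.half : Set (cs.specialSubgroup J))
  have h2 := Set.ncard_add_ncard_compl (Subtype.val ⁻¹' γ.half : Set (cs.specialSubgroup J))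
  rw [← key _ hα] at h1
  rw [← key _ hγ] at h2
  have h3 := Set.eq_of_subset_of_ncard_le
    (s := (Subtype.val ⁻¹' α.half : Set (cs.specialSubgroup J))) (t := Subtype.val ⁻¹' γ.half)
    (fun x hx => h x x.2 hx) (by omega) (Set.toFinite _)
  refine hne (hα.eq_of_forall fun x hx => ?_).symm
  have : (⟨x, hx⟩ : cs.specialSubgroup J) ∈ Subtype.val ⁻¹' α.half ↔
      (⟨x, hx⟩ : cs.specialSubgroup J) ∈ Subtype.val ⁻¹' γ.half := by rw [h3]
  exact this

end Special
end CoxeterSystem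

/-! ### Linear intervals and special subgroups -/

namespace CoxeterMatrix

variable {S : Type*} (M : CoxeterMatrix S)

/-- The bilinear form `B` with `B(α_s, α_t) = -cos (π / M_{st})`. -/
noncomputable def cosBilin : (S →₀ ℝ) →ₗ[ℝ] (S →₀ ℝ) →ₗ[ℝ] ℝ :=
  Finsupp.linearCombination ℝ M.cosForm

theorem cosBilin_single (s : S) (c : ℝ) (v : S →₀ ℝ) :
    M.cosBilin (Finsupp.single s c) v = c * M.cosForm s v := by
  simp [cosBilin]

theorem cosBilin_comm (u v : S →₀ ℝ) : M.cosBilin u v = M.cosBilin v u := by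
  have : M.cosBilin = M.cosBilin.flip := by
    ext s t
    simp [cosBilin_single, cosForm_single, M.symmetric s t]
  conv_lhs => rw [this]
  rfl

theorem cosForm_eq_cosBilin (s : S) (v : S →₀ ℝ) :
    M.cosForm s v = M.cosBilin v (Finsupp.single s 1) := by
  rw [cosBilin_comm, cosBilin_single, one_mul]

theorem cosBilin_simpleReflection (s : S) (u v : S →₀ ℝ) :
    M.cosBilin (M.simpleReflection s u) (M.simpleReflection s v) = M.cosBilin u v := by
  have h : M.cosBilin (Finsupp.single s 1) (Finsupp.single s 1) = 1 := by
    rw [cosBilin_single, cosForm_single, M.diagonal]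
    simp
  simp only [simpleReflection_apply, cosForm_eq_cosBilin, map_sub, map_smul, LinearMap.sub_apply,
    LinearMap.smul_apply, smul_eq_mul, h, M.cosBilin_comm (Finsupp.single s 1)]
  ring

end CoxeterMatrix

namespace CoxeterSystem

section LinearForms

variable {S : Type*} {W : Type*} [Group W] {M : CoxeterMatrix S} {cs : CoxeterSystem M W}
  {J : Set S}

theorem cosBilin_geometricRep (w : W) (u v : S →₀ ℝ) :
    M.cosBilin (cs.geometricRep w u) (cs.geometricRep w v) = M.cosBilin u v := by
  induction w using cs.simple_induction_left with
  | one => simp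
  | mul_simple_left w i ih =>
    rw [geometricRep_mul_apply, geometricRep_mul_apply, geometricRep, cs.lift_apply_simple,
      M.cosBilin_simpleReflection]
    exact ih

theorem IsLinearForm.cosBilin_self {α : cs.Root} {a : S →₀ ℝ} (h : cs.IsLinearForm α a) :
    M.cosBilin a a = 1 := by
  obtain ⟨w, s, -, rfl⟩ := h
  rw [cosBilin_geometricRep, M.cosBilin_single, M.cosForm_single, M.diagonal]
  simp

/-- A multiple of a basis vector can be the vector of a positive root only if it is that basis
vector, since both have norm one. -/
theorem IsLinearForm.eq_single {α : cs.Root} {a : S →₀ ℝ} (h : cs.IsLinearForm α a) {s : S}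
    {c : ℝ} (hc : a = c • Finsupp.single s 1) (h0 : 0 ≤ a) :
    a = Finsupp.single s 1 ∧ α = cs.simpleRoot s := by
  have h1 := h.cosBilin_self
  rw [hc, map_smul, map_smul, LinearMap.smul_apply, M.cosBilin_single, M.cosForm_single,
    M.diagonal] at h1
  have hc0 : 0 ≤ c := by simpa [hc] using h0 s
  have hc1 : c = 1 := by
    simp at h1
    nlinarith
  rw [hc1, one_smul] at hc
  refine ⟨hc, ?_⟩
  have e := eq_smul_simpleRoot_of_separates (α := α) (w := 1) (s := s)
    (by rw [h.mem_iff]; simpa using h0)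
    (by rw [one_mul, h.notMem_iff, hc, cs.inv_simple, geometricRep_simple_self]
        exact neg_nonpos.2 (Finsupp.single_nonneg.2 zero_le_one))
  rwa [one_smul] at e

theorem IsLinearForm.unique {α : cs.Root} {a a' : S →₀ ℝ} (h : cs.IsLinearForm α a)
    (h' : cs.IsLinearForm α a') : a = a' := by
  obtain ⟨w, s, rfl, rfl⟩ := h'
  have h1 := h.smul w⁻¹
  rw [inv_smul_smul] at h1
  have h0 : 0 ≤ cs.geometricRep w⁻¹ a := by
    have := (h1.mem_iff 1).1 (cs.one_mem_simpleRoot s)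
    simpa using this
  have h2 := (h1.notMem_iff _).1 (cs.simple_notMem_simpleRoot s)
  rw [cs.inv_simple] at h2
  have h3 := (h1.eq_single (eq_smul_single_of_nonneg_of_nonpos h0 h2) h0).1
  rw [← h3, ← geometricRep_mul_apply, mul_inv_cancel, geometricRep_one_apply]

theorem geometricRep_reflection_apply (w : W) (s : S) (v : S →₀ ℝ) :
    cs.geometricRep (w * cs.simple s * w⁻¹) v =
      v - (2 * M.cosBilin (cs.geometricRep w (Finsupp.single s 1)) v) •
        cs.geometricRep w (Finsupp.single s 1) := by
  have h : M.cosForm s (cs.geometricRep w⁻¹ v) =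
      M.cosBilin (cs.geometricRep w (Finsupp.single s 1)) v := by
    rw [M.cosForm_eq_cosBilin, M.cosBilin_comm, ← cosBilin_geometricRep w (cs := cs),
      ← geometricRep_mul_apply, mul_inv_cancel, geometricRep_one_apply]
  rw [geometricRep_mul_apply, geometricRep_mul_apply, geometricRep_simple_apply, map_sub,
    map_smul, h, ← geometricRep_mul_apply, mul_inv_cancel, geometricRep_one_apply]

/-- A positive root whose vector `b` lies in the span of `J` is a root of `W_J`. The proof is by
induction on the length of the reflection: since `B(b, b) = 1`, some `t ∈ J` satisfies
`B(b, α_t) > 0`, and the reflection of `σ_t b` is then shorter. -/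
theorem exists_eq_smul_of_support_of_nonneg (n : ℕ) (w : W) (s : S)
    (hn : cs.length (w * cs.simple s * w⁻¹) = n)
    (h0 : 0 ≤ cs.geometricRep w (Finsupp.single s 1))
    (hJ : ∀ i ∉ J, cs.geometricRep w (Finsupp.single s 1) i = 0) :
    ∃ y ∈ cs.specialSubgroup J, ∃ j ∈ J, w • cs.simpleRoot s = y • cs.simpleRoot j := by
  induction n using Nat.strong_induction_on generalizing w with
  | _ n ih =>
  set b := cs.geometricRep w (Finsupp.single s 1) with hb
  have hbr : cs.IsLinearForm (w • cs.simpleRoot s) b := ⟨w, s, rfl, rfl⟩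
  obtain ⟨t, ht⟩ : ∃ t, 0 < b t * M.cosForm t b := by
    by_contra hcon
    push Not at hcon
    have h1 : M.cosBilin b b = b.sum fun t x => x * M.cosForm t b := by
      conv_lhs => rw [CoxeterMatrix.cosBilin, Finsupp.linearCombination_apply, Finsupp.sum,
        LinearMap.sum_apply]
      rfl
    have h2 : M.cosBilin b b ≤ 0 := by
      rw [h1]; exact Finset.sum_nonpos fun t _ => hcon t
    rw [hbr.cosBilin_self] at h2
    norm_num at h2
  have htJ : t ∈ J := by
    by_contra h
    rw [hJ t h, zero_mul] at ht
    exact lt_irrefl _ ht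
  have hbt : 0 < M.cosForm t b := pos_of_mul_pos_right ht (h0 t)
  by_cases hc : b = b t • Finsupp.single t 1
  · exact ⟨1, one_mem _, t, htJ, by rw [(hbr.eq_single hc h0).2, one_smul W]⟩
  have htb : 0 ≤ cs.geometricRep (cs.simple t * w) (Finsupp.single s 1) := by
    by_contra hcon
    refine hc (eq_smul_single_of_nonneg_of_nonpos (cs := cs) h0 ?_)
    rw [hb, ← geometricRep_mul_apply, geometricRep_nonpos_iff]
    rw [geometricRep_nonneg_iff] at hcon
    have := cs.length_mul_simple_ne (cs.simple t * w) s
    omega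
  obtain ⟨i, hit, hi⟩ : ∃ i, i ≠ t ∧ 0 < b i := by
    by_contra hcon
    push Not at hcon
    refine hc (Finsupp.ext fun i => ?_)
    obtain rfl | hit := eq_or_ne i t
    · simp
    · simp [Finsupp.single_eq_of_ne hit, le_antisymm (hcon i hit) (h0 i)]
  have hr := geometricRep_reflection_apply (cs := cs) w s (Finsupp.single t 1)
  rw [← hb, ← M.cosForm_eq_cosBilin] at hr
  have h1 : cs.length (w * cs.simple s * w⁻¹ * cs.simple t) <
      cs.length (w * cs.simple s * w⁻¹) := by
    by_contra hcon
    have hne := cs.length_mul_simple_ne (w * cs.simple s * w⁻¹) t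
    have := cs.geometricRep_nonneg (w := w * cs.simple s * w⁻¹) (s := t) (by omega) i
    rw [hr] at this
    simp [Finsupp.single_eq_of_ne hit] at this
    nlinarith
  have h2 : cs.length (cs.simple t * (w * cs.simple s * w⁻¹) * cs.simple t) <
      cs.length (cs.simple t * (w * cs.simple s * w⁻¹)) := by
    rw [← geometricRep_nonpos_iff, geometricRep_mul_apply, hr, map_sub, map_smul,
      geometricRep_simple_self, hb, ← geometricRep_mul_apply, sub_nonpos]
    exact (neg_nonpos.2 (Finsupp.single_nonneg.2 zero_le_one)).trans
      (smul_nonneg (by positivity) htb)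
  have h3 : cs.length (cs.simple t * (w * cs.simple s * w⁻¹)) =
      cs.length (w * cs.simple s * w⁻¹ * cs.simple t) := by
    rw [← cs.length_inv]
    congr 1
    simp [mul_assoc]
  have e : cs.simple t * w * cs.simple s * (cs.simple t * w)⁻¹ =
      cs.simple t * (w * cs.simple s * w⁻¹) * cs.simple t := by simp [mul_assoc]
  obtain ⟨y, hy, j, hj, hyj⟩ := ih _ (by rw [h3] at h2; exact (h2.trans h1).trans_eq hn)
    (cs.simple t * w) (congrArg cs.length e) htb (fun k hk => by
      rw [geometricRep_mul_apply, ← hb,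
        geometricRep_apply_of_notMem (simple_mem_special htJ) _ hk, hJ k hk])
  refine ⟨cs.simple t * y, mul_mem (simple_mem_special htJ) hy, j, hj, ?_⟩
  rw [mul_smul, ← hyj, ← mul_smul, cs.simple_mul_simple_cancel_left]

theorem IsLinearForm.crosses_of_support {α : cs.Root} {a : S →₀ ℝ} (h : cs.IsLinearForm α a)
    (hJ : ∀ i ∉ J, a i = 0) : α.Crosses J := by
  have key : ∀ (α : cs.Root) (a : S →₀ ℝ), cs.IsLinearForm α a → (∀ i ∉ J, a i = 0) → 0 ≤ a →
      α.Crosses J := by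
    intro α a h hJ h0
    obtain ⟨w, s, rfl, rfl⟩ := h
    obtain ⟨y, hy, j, hj, e⟩ := exists_eq_smul_of_support_of_nonneg _ w s rfl h0 hJ
    rw [e]
    exact crosses_smul_simpleRoot hy hj
  by_cases h1 : 1 ∈ α.half
  · exact key α a h hJ (by simpa using (h.mem_iff 1).1 h1)
  · rw [← neg_neg α]
    exact (key (-α) (-a) h.neg (fun i hi => by simp [hJ i hi])
      (by simpa using (h.notMem_iff 1).1 h1)).neg

theorem IsLinearForm.support_of_crosses {α : cs.Root} {a : S →₀ ℝ} (h : cs.IsLinearForm α a)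
    (hα : α.Crosses J) {i : S} (hi : i ∉ J) : a i = 0 := by
  obtain ⟨y, hy, j, hj, rfl⟩ := hα.exists_eq
  rw [h.unique ⟨y, j, rfl, rfl⟩, geometricRep_apply_of_notMem hy _ hi,
    Finsupp.single_eq_of_ne (by rintro rfl; exact hi hj)]

/-- In the linear setting, an interval between a root crossing `W_J` and a root containing `W_J`
consists of roots containing `W_J`: their vectors have a positive coordinate outside of `J`. -/
theorem special_subset_of_mem_openLinearInterval {α β γ : cs.Root} (hα : α.Crosses J)
    (hβ : ∀ x ∈ cs.specialSubgroup J, x ∈ β.half) (hγ : γ ∈ cs.openLinearInterval α β) :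
    ∀ x ∈ cs.specialSubgroup J, x ∈ γ.half := by
  obtain ⟨⟨a, b, c, ha, hb, hc, x, y, hx, hy, rfl⟩, hγα, -⟩ := hγ
  have hb0 : 0 ≤ b := by simpa using (hb.mem_iff 1).1 (hβ 1 (one_mem _))
  obtain ⟨i, hi, hbi⟩ : ∃ i ∉ J, b i ≠ 0 := by
    by_contra hcon
    push Not at hcon
    obtain ⟨z, hz, hzβ⟩ := (hb.crosses_of_support hcon).2
    exact hzβ (hβ z hz)
  rcases hy.eq_or_lt with rfl | hy
  · exfalso
    rw [zero_smul, add_zero] at hc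
    have hx0 : 0 < x := by
      rcases hx.eq_or_lt with rfl | hx
      · exact absurd (zero_smul ℝ a) hc.ne_zero
      · exact hx
    refine hγα (Root.ext_half (Set.ext fun w => ?_))
    rw [hc.mem_iff, ha.mem_iff, map_smul]
    exact ⟨fun h => (by simpa [smul_smul, hx0.ne'] using smul_nonneg (inv_nonneg.2 hx0.le) h),
      fun h => smul_nonneg hx0.le h⟩
  · intro w hw
    by_contra hcon
    have h1 := (hc.notMem_iff w).1 hcon i
    rw [geometricRep_apply_of_notMem (inv_mem hw) _ hi] at h1
    have h2 := ha.support_of_crosses hα hi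
    have h3 := hb0 i
    simp only [Finsupp.coe_add, Finsupp.coe_smul, Pi.add_apply, Pi.smul_apply, smul_eq_mul, h2,
      mul_zero, zero_add, Finsupp.coe_zero, Pi.zero_apply] at h1 h3
    have : 0 < b i := lt_of_le_of_ne h3 (Ne.symm hbi)
    have := mul_pos hy this
    linarith

theorem IsLinearForm.exists_specialRoot {α : cs.Root} {a : S →₀ ℝ} (h : cs.IsLinearForm α a)
    {β : (cs.specialSystem J).Root} (hβ : Subtype.val ⁻¹' α.half = β.half) :
    ∃ b, (cs.specialSystem J).IsLinearForm β b ∧ spanEmbedding J b = a := by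
  obtain ⟨y, hy, j, hj, rfl⟩ := (crosses_of_preimage_half_eq hβ).exists_eq
  refine ⟨(cs.specialSystem J).geometricRep ⟨y, hy⟩ (Finsupp.single ⟨j, hj⟩ 1),
    ⟨⟨y, hy⟩, ⟨j, hj⟩, Root.ext_half ?_, rfl⟩, ?_⟩
  · rw [← hβ]
    exact (half_specialSystem ⟨y, hy⟩ ⟨j, hj⟩).symm
  · rw [← geometricRep_single_mem_span hy ⟨j, hj⟩]
    exact (IsLinearForm.unique ⟨y, j, rfl, rfl⟩ h)

/-- Linear intervals between roots crossing `W_J` are the linear intervals of `(W_J, J)`. -/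
theorem exists_mem_openLinearInterval_special {α β γ : cs.Root}
    {α' β' : (cs.specialSystem J).Root} (hα : Subtype.val ⁻¹' α.half = α'.half)
    (hβ : Subtype.val ⁻¹' β.half = β'.half) (hγ : γ ∈ cs.openLinearInterval α β) :
    ∃ γ' ∈ (cs.specialSystem J).openLinearInterval α' β', Subtype.val ⁻¹' γ.half = γ'.half := by
  obtain ⟨⟨a, b, c, ha, hb, hc, x, y, hx, hy, rfl⟩, hγα, hγβ⟩ := hγ
  have hαc := crosses_of_preimage_half_eq hα
  have hβc := crosses_of_preimage_half_eq hβ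
  have hγc : γ.Crosses J := hc.crosses_of_support fun i hi => by
    simp [ha.support_of_crosses hαc hi, hb.support_of_crosses hβc hi]
  obtain ⟨γ', hγ'⟩ := exists_specialRoot_of_crosses hγc
  obtain ⟨a', ha', rfl⟩ := ha.exists_specialRoot hα
  obtain ⟨b', hb', rfl⟩ := hb.exists_specialRoot hβ
  obtain ⟨c', hc', e⟩ := hc.exists_specialRoot hγ'
  refine ⟨γ', ⟨⟨a', b', c', ha', hb', hc', x, y, hx, hy, ?_⟩, ?_, ?_⟩, hγ'⟩
  · apply spanEmbedding_injective J
    rw [e, map_add, map_smul, map_smul]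
  · rintro rfl
    refine hγα (hγc.eq_of_forall fun x hx => ?_)
    have : (⟨x, hx⟩ : cs.specialSubgroup J) ∈ Subtype.val ⁻¹' γ.half ↔
      (⟨x, hx⟩ : cs.specialSubgroup J) ∈ Subtype.val ⁻¹' α.half := by rw [hα, hγ']
    exact this
  · rintro rfl
    refine hγβ (hγc.eq_of_forall fun x hx => ?_)
    have : (⟨x, hx⟩ : cs.specialSubgroup J) ∈ Subtype.val ⁻¹' γ.half ↔
      (⟨x, hx⟩ : cs.specialSubgroup J) ∈ Subtype.val ⁻¹' β.half := by rw [hβ, hγ']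
    exact this

end LinearForms
end CoxeterSystem

/-! ### Lifts of elements of the Weyl group -/

theorem MulAut.mem_conj_smul_iff {G : Type*} [Group G] {n x : G} {K : Subgroup G} :
    x ∈ MulAut.conj n • K ↔ n⁻¹ * x * n ∈ K := by
  rw [Subgroup.mem_pointwise_smul_iff_inv_smul_mem, ← map_inv, MulAut.smul_def,
    MulAut.conj_apply, inv_inv]

theorem MulAut.conj_mul_mem_conj_smul {G : Type*} [Group G] {n x : G} {K : Subgroup G}
    (hx : x ∈ K) : n * x * n⁻¹ ∈ MulAut.conj n • K := by
  rw [MulAut.mem_conj_smul_iff]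
  simpa [mul_assoc] using hx

/-- In a group generated by involutions, `ab` is inverted by `a`. -/
theorem mul_pow_mul_eq_of_sq_eq_one {Q : Type*} [Group Q] {a b : Q} (ha : a * a = 1)
    (hb : b * b = 1) (k : ℕ) : (a * b) ^ k * a = a * ((a * b) ^ k)⁻¹ := by
  have h : SemiconjBy a (b * a) (a * b) := by simp [SemiconjBy, mul_assoc]
  have h2 : (a * b)⁻¹ = b * a := by
    rw [mul_inv_rev, inv_eq_of_mul_eq_one_right ha, inv_eq_of_mul_eq_one_right hb]
  rw [← (h.pow_right k).eq, ← inv_pow, h2]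

namespace RootGroupData

section Lifts

variable {S : Type*} {W : Type*} [Group W] {M : CoxeterMatrix S} {cs : CoxeterSystem M W}
  {G : Type*} [Group G] {D : RootGroupData cs G}

open CoxeterSystem

theorem Lifts.mul {n m : G} {w v : W} (hn : D.Lifts n w) (hm : D.Lifts m v) :
    D.Lifts (n * m) (w * v) := mul_mem hn hm

theorem Lifts.inv {n : G} {w : W} (hn : D.Lifts n w) : D.Lifts n⁻¹ w⁻¹ := inv_mem hn

theorem lifts_one : D.Lifts 1 1 := one_mem D.weylGraph

theorem lifts_of_mem {h : G} (hh : h ∈ D.H) : D.Lifts h 1 :=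
  Subgroup.subset_closure (Or.inl ⟨hh, rfl⟩)

theorem IsReflectionLift.lifts {s : S} {u m : G} (h : D.IsReflectionLift s u m) :
    D.Lifts m (cs.simple s) :=
  Subgroup.subset_closure (Or.inr ⟨s, u, h, rfl⟩)

theorem IsReflectionPair.inv {s : S} {u : G} {x : G × G} (h : D.IsReflectionPair s u x) :
    D.IsReflectionPair s u⁻¹ (x.2⁻¹, x.1⁻¹) := by
  obtain ⟨h1, h1', h2, h2', h3⟩ := h
  refine ⟨inv_mem h2, inv_ne_one.2 h2', inv_mem h1, inv_ne_one.2 h1', fun β => ?_⟩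
  have e : x.2⁻¹ * u⁻¹ * x.1⁻¹ = (x.1 * u * x.2)⁻¹ := by group
  simp only [e]
  rw [map_inv, inv_smul_eq_iff, h3, ← mul_smul, cs.simple_mul_simple_self, one_smul]

theorem IsReflectionLift.inv {s : S} {u m : G} (h : D.IsReflectionLift s u m) :
    D.IsReflectionLift s u⁻¹ m⁻¹ := by
  obtain ⟨hu, hu1, x, hx, rfl⟩ := h
  exact ⟨inv_mem hu, inv_ne_one.2 hu1, _, hx.inv, by group⟩

theorem IsReflectionLift.conj_smul {s : S} {u m : G} (h : D.IsReflectionLift s u m)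
    (β : cs.Root) : MulAut.conj m • D.U β = D.U (cs.simple s • β) := by
  obtain ⟨hu, hu1, x, hx, rfl⟩ := h
  exact hx.2.2.2.2 β

theorem U_le_unipotent_pos {α : cs.Root} (h : 1 ∈ α.half) : D.U α ≤ D.unipotent .pos :=
  le_iSup₂_of_le α h le_rfl

theorem U_le_unipotent_neg {α : cs.Root} (h : 1 ∉ α.half) : D.U α ≤ D.unipotent .neg :=
  le_iSup₂_of_le α h le_rfl

variable (hD : D.IsTRD)
include hD

theorem IsTRD.exists_mem_ne_one (α : cs.Root) : ∃ x ∈ D.U α, x ≠ 1 :=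
  (Subgroup.ne_bot_iff_exists_ne_one.1 (hD.nontrivial α)).elim fun x hx =>
    ⟨x, x.2, fun h => hx (Subtype.ext h)⟩

theorem IsTRD.exists_isReflectionLift {s : S} {u : G} (hu : u ∈ D.U (cs.simpleRoot s))
    (hu1 : u ≠ 1) : ∃ m, D.IsReflectionLift s u m := by
  obtain ⟨x, hx, -⟩ := hD.existsUnique_reflection s u hu hu1
  exact ⟨_, hu, hu1, x, hx, rfl⟩

theorem IsTRD.exists_simple_isReflectionLift (s : S) : ∃ u m, D.IsReflectionLift s u m := by
  obtain ⟨u, hu, hu1⟩ := hD.exists_mem_ne_one (cs.simpleRoot s)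
  obtain ⟨m, hm⟩ := hD.exists_isReflectionLift hu hu1
  exact ⟨u, m, hm⟩

theorem IsTRD.exists_lifts (w : W) : ∃ n, D.Lifts n w := by
  induction w using cs.simple_induction_left with
  | one => exact ⟨1, lifts_one⟩
  | mul_simple_left w s ih =>
    obtain ⟨n, hn⟩ := ih
    obtain ⟨u, m, hm⟩ := hD.exists_simple_isReflectionLift s
    exact ⟨m * n, hm.lifts.mul hn⟩

theorem IsTRD.conj_smul_of_mem {h : G} (hh : h ∈ D.H) (β : cs.Root) :
    MulAut.conj h • D.U β = D.U β := by
  ext x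
  rw [MulAut.mem_conj_smul_iff]
  have := Subgroup.mem_normalizer_iff.1 (hD.normalized β (inv_mem hh)) x
  rw [inv_inv] at this
  exact this.symm

theorem IsTRD.conj_smul {n : G} {w : W} (hn : D.Lifts n w) (β : cs.Root) :
    MulAut.conj n • D.U β = D.U (w • β) := by
  have key : ∀ x ∈ D.weylGraph, ∀ β, MulAut.conj x.1 • D.U β = D.U (x.2 • β) := by
    intro x hx
    induction hx using Subgroup.closure_induction with
    | mem x hx =>
      rcases hx with ⟨h1, h2⟩ | ⟨s, u, h1, h2⟩
      · intro β; rw [h2, one_smul, hD.conj_smul_of_mem h1]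
      · intro β; rw [h2, h1.conj_smul]
    | one => intro β; simp
    | mul x y _ _ hx hy =>
      intro β
      rw [Prod.fst_mul, Prod.snd_mul, map_mul, mul_smul, hy, hx, mul_smul]
    | inv x _ hx =>
      intro β
      rw [Prod.fst_inv, Prod.snd_inv, map_inv, inv_smul_eq_iff, hx, smul_inv_smul]
  exact key _ hn β

theorem IsTRD.conj_mem {n : G} {w : W} (hn : D.Lifts n w) {β : cs.Root} {x : G}
    (hx : x ∈ D.U β) : n * x * n⁻¹ ∈ D.U (w • β) := by
  rw [← hD.conj_smul hn]
  exact MulAut.conj_mul_mem_conj_smul hx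

theorem IsTRD.inv_conj_mem {n : G} {w : W} (hn : D.Lifts n w) {β : cs.Root} {x : G}
    (hx : x ∈ D.U (w • β)) : n⁻¹ * x * n ∈ D.U β := by
  rwa [← hD.conj_smul hn, MulAut.mem_conj_smul_iff] at hx

/-- Conjugation by a lift of `w` carries reflection lifts for `s` to reflection lifts for `t` when
`w s = t w` and `w α_s = α_t`. -/
theorem IsTRD.isReflectionLift_conj {n : G} {w : W} (hn : D.Lifts n w) {s t : S} {u m : G}
    (hm : D.IsReflectionLift s u m) (hst : w * cs.simple s = cs.simple t * w)
    (h : w • cs.simpleRoot s = cs.simpleRoot t) :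
    D.IsReflectionLift t (n * u * n⁻¹) (n * m * n⁻¹) := by
  have hl := hn.mul (hm.lifts.mul hn.inv)
  obtain ⟨hu, hu1, x, ⟨h1, h1', h2, h2', h3⟩, rfl⟩ := hm
  have hneg : w • (-cs.simpleRoot s) = -cs.simpleRoot t := by rw [smul_neg_root, h]
  refine ⟨h ▸ hD.conj_mem hn hu, by simpa using hu1, (n * x.1 * n⁻¹, n * x.2 * n⁻¹),
    ⟨hneg ▸ hD.conj_mem hn h1, by simpa using h1', hneg ▸ hD.conj_mem hn h2, by simpa using h2',
      fun β => ?_⟩, by group⟩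
  have e : n * x.1 * n⁻¹ * (n * u * n⁻¹) * (n * x.2 * n⁻¹) =
    n * (x.1 * u * x.2 * n⁻¹) := by group
  simp only [e]
  rw [hD.conj_smul hl, ← mul_assoc, hst, mul_inv_cancel_right]

theorem IsTRD.exists_isReflectionLift_conj {n : G} {w : W} (hn : D.Lifts n w) {s t : S} {u m : G}
    (hm : D.IsReflectionLift s u m) (hst : w * cs.simple s = cs.simple t * w) :
    ∃ u', D.IsReflectionLift t u' (n * m * n⁻¹) := by
  rcases smul_simpleRoot_eq_or_eq_neg hst with h | h
  · exact ⟨_, hD.isReflectionLift_conj hn hm hst h⟩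
  · have h' : (w * cs.simple s) • cs.simpleRoot s = cs.simpleRoot t := by
      rw [mul_smul, simple_smul_simpleRoot, smul_neg_root, h, neg_neg]
    have := hD.isReflectionLift_conj (hn.mul hm.lifts) hm (t := t)
      (by rw [hst, mul_assoc, hst]) h'
    refine ⟨n * m * u * (n * m)⁻¹, ?_⟩
    convert this using 1
    group

theorem IsTRD.reflectionLift_inv_mul {s : S} {u v m m' : G} (h : D.IsReflectionLift s u m)
    (h' : D.IsReflectionLift s v m') : m⁻¹ * m' ∈ D.H :=
  hD.reflection_coset s u v m m' h h'

theorem IsTRD.lifts_conj_mem_H {n : G} {w : W} (hn : D.Lifts n w) {h : G} (hh : h ∈ D.H) :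
    n * h * n⁻¹ ∈ D.H := by
  have key : ∀ x ∈ D.weylGraph, ∀ h, h ∈ D.H ↔ x.1 * h * x.1⁻¹ ∈ D.H := by
    intro x hx
    have hrefl : ∀ s u m, D.IsReflectionLift s u m → ∀ h ∈ D.H, m * h * m⁻¹ ∈ D.H := by
      intro s u m hm h hh
      have h1 := hD.isReflectionLift_conj (lifts_of_mem hh) hm.inv (t := s) (by simp) (by simp)
      have h2 := hD.reflectionLift_inv_mul hm.inv h1
      have e : m⁻¹⁻¹ * (h * m⁻¹ * h⁻¹) = m * h * m⁻¹ * h⁻¹ := by group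
      rw [e] at h2
      simpa using mul_mem h2 hh
    induction hx using Subgroup.closure_induction with
    | mem x hx =>
      intro h
      rcases hx with ⟨h1, -⟩ | ⟨s, u, h1, -⟩
      · exact ⟨fun hh => mul_mem (mul_mem h1 hh) (inv_mem h1), fun hh => by
          simpa [mul_assoc] using mul_mem (mul_mem (inv_mem h1) hh) h1⟩
      · refine ⟨hrefl s u _ h1 h, fun hh => ?_⟩
        have := hrefl s _ _ h1.inv _ hh
        simpa [mul_assoc] using this
    | one => simp
    | mul x y _ _ hx hy =>
      intro h
      rw [hy, hx]
      simp [mul_assoc]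
    | inv x _ hx =>
      intro h
      rw [hx (x⁻¹.1 * h * x⁻¹.1⁻¹)]
      simp [mul_assoc]
  exact (key _ hn h).1 hh

/-- An element of `N` lying over `1 ∈ W` lies in `H`. The quotient of `N` by `H` satisfies the
Coxeter relations: if `w s w⁻¹ = t`, a lift of `w` conjugates the class `q_s` of the reflection
lifts for `s` to `q_t`, and for `w = (s t)^k` with `M_{st} = 2k` or `2k + 1` this is equivalent
to `(q_s q_t) ^ M_{st} = 1`. Hence it is a section of `W`. -/
theorem IsTRD.mem_of_lifts_one {n : G} (hn : D.Lifts n 1) : n ∈ D.H := by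
  let N := D.weylGraph
  let K : Subgroup N := (D.H.prod ⊥).subgroupOf N
  have hK : ∀ x : N, x ∈ K ↔ x.1.1 ∈ D.H ∧ x.1.2 = 1 := fun x => by
    simp [K, Subgroup.mem_subgroupOf, Subgroup.mem_prod]
  have hKn : K.Normal := ⟨fun x hx g => by
    rw [hK] at hx ⊢
    exact ⟨hD.lifts_conj_mem_H g.2 hx.1, by simp [hx.2]⟩⟩
  choose u m hm using fun s => hD.exists_simple_isReflectionLift s
  let X : S → N := fun s => ⟨(m s, cs.simple s), (hm s).lifts⟩
  let q : S → N ⧸ K := fun s => QuotientGroup.mk (X s)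
  have hmk : ∀ (x : N) s v, D.IsReflectionLift s v x.1.1 → x.1.2 = cs.simple s →
      (QuotientGroup.mk x : N ⧸ K) = q s := by
    intro x s v hv hx
    refine (QuotientGroup.eq).2 ((hK _).2 ⟨hD.reflectionLift_inv_mul hv (hm s), ?_⟩)
    simp [X, hx]
  have hq : ∀ s, q s * q s = 1 := by
    intro s
    have h1 := hmk (X s)⁻¹ s _ (hm s).inv (cs.inv_simple s)
    rw [QuotientGroup.mk_inv] at h1
    rw [← inv_eq_iff_mul_eq_one]
    exact h1
  have hconj : ∀ (x : N) s t, x.1.2 * cs.simple s = cs.simple t * x.1.2 →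
      (QuotientGroup.mk x : N ⧸ K) * q s = q t * QuotientGroup.mk x := by
    intro x s t hst
    obtain ⟨v, hv⟩ := hD.exists_isReflectionLift_conj x.2 (hm s) hst
    have := hmk (x * X s * x⁻¹) t v hv (by
      show x.1.2 * cs.simple s * x.1.2⁻¹ = cs.simple t
      rw [hst, mul_inv_cancel_right])
    rw [QuotientGroup.mk_mul, QuotientGroup.mk_mul, QuotientGroup.mk_inv] at this
    rw [← this, inv_mul_cancel_right]
  have hlift : M.IsLiftable q := by
    intro s t
    have hpow : ∀ k, (QuotientGroup.mk ((X s * X t) ^ k) : N ⧸ K) = (q s * q t) ^ k := fun k => rfl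
    have h1 := fun k => mul_pow_mul_eq_of_sq_eq_one (hq s) (hq t) k
    have h2 := fun k => mul_pow_mul_eq_of_sq_eq_one (cs.simple_mul_simple_self s)
      (cs.simple_mul_simple_self t) k
    have h3 := cs.simple_mul_simple_pow s t
    obtain ⟨k, hk | hk⟩ := Nat.even_or_odd' (M s t)
    · have h4 := hconj ((X s * X t) ^ k) s s (by
        show (cs.simple s * cs.simple t) ^ k * cs.simple s =
          cs.simple s * (cs.simple s * cs.simple t) ^ k
        rw [h2, mul_right_inj, inv_eq_iff_mul_eq_one, ← pow_add, ← two_mul, ← hk, h3])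
      rw [hpow, h1, mul_right_inj, inv_eq_iff_mul_eq_one, ← pow_add, ← two_mul, ← hk] at h4
      exact h4
    · have h4 := hconj ((X s * X t) ^ k) s t (by
        show (cs.simple s * cs.simple t) ^ k * cs.simple s =
          cs.simple t * (cs.simple s * cs.simple t) ^ k
        rw [h2, ← mul_right_inj (cs.simple s), cs.simple_mul_simple_cancel_left, ← mul_assoc,
          ← pow_succ', inv_eq_iff_mul_eq_one, ← pow_add,
          show k + (k + 1) = 2 * k + 1 by ring, ← hk, h3])
      rw [hpow, h1, ← mul_right_inj (q s), ← mul_assoc, hq, one_mul, ← mul_assoc, ← pow_succ',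
        inv_eq_iff_mul_eq_one, ← pow_add, show k + (k + 1) = 2 * k + 1 by ring, ← hk] at h4
      exact h4
  let ψ : W →* N ⧸ K := cs.lift ⟨q, hlift⟩
  have hψ : ∀ x (hx : x ∈ N), (QuotientGroup.mk ⟨x, hx⟩ : N ⧸ K) = ψ x.2 := by
    intro x hx
    induction hx using Subgroup.closure_induction with
    | mem x hx =>
      rcases hx with ⟨h1, h2⟩ | ⟨s, v, h1, h2⟩
      · refine Eq.trans ?_ (congrArg ψ h2).symm
        rw [map_one, QuotientGroup.eq_one_iff, hK]
        exact ⟨h1, h2⟩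
      · refine Eq.trans ?_ (congrArg ψ h2).symm
        exact (hmk _ s v h1 h2).trans (cs.lift_apply_simple hlift s).symm
    | one => rw [Prod.snd_one, map_one]; rfl
    | mul x y hx' hy' hx hy =>
      rw [Prod.snd_mul, map_mul, ← hx, ← hy]; rfl
    | inv x hx' hx => rw [Prod.snd_inv, map_inv, ← hx]; rfl
  have := hψ _ hn
  rw [map_one, QuotientGroup.eq_one_iff, hK] at this
  exact this.1

theorem IsTRD.lifts_inv_mul_mem {n n' : G} {w : W} (hn : D.Lifts n w) (hn' : D.Lifts n' w) :
    n⁻¹ * n' ∈ D.H := by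
  apply hD.mem_of_lifts_one
  simpa using hn.inv.mul hn'

/-- The factorization of an element of `U_{-α_s}` through a lift of `s`. -/
theorem IsTRD.exists_eq_mul_lift_mul {s : S} {y : G} (hy : y ∈ D.U (-cs.simpleRoot s))
    (hy1 : y ≠ 1) : ∃ x ∈ D.U (cs.simpleRoot s), ∃ x' ∈ D.U (cs.simpleRoot s), ∃ n,
      x ≠ 1 ∧ x' ≠ 1 ∧ D.Lifts n (cs.simple s) ∧ y = x * n * x' := by
  obtain ⟨_, m, hm⟩ := hD.exists_simple_isReflectionLift s
  have hl := hm.lifts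
  rw [← simple_smul_simpleRoot] at hy
  have hu := hD.inv_conj_mem hl hy
  obtain ⟨m', hm'⟩ := hD.exists_isReflectionLift hu (by
    intro h
    apply hy1
    have : y = m * (m⁻¹ * y * m) * m⁻¹ := by group
    rw [this, h]; group)
  have hl' := hm'.lifts
  obtain ⟨-, -, x, ⟨h1, h1', h2, h2', -⟩, hx⟩ := hm'
  have h1 := hD.conj_mem hl (inv_mem h1)
  have h2 := hD.conj_mem hl (inv_mem h2)
  rw [simple_smul_neg_simpleRoot] at h1 h2
  refine ⟨_, h1, _, h2, m * m' * m⁻¹, by simpa using h1', by simpa using h2', ?_, ?_⟩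
  · simpa using (hl.mul hl').mul hl.inv
  · rw [hx]; group

theorem IsTRD.exists_eq_mul_lift_mul' {s : S} {x : G} (hx : x ∈ D.U (cs.simpleRoot s))
    (hx1 : x ≠ 1) : ∃ y ∈ D.U (-cs.simpleRoot s), ∃ y' ∈ D.U (-cs.simpleRoot s), ∃ n,
      y ≠ 1 ∧ y' ≠ 1 ∧ D.Lifts n (cs.simple s) ∧ x = y * n * y' := by
  obtain ⟨m, hm⟩ := hD.exists_isReflectionLift hx hx1
  have hl := hm.lifts
  obtain ⟨-, -, y, ⟨h1, h1', h2, h2', -⟩, rfl⟩ := hm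
  exact ⟨_, inv_mem h1, _, inv_mem h2, _, inv_ne_one.2 h1', inv_ne_one.2 h2', hl, by group⟩

/-- No nontrivial element of `U_{-α_s}` normalizes `U_{α_s}`. -/
theorem IsTRD.eq_one_of_conj_le {s : S} {y : G} (hy : y ∈ D.U (-cs.simpleRoot s))
    (h : ∀ x ∈ D.U (cs.simpleRoot s), y * x * y⁻¹ ∈ D.U (cs.simpleRoot s)) : y = 1 := by
  by_contra hne
  obtain ⟨x, hx, x', hx', n, -, -, hn, rfl⟩ := hD.exists_eq_mul_lift_mul hy hne
  apply hD.not_le_pos s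
  refine le_trans (fun z hz => ?_) (U_le_unipotent_pos (cs.one_mem_simpleRoot s))
  rw [← simple_smul_simpleRoot] at hz
  have h1 := hD.inv_conj_mem hn hz
  have h2 := h _ (mul_mem (mul_mem (inv_mem hx') h1) hx')
  have h3 := mul_mem (mul_mem (inv_mem hx) h2) hx
  convert h3 using 1
  group

theorem IsTRD.eq_one_of_conj_le' {s : S} {x : G} (hx : x ∈ D.U (cs.simpleRoot s))
    (h : ∀ y ∈ D.U (-cs.simpleRoot s), x * y * x⁻¹ ∈ D.U (-cs.simpleRoot s)) : x = 1 := by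
  obtain ⟨_, m, hm⟩ := hD.exists_simple_isReflectionLift s
  have hl := hm.lifts
  have h1 := hD.conj_mem hl hx
  rw [simple_smul_simpleRoot] at h1
  have h2 := hD.eq_one_of_conj_le h1 fun z hz => by
    rw [← simple_smul_neg_simpleRoot] at hz ⊢
    have h3 := hD.conj_mem hl (h _ (hD.inv_conj_mem hl hz))
    convert h3 using 1
    group
  simpa using h2

/-- The pair of axiom (TRD2) is determined by its effect on `U_{α_s}` and `U_{-α_s}` only. -/
theorem IsTRD.reflectionPair_unique {s : S} {u a b a' b' : G}
    (ha : a ∈ D.U (-cs.simpleRoot s)) (hb : b ∈ D.U (-cs.simpleRoot s))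
    (ha' : a' ∈ D.U (-cs.simpleRoot s)) (hb' : b' ∈ D.U (-cs.simpleRoot s))
    (h1 : MulAut.conj (a * u * b) • D.U (cs.simpleRoot s) = D.U (-cs.simpleRoot s))
    (h2 : MulAut.conj (a * u * b) • D.U (-cs.simpleRoot s) = D.U (cs.simpleRoot s))
    (h1' : MulAut.conj (a' * u * b') • D.U (cs.simpleRoot s) = D.U (-cs.simpleRoot s))
    (h2' : MulAut.conj (a' * u * b') • D.U (-cs.simpleRoot s) = D.U (cs.simpleRoot s)) :
    a = a' ∧ b = b' := by
  set m := a * u * b with hm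
  set m' := a' * u * b' with hm'
  -- `m' m⁻¹ = y x` normalizes both root groups
  set y := a' * a⁻¹ with hy
  set x := m * (b⁻¹ * b') * m⁻¹ with hx
  have hyx : y * x = m' * m⁻¹ := by rw [hy, hx, hm, hm']; group
  have hyU : y ∈ D.U (-cs.simpleRoot s) := mul_mem ha' (inv_mem ha)
  have hxU : x ∈ D.U (cs.simpleRoot s) := by
    rw [← h2]; exact MulAut.conj_mul_mem_conj_smul (mul_mem (inv_mem hb) hb')
  have c1 : ∀ z ∈ D.U (cs.simpleRoot s), y * x * z * (y * x)⁻¹ ∈ D.U (cs.simpleRoot s) := by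
    intro z hz
    rw [← h2, MulAut.mem_conj_smul_iff] at hz
    rw [hyx, ← h2', MulAut.mem_conj_smul_iff]
    convert hz using 1
    group
  have c2 : ∀ z ∈ D.U (-cs.simpleRoot s), y * x * z * (y * x)⁻¹ ∈ D.U (-cs.simpleRoot s) := by
    intro z hz
    rw [← h1, MulAut.mem_conj_smul_iff] at hz
    rw [hyx, ← h1', MulAut.mem_conj_smul_iff]
    convert hz using 1
    group
  have ey : y = 1 := hD.eq_one_of_conj_le hyU fun z hz => by
    convert c1 _ (mul_mem (mul_mem (inv_mem hxU) hz) hxU) using 1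
    group
  have ex : x = 1 := hD.eq_one_of_conj_le' hxU fun z hz => by
    convert mul_mem (mul_mem (inv_mem hyU) (c2 _ hz)) hyU using 1
    group
  refine ⟨(mul_inv_eq_one.1 ey).symm, ?_⟩
  rw [hx] at ex
  have : b⁻¹ * b' = 1 := by simpa using ex
  exact inv_mul_eq_one.1 this

end Lifts
end RootGroupData

/-! ### The opposite root data -/

namespace CoxeterSystem

section Intervals

variable {S : Type*} {W : Type*} [Group W] {M : CoxeterMatrix S} {cs : CoxeterSystem M W}

theorem Root.contains_neg {α : cs.Root} {ε : TwinSign} {w : W} :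
    (-α).Contains ε w ↔ α.Contains ε.opp w := by
  cases ε
  · exact Iff.rfl
  · exact not_not

theorem Root.contains_smul {α : cs.Root} {ε : TwinSign} {w v : W} :
    (w • α).Contains ε v ↔ α.Contains ε (w⁻¹ * v) := by
  cases ε
  · exact mem_half_smul
  · exact not_congr mem_half_smul

theorem Prenilpotent.neg {α β : cs.Root} (h : cs.Prenilpotent (-α) (-β)) :
    cs.Prenilpotent α β := by
  simp only [Prenilpotent, neg_neg] at h
  exact ⟨h.2, h.1⟩

theorem neg_mem_openInterval {α β γ : cs.Root} (h : γ ∈ cs.openInterval (-α) (-β)) :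
    -γ ∈ cs.openInterval α β := by
  obtain ⟨h1, h2, h3, h4⟩ := h
  rw [neg_neg, neg_neg] at h2
  exact ⟨h2, by rwa [neg_neg], fun e => h3 (by rw [← e, neg_neg]),
    fun e => h4 (by rw [← e, neg_neg])⟩

theorem neg_mem_openLinearInterval {α β γ : cs.Root}
    (h : γ ∈ cs.openLinearInterval (-α) (-β)) : -γ ∈ cs.openLinearInterval α β := by
  obtain ⟨⟨a, b, c, ha, hb, hc, x, y, hx, hy, rfl⟩, h3, h4⟩ := h
  refine ⟨⟨-a, -b, _, by simpa using ha.neg, by simpa using hb.neg, hc.neg, x, y, hx, hy, ?_⟩,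
    fun e => h3 (by rw [← e, neg_neg]), fun e => h4 (by rw [← e, neg_neg])⟩
  module

end Intervals

end CoxeterSystem

theorem inv_mul_mul_ne_one {G : Type*} [Group G] {m z : G} (hz : z ≠ 1) : m⁻¹ * z * m ≠ 1 := by
  intro h
  apply hz
  have e : z = m * (m⁻¹ * z * m) * m⁻¹ := by group
  rw [e, h]
  group

theorem TwinSign.opp_opp (ε : TwinSign) : ε.opp.opp = ε := by cases ε <;> rfl

namespace RootGroupData

section Flip

variable {S : Type*} {W : Type*} [Group W] {M : CoxeterMatrix S} {cs : CoxeterSystem M W}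
  {G : Type*} [Group G] {D : RootGroupData cs G}

open CoxeterSystem

/-- The opposite data, in which the root groups of `α` and `-α` are exchanged. This exchanges the
two halves of the twin building. -/
def flip (D : RootGroupData cs G) : RootGroupData cs G where
  H := D.H
  U α := D.U (-α)

theorem flip_U (α : cs.Root) : D.flip.U α = D.U (-α) := rfl

theorem flip_flip : D.flip.flip = D := by
  cases D
  simp [flip]

theorem flip_unipotent (ε : TwinSign) : D.flip.unipotent ε = D.unipotent ε.opp := by
  apply le_antisymm
  · refine iSup₂_le fun α hα => le_iSup₂_of_le (-α) ?_ le_rfl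
    rw [Root.contains_neg, TwinSign.opp_opp]
    exact hα
  · refine iSup₂_le fun α hα => le_iSup₂_of_le (-α) ?_ (by rw [flip_U, neg_neg])
    rw [Root.contains_neg]
    exact hα

theorem flip_borel (ε : TwinSign) : D.flip.borel ε = D.borel ε.opp := by
  rw [borel, borel, flip_unipotent]
  rfl

variable (hD : D.IsTRD)
include hD

theorem IsTRD.flip_isReflectionPair {s : S} {y m : G} {x : G × G} (hm : D.Lifts m (cs.simple s))
    (h : D.flip.IsReflectionPair s y x) :
    D.IsReflectionPair s (m⁻¹ * y * m) (m⁻¹ * x.1 * m, m⁻¹ * x.2 * m) := by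
  obtain ⟨h1, h1', h2, h2', h3⟩ := h
  simp only [flip_U, neg_neg] at h1 h2 h3
  rw [← simple_smul_neg_simpleRoot] at h1 h2
  refine ⟨hD.inv_conj_mem hm h1, inv_mul_mul_ne_one h1', hD.inv_conj_mem hm h2,
    inv_mul_mul_ne_one h2', fun β => ?_⟩
  have e : m⁻¹ * x.1 * m * (m⁻¹ * y * m) * (m⁻¹ * x.2 * m) = m⁻¹ * (x.1 * y * x.2) * m := by
    group
  simp only [e]
  have h4 := fun β => h3 (-β)
  simp only [smul_neg_root, neg_neg] at h4
  rw [map_mul, map_mul, mul_smul, mul_smul, hD.conj_smul hm, h4, hD.conj_smul hm.inv,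
    ← mul_smul, ← mul_smul]
  simp

theorem IsTRD.flip_isReflectionLift {s : S} {y m n : G} (hm : D.Lifts m (cs.simple s))
    (h : D.flip.IsReflectionLift s y n) :
    D.IsReflectionLift s (m⁻¹ * y * m) (m⁻¹ * n * m) := by
  obtain ⟨hy, hy1, x, hx, rfl⟩ := h
  have hy : y ∈ D.U (-cs.simpleRoot s) := hy
  exact ⟨hD.inv_conj_mem hm (by rwa [simple_smul_simpleRoot]), inv_mul_mul_ne_one hy1, _,
    hD.flip_isReflectionPair hm hx, by group⟩

theorem IsTRD.lifts_of_flip_lifts {n : G} {w : W} (h : D.flip.Lifts n w) : D.Lifts n w := by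
  have : D.flip.weylGraph ≤ D.weylGraph := by
    rw [weylGraph, Subgroup.closure_le]
    rintro x (⟨h1, h2⟩ | ⟨s, y, hx, h2⟩)
    · exact Subgroup.subset_closure (Or.inl ⟨h1, h2⟩)
    · obtain ⟨_, m, hm⟩ := hD.exists_simple_isReflectionLift s
      have h3 := (hD.flip_isReflectionLift hm.lifts hx).lifts
      have h4 := (hm.lifts.mul h3).mul hm.lifts.inv
      have e : m * (m⁻¹ * x.1 * m) * m⁻¹ = x.1 := by group
      rw [e, mul_inv_cancel_right, ← h2] at h4
      exact h4
  exact this h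

theorem IsTRD.flip : D.flip.IsTRD where
  nontrivial α := hD.nontrivial (-α)
  normalized α := hD.normalized (-α)
  commutator α β hne h := by
    refine (hD.commutator (-α) (-β) (fun e => hne (neg_injective e)) ?_).trans ?_
    · exact Prenilpotent.neg (by simpa only [neg_neg] using h)
    · refine iSup₂_le fun γ hγ => le_iSup₂_of_le (-γ) (neg_mem_openInterval hγ) ?_
      rw [flip_U, neg_neg]
  existsUnique_reflection s y hy hy1 := by
    have hy' : y ∈ D.U (-cs.simpleRoot s) := hy
    obtain ⟨x, hx, x', hx', n, hx1, hx1', hn, e⟩ := hD.exists_eq_mul_lift_mul hy' hy1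
    have hpair : D.flip.IsReflectionPair s y (x⁻¹, x'⁻¹) := by
      refine ⟨?_, inv_ne_one.2 hx1, ?_, inv_ne_one.2 hx1', fun β => ?_⟩
      · rw [flip_U, neg_neg]; exact inv_mem hx
      · rw [flip_U, neg_neg]; exact inv_mem hx'
      · have : x⁻¹ * y * x'⁻¹ = n := by rw [e]; group
        rw [this, flip_U, flip_U, hD.conj_smul hn, smul_neg_root]
    refine ⟨_, hpair, fun z hz => ?_⟩
    have h1 := (hD.existsUnique_reflection s (n⁻¹ * y * n)
      (hD.inv_conj_mem hn (by rwa [simple_smul_simpleRoot])) (inv_mul_mul_ne_one hy1)).unique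
      (hD.flip_isReflectionPair hn hz) (hD.flip_isReflectionPair hn hpair)
    rw [Prod.ext_iff] at h1
    simpa [Prod.ext_iff] using h1
  reflection_coset s u v m m' h h' := by
    obtain ⟨_, n, hn⟩ := hD.exists_simple_isReflectionLift s
    have h1 := hD.reflectionLift_inv_mul (hD.flip_isReflectionLift hn.lifts h)
      (hD.flip_isReflectionLift hn.lifts h')
    have h2 := hD.lifts_conj_mem_H hn.lifts h1
    have e : n * ((n⁻¹ * m * n)⁻¹ * (n⁻¹ * m' * n)) * n⁻¹ = m⁻¹ * m' := by group
    rwa [e] at h2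
  not_le_neg s := by
    rw [flip_unipotent]
    exact hD.not_le_pos s
  not_le_pos s := by
    rw [flip_unipotent, flip_U, neg_neg]
    exact hD.not_le_neg s
  generated := by
    rw [← hD.generated]
    congr 1
    exact (Equiv.neg cs.Root).iSup_congr fun α => rfl

theorem IsTRD.flip_lifts {n : G} {w : W} : D.flip.Lifts n w ↔ D.Lifts n w :=
  ⟨hD.lifts_of_flip_lifts, fun h => hD.flip.lifts_of_flip_lifts (by rwa [flip_flip])⟩

theorem IsTRD.flip_parabolic (ε : TwinSign) (J : Set S) :
    D.flip.parabolic ε J = D.parabolic ε.opp J := by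
  simp only [parabolic, flip_borel, hD.flip_lifts]

omit hD in
theorem IsTRDLin.flip (hL : D.IsTRDLin) : D.flip.IsTRDLin where
  toIsTRD := hL.toIsTRD.flip
  commutator_lin α β hne h := by
    refine (hL.commutator_lin (-α) (-β) (fun e => hne (neg_injective e)) ?_).trans ?_
    · exact Prenilpotent.neg (by simpa only [neg_neg] using h)
    · refine iSup₂_le fun γ hγ => le_iSup₂_of_le (-γ) (neg_mem_openLinearInterval hγ) ?_
      rw [flip_U, neg_neg]

end Flip
end RootGroupData

/-! ### Unipotent radicals -/

section GroupLemmas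

variable {G : Type*} [Group G]

/-- If `A` normalizes `V`, the elements of the subgroup generated by both are products. -/
theorem Subgroup.exists_mul_of_mem_sup {A V : Subgroup G} (h : ∀ a ∈ A, ∀ v ∈ V, a * v * a⁻¹ ∈ V)
    {x : G} (hx : x ∈ V ⊔ A) : ∃ v ∈ V, ∃ a ∈ A, x = v * a := by
  rw [Subgroup.sup_eq_closure] at hx
  induction hx using Subgroup.closure_induction with
  | mem x hx =>
    rcases hx with hx | hx
    · exact ⟨x, hx, 1, one_mem _, by simp⟩
    · exact ⟨1, one_mem _, x, hx, by simp⟩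
  | one => exact ⟨1, one_mem _, 1, one_mem _, by simp⟩
  | mul x y _ _ hx hy =>
    obtain ⟨v, hv, a, ha, rfl⟩ := hx
    obtain ⟨v', hv', a', ha', rfl⟩ := hy
    exact ⟨_, mul_mem hv (h a ha v' hv'), _, mul_mem ha ha', by group⟩
  | inv x _ hx =>
    obtain ⟨v, hv, a, ha, rfl⟩ := hx
    exact ⟨_, h _ (inv_mem ha) _ (inv_mem hv), _, inv_mem ha, by group⟩

theorem Subgroup.exists_mul_of_mem_sup' {A V : Subgroup G}
    (h : ∀ a ∈ A, ∀ v ∈ V, a * v * a⁻¹ ∈ V) {x : G} (hx : x ∈ V ⊔ A) :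
    ∃ a ∈ A, ∃ v ∈ V, x = a * v := by
  obtain ⟨v, hv, a, ha, rfl⟩ := Subgroup.exists_mul_of_mem_sup h hx
  exact ⟨a, ha, a⁻¹ * v * a, by simpa using h _ (inv_mem ha) v hv, by group⟩

theorem Subgroup.le_comap_conj_iff {A K : Subgroup G} {g : G} :
    A ≤ K.comap (MulAut.conj g).toMonoidHom ↔ ∀ x ∈ A, g * x * g⁻¹ ∈ K := Iff.rfl

theorem Subgroup.closure_conj_mem {T : Set G} {K : Subgroup G} {g : G}
    (h : ∀ x ∈ T, g * x * g⁻¹ ∈ K) : ∀ x ∈ Subgroup.closure T, g * x * g⁻¹ ∈ K :=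
  Subgroup.le_comap_conj_iff.1 ((Subgroup.closure_le _).2 h)

end GroupLemmas

namespace RootGroupData

section Radical

variable {S : Type*} {W : Type*} [Group W] {M : CoxeterMatrix S} {cs : CoxeterSystem M W}
  {G : Type*} [Group G] {D : RootGroupData cs G} {J : Set S}

open CoxeterSystem

variable (D J)

/-- The group generated by the root groups of positive roots crossing `W_J`. -/
def leviUnipotent : Subgroup G := ⨆ (α : cs.Root) (_ : α.Crosses J ∧ 1 ∈ α.half), D.U α

/-- The group generated by the root groups of the roots containing `W_J`. -/
def outerUnipotent : Subgroup G :=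
  ⨆ (α : cs.Root) (_ : ∀ x ∈ cs.specialSubgroup J, x ∈ α.half), D.U α

/-- The unipotent radical of the standard positive parabolic subgroup of type `J`, generated by
the conjugates of `outerUnipotent` under `leviUnipotent`. -/
def radical : Subgroup G :=
  Subgroup.closure {y | ∃ x ∈ D.leviUnipotent J, ∃ u ∈ D.outerUnipotent J, y = x * u * x⁻¹}

/-- The commutator condition under which parabolic subgroups of type `J` have a Levi
decomposition: it holds for finite `W_J`, and in the linear setting. -/
def LeviCondition : Prop :=
  ∀ α β : cs.Root, α.Crosses J → (∀ x ∈ cs.specialSubgroup J, x ∈ β.half) →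
    cs.Prenilpotent α β → ⁅D.U α, D.U β⁆ ≤ D.outerUnipotent J

variable {D J}

theorem U_le_leviUnipotent {α : cs.Root} (h : α.Crosses J) (h1 : 1 ∈ α.half) :
    D.U α ≤ D.leviUnipotent J := le_iSup₂_of_le α ⟨h, h1⟩ le_rfl

theorem U_le_outerUnipotent {α : cs.Root} (h : ∀ x ∈ cs.specialSubgroup J, x ∈ α.half) :
    D.U α ≤ D.outerUnipotent J := le_iSup₂_of_le α h le_rfl

theorem leviUnipotent_le : D.leviUnipotent J ≤ D.unipotent .pos :=
  iSup₂_le fun _ h => U_le_unipotent_pos h.2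

theorem outerUnipotent_le : D.outerUnipotent J ≤ D.unipotent .pos :=
  iSup₂_le fun _ h => U_le_unipotent_pos (h 1 (one_mem _))

theorem conj_mem_radical {x u : G} (hx : x ∈ D.leviUnipotent J) (hu : u ∈ D.outerUnipotent J) :
    x * u * x⁻¹ ∈ D.radical J := Subgroup.subset_closure ⟨x, hx, u, hu, rfl⟩

theorem outerUnipotent_le_radical : D.outerUnipotent J ≤ D.radical J := fun u hu => by
  simpa using conj_mem_radical (one_mem _) hu

theorem radical_le : D.radical J ≤ D.unipotent .pos := by
  rw [radical, Subgroup.closure_le]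
  rintro _ ⟨x, hx, u, hu, rfl⟩
  exact mul_mem (mul_mem (leviUnipotent_le hx) (outerUnipotent_le hu))
    (inv_mem (leviUnipotent_le hx))

theorem leviUnipotent_conj_radical {x : G} (hx : x ∈ D.leviUnipotent J) :
    ∀ v ∈ D.radical J, x * v * x⁻¹ ∈ D.radical J := by
  refine Subgroup.closure_conj_mem ?_
  rintro _ ⟨z, hz, u, hu, rfl⟩
  convert conj_mem_radical (mul_mem hx hz) hu using 1
  group

/-- A positive root contains `W_J` or crosses it. -/
theorem unipotent_eq_sup : D.unipotent .pos = D.radical J ⊔ D.leviUnipotent J := by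
  apply le_antisymm
  · refine iSup₂_le fun α (hα : 1 ∈ α.half) => ?_
    by_cases h : ∀ x ∈ cs.specialSubgroup J, x ∈ α.half
    · exact ((U_le_outerUnipotent h).trans outerUnipotent_le_radical).trans le_sup_left
    · push Not at h
      exact (U_le_leviUnipotent ⟨⟨1, one_mem _, hα⟩, h⟩ hα).trans le_sup_right
  · exact sup_le radical_le leviUnipotent_le

theorem exists_levi_mul_radical {u : G} (hu : u ∈ D.unipotent .pos) :
    ∃ x ∈ D.leviUnipotent J, ∃ v ∈ D.radical J, u = x * v := by
  rw [unipotent_eq_sup (J := J)] at hu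
  exact Subgroup.exists_mul_of_mem_sup' (fun _ ha => leviUnipotent_conj_radical ha) hu

variable (hD : D.IsTRD)
include hD

theorem IsTRD.leviCondition_of_finite [Finite (cs.specialSubgroup J)] : D.LeviCondition J := by
  intro α β hα hβ h
  refine (hD.commutator α β ?_ h).trans ?_
  · rintro rfl
    obtain ⟨x, hx, hxα⟩ := hα.2
    exact hxα (hβ x hx)
  · refine iSup₂_le fun γ hγ => U_le_outerUnipotent ?_
    exact hα.special_subset_of_finite hγ.2.2.1 fun x hx hxα => hγ.1 ⟨hxα, hβ x hx⟩

omit hD in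
theorem IsTRDLin.leviCondition (hL : D.IsTRDLin) : D.LeviCondition J := by
  intro α β hα hβ h
  refine (hL.commutator_lin α β ?_ h).trans ?_
  · rintro rfl
    obtain ⟨x, hx, hxα⟩ := hα.2
    exact hxα (hβ x hx)
  · exact iSup₂_le fun γ hγ => U_le_outerUnipotent
      (special_subset_of_mem_openLinearInterval hα hβ hγ)

theorem IsTRD.lifts_conj_outerUnipotent {n : G} {w : W} (hn : D.Lifts n w)
    (hw : w ∈ cs.specialSubgroup J) : ∀ u ∈ D.outerUnipotent J,
      n * u * n⁻¹ ∈ D.outerUnipotent J := by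
  rw [← Subgroup.le_comap_conj_iff]
  refine iSup₂_le fun α hα u hu => ?_
  refine U_le_outerUnipotent (α := w • α) ?_ (hD.conj_mem hn hu)
  intro x hx
  rw [mem_half_smul]
  exact hα _ (mul_mem (inv_mem hw) hx)

theorem IsTRD.H_conj_unipotent {h : G} (hh : h ∈ D.H) (ε : TwinSign) :
    ∀ u ∈ D.unipotent ε, h * u * h⁻¹ ∈ D.unipotent ε := by
  rw [← Subgroup.le_comap_conj_iff]
  refine iSup₂_le fun α hα u hu => ?_
  have := hD.conj_mem (lifts_of_mem hh) hu
  rw [one_smul] at this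
  exact (le_iSup₂_of_le α hα le_rfl : D.U α ≤ D.unipotent ε) this

theorem IsTRD.H_conj_leviUnipotent {h : G} (hh : h ∈ D.H) :
    ∀ u ∈ D.leviUnipotent J, h * u * h⁻¹ ∈ D.leviUnipotent J := by
  rw [← Subgroup.le_comap_conj_iff]
  refine iSup₂_le fun α hα u hu => ?_
  have := hD.conj_mem (lifts_of_mem hh) hu
  rw [one_smul] at this
  exact U_le_leviUnipotent hα.1 hα.2 this

theorem IsTRD.H_conj_radical {h : G} (hh : h ∈ D.H) :
    ∀ v ∈ D.radical J, h * v * h⁻¹ ∈ D.radical J := by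
  refine Subgroup.closure_conj_mem ?_
  rintro _ ⟨x, hx, u, hu, rfl⟩
  convert conj_mem_radical (hD.H_conj_leviUnipotent hh x hx)
    (hD.lifts_conj_outerUnipotent (lifts_of_mem hh) (one_mem _) u hu) using 1
  group

/-- The crucial point for the invariance of the radical. If `{-α_s, β}` is not prenilpotent, then
`α_s ⊆ β`, so that `{α_s, β}` is prenilpotent and a factorization `y = x n x'` through a lift `n`
of `s` can be used. -/
theorem IsTRD.conj_outerUnipotent_mem_radical (hJ : D.LeviCondition J) {s : S} (hs : s ∈ J)
    {y : G} (hy : y ∈ D.U (-cs.simpleRoot s)) :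
    ∀ u ∈ D.outerUnipotent J, y * u * y⁻¹ ∈ D.radical J := by
  have hcross := crosses_simpleRoot (cs := cs) hs
  have hcomm : ∀ α β : cs.Root, α.Crosses J → (∀ x ∈ cs.specialSubgroup J, x ∈ β.half) →
      cs.Prenilpotent α β → ∀ x ∈ D.U α, ∀ u ∈ D.U β, x * u * x⁻¹ ∈ D.outerUnipotent J := by
    intro α β hα hβ h x hx u hu
    have h1 := hJ α β hα hβ h (Subgroup.commutator_mem_commutator hx hu)
    rw [commutatorElement_def] at h1
    simpa using mul_mem h1 (U_le_outerUnipotent hβ hu)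
  rw [← Subgroup.le_comap_conj_iff]
  refine iSup₂_le fun β hβ u hu => ?_
  show y * u * y⁻¹ ∈ D.radical J
  by_cases hp : cs.Prenilpotent (-cs.simpleRoot s) β
  · exact outerUnipotent_le_radical (hcomm _ _ hcross.neg hβ hp y hy u hu)
  obtain rfl | hy1 := eq_or_ne y 1
  · simpa using outerUnipotent_le_radical (U_le_outerUnipotent hβ hu)
  have hsub : ∀ w, w ∉ β.half → w ∉ (cs.simpleRoot s).half := by
    intro w hw hw'
    refine hp ⟨⟨cs.simple s, cs.simple_notMem_simpleRoot s, hβ _ (simple_mem_special hs)⟩,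
      ⟨w, ?_, hw⟩⟩
    rwa [neg_neg]
  obtain ⟨w, hw⟩ : ∃ w, w ∉ β.half := by
    obtain ⟨w, t, rfl⟩ := cs.exists_eq_smul_simpleRoot β
    exact ⟨w * cs.simple t, by
      rw [mem_half_smul, inv_mul_cancel_left]; exact cs.simple_notMem_simpleRoot t⟩
  have hp' : cs.Prenilpotent (cs.simpleRoot s) β :=
    ⟨⟨1, cs.one_mem_simpleRoot s, hβ 1 (one_mem _)⟩, ⟨w, hsub w hw, hw⟩⟩
  obtain ⟨x, hx, x', hx', n, -, -, hn, rfl⟩ := hD.exists_eq_mul_lift_mul hy hy1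
  have h1 := hcomm _ _ hcross hβ hp' x' hx' u hu
  have h2 := hD.lifts_conj_outerUnipotent hn (simple_mem_special hs) _ h1
  convert conj_mem_radical (U_le_leviUnipotent hcross (cs.one_mem_simpleRoot s) hx) h2 using 1
  group

/-- The radical is normalized by the lifts of `s ∈ J`. -/
theorem IsTRD.lifts_simple_conj_radical (hJ : D.LeviCondition J) {s : S} (hs : s ∈ J) {n : G}
    (hn : D.Lifts n (cs.simple s))
    (hdec : ∀ x ∈ D.leviUnipotent J, ∃ v, n * v * n⁻¹ ∈ D.leviUnipotent J ∧
      ∃ a ∈ D.U (cs.simpleRoot s), x = v * a) :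
    ∀ v ∈ D.radical J, n * v * n⁻¹ ∈ D.radical J := by
  refine Subgroup.closure_conj_mem ?_
  rintro _ ⟨x, hx, u, hu, rfl⟩
  obtain ⟨v, hv, a, ha, rfl⟩ := hdec x hx
  have h1 := hD.conj_mem hn ha
  rw [simple_smul_simpleRoot] at h1
  have h2 := leviUnipotent_conj_radical hv _ (hD.conj_outerUnipotent_mem_radical hJ hs h1 _
    (hD.lifts_conj_outerUnipotent hn (simple_mem_special hs) u hu))
  convert h2 using 1
  group

/-! ### Rank one -/

omit hD in
theorem leviUnipotent_singleton (s : S) : D.leviUnipotent {s} = D.U (cs.simpleRoot s) := by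
  apply le_antisymm
  · refine iSup₂_le fun α hα => ?_
    obtain ⟨⟨-, x, hx, hxα⟩, h1⟩ := hα
    rcases mem_specialSubgroup_singleton hx with rfl | rfl
    · exact absurd h1 hxα
    · rw [eq_smul_simpleRoot_of_separates h1 (by rwa [one_mul]), one_smul]
  · exact U_le_leviUnipotent (crosses_simpleRoot rfl) (cs.one_mem_simpleRoot s)

omit hD in
theorem finite_specialSubgroup_singleton (s : S) : Finite (cs.specialSubgroup {s}) := by
  rw [specialSubgroup, Set.image_singleton, ← Subgroup.zpowers_eq_closure]
  have : IsOfFinOrder (cs.simple s) :=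
    isOfFinOrder_iff_pow_eq_one.2 ⟨2, by norm_num, cs.simple_sq s⟩
  exact this.finite_zpowers

theorem IsTRD.lifts_conj_radical_singleton {s : S} {n : G} (hn : D.Lifts n (cs.simple s)) :
    ∀ v ∈ D.radical {s}, n * v * n⁻¹ ∈ D.radical {s} := by
  have := finite_specialSubgroup_singleton (cs := cs) s
  refine hD.lifts_simple_conj_radical hD.leviCondition_of_finite (Set.mem_singleton s) hn
    fun x hx => ?_
  rw [leviUnipotent_singleton] at hx
  exact ⟨1, by simp [one_mem], x, hx, by simp⟩

omit hD in
theorem exists_root_mul_radical {u : G} (s : S) (hu : u ∈ D.unipotent .pos) :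
    ∃ x ∈ D.U (cs.simpleRoot s), ∃ v ∈ D.radical {s}, u = x * v := by
  obtain ⟨x, hx, v, hv, e⟩ := exists_levi_mul_radical (J := {s}) hu
  rw [leviUnipotent_singleton] at hx
  exact ⟨x, hx, v, hv, e⟩

theorem IsTRD.exists_unipotent_mul_H {ε : TwinSign} {b : G} (hb : b ∈ D.borel ε) :
    ∃ u ∈ D.unipotent ε, ∃ h ∈ D.H, b = u * h := by
  rw [borel, sup_comm] at hb
  exact Subgroup.exists_mul_of_mem_sup (fun _ ha => hD.H_conj_unipotent ha ε) hb

omit hD in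
theorem H_le_borel (ε : TwinSign) : D.H ≤ D.borel ε := le_sup_left

omit hD in
theorem unipotent_le_borel (ε : TwinSign) : D.unipotent ε ≤ D.borel ε := le_sup_right

theorem IsTRD.borel_conj_unipotent {ε : TwinSign} {b : G} (hb : b ∈ D.borel ε) :
    ∀ u ∈ D.unipotent ε, b * u * b⁻¹ ∈ D.unipotent ε := by
  obtain ⟨v, hv, h, hh, rfl⟩ := hD.exists_unipotent_mul_H hb
  intro u hu
  convert mul_mem (mul_mem hv (hD.H_conj_unipotent hh ε u hu)) (inv_mem hv) using 1
  group

/-- The standard positive Borel subgroup is `U_{α_s} V_s H`, where `V_s` is the radical of the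
parabolic subgroup of type `{s}`. -/
theorem IsTRD.exists_borel_factorization (s : S) {b : G} (hb : b ∈ D.borel .pos) {n : G}
    (hn : D.Lifts n (cs.simple s)) :
    ∃ x ∈ D.U (cs.simpleRoot s), ∃ c, b = x * c ∧ n⁻¹ * c * n ∈ D.borel .pos := by
  obtain ⟨u, hu, h, hh, rfl⟩ := hD.exists_unipotent_mul_H hb
  obtain ⟨x, hx, v, hv, rfl⟩ := exists_root_mul_radical s hu
  refine ⟨x, hx, v * h, by group, ?_⟩
  have hn' : D.Lifts n⁻¹ (cs.simple s) := by simpa using hn.inv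
  have h1 := hD.lifts_conj_radical_singleton hn' v hv
  have h2 := hD.lifts_conj_mem_H hn' hh
  rw [inv_inv] at h1 h2
  convert mul_mem (unipotent_le_borel .pos (radical_le h1)) (H_le_borel .pos h2) using 1
  group

end Radical
end RootGroupData

/-! ### The Bruhat decomposition -/

namespace RootGroupData

section Bruhat

variable {S : Type*} {W : Type*} [Group W] {M : CoxeterMatrix S} {cs : CoxeterSystem M W}
  {G : Type*} [Group G] {D : RootGroupData cs G}

open CoxeterSystem

variable (D) in
/-- The double coset `B_ε w B_ε`. -/
def cell (ε : TwinSign) (w : W) : Set G :=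
  {g | ∃ b ∈ D.borel ε, ∃ n, D.Lifts n w ∧ ∃ b' ∈ D.borel ε, g = b * n * b'}

theorem Lifts.mem_cell {n : G} {w : W} (hn : D.Lifts n w) (ε : TwinSign) : n ∈ D.cell ε w :=
  ⟨1, one_mem _, n, hn, 1, one_mem _, by simp⟩

theorem mul_mem_cell {ε : TwinSign} {w : W} {b g : G} (hb : b ∈ D.borel ε) (hg : g ∈ D.cell ε w) :
    b * g ∈ D.cell ε w := by
  obtain ⟨c, hc, n, hn, c', hc', rfl⟩ := hg
  exact ⟨b * c, mul_mem hb hc, n, hn, c', hc', by group⟩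

theorem cell_mul_mem {ε : TwinSign} {w : W} {b g : G} (hg : g ∈ D.cell ε w) (hb : b ∈ D.borel ε) :
    g * b ∈ D.cell ε w := by
  obtain ⟨c, hc, n, hn, c', hc', rfl⟩ := hg
  exact ⟨c, hc, n, hn, c' * b, mul_mem hc' hb, by group⟩

theorem inv_mem_cell {ε : TwinSign} {w : W} {g : G} (hg : g ∈ D.cell ε w) :
    g⁻¹ ∈ D.cell ε w⁻¹ := by
  obtain ⟨c, hc, n, hn, c', hc', rfl⟩ := hg
  exact ⟨_, inv_mem hc', _, hn.inv, _, inv_mem hc, by group⟩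

theorem U_le_borel {α : cs.Root} (h : 1 ∈ α.half) : D.U α ≤ D.borel .pos :=
  (U_le_unipotent_pos h).trans (unipotent_le_borel _)

theorem mem_parabolic_iff {ε : TwinSign} {J : Set S} {g : G} :
    g ∈ D.parabolic ε J ↔ ∃ w ∈ cs.specialSubgroup J, g ∈ D.cell ε w := by
  constructor
  · rintro ⟨b, hb, n, w, hw, hn, b', hb', e⟩
    exact ⟨w, hw, b, hb, n, hn, b', hb', e⟩
  · rintro ⟨w, hw, b, hb, n, hn, b', hb', e⟩
    exact ⟨b, hb, n, w, hw, hn, b', hb', e⟩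

variable (hD : D.IsTRD)
include hD

theorem IsTRD.flip_cell (ε : TwinSign) (w : W) : D.flip.cell ε w = D.cell ε.opp w := by
  simp only [cell, flip_borel, hD.flip_lifts]

theorem IsTRD.mem_cell_one_iff {ε : TwinSign} {g : G} : g ∈ D.cell ε 1 ↔ g ∈ D.borel ε := by
  constructor
  · rintro ⟨b, hb, n, hn, b', hb', rfl⟩
    exact mul_mem (mul_mem hb (H_le_borel _ (hD.mem_of_lifts_one hn))) hb'
  · exact fun hg => ⟨g, hg, 1, lifts_one, 1, one_mem _, by simp⟩

theorem IsTRD.exists_eq_mul_of_mem_cell {ε : TwinSign} {w : W} {g n : G} (hg : g ∈ D.cell ε w)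
    (hn : D.Lifts n w) : ∃ b ∈ D.borel ε, ∃ b' ∈ D.borel ε, g = b * n * b' := by
  obtain ⟨b, hb, m, hm, b', hb', rfl⟩ := hg
  refine ⟨b, hb, n⁻¹ * m * b', mul_mem (H_le_borel _ ?_) hb', by group⟩
  exact hD.lifts_inv_mul_mem hn hm

theorem IsTRD.cell_mul_lift_of_lt {w : W} {s : S} {g n : G} (hg : g ∈ D.cell .pos w)
    (hn : D.Lifts n (cs.simple s)) (h : cs.length w < cs.length (w * cs.simple s)) :
    g * n ∈ D.cell .pos (w * cs.simple s) := by
  obtain ⟨b, hb, m, hm, b', hb', rfl⟩ := hg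
  obtain ⟨x, hx, c, rfl, hc⟩ := hD.exists_borel_factorization s hb' hn
  exact ⟨b * (m * x * m⁻¹), mul_mem hb (U_le_borel
    ((cs.one_mem_smul_simpleRoot_iff w s).2 h) (hD.conj_mem hm hx)), m * n, hm.mul hn, _, hc,
    by group⟩

theorem IsTRD.cell_mul_lift {w : W} {s : S} {g n : G} (hg : g ∈ D.cell .pos w)
    (hn : D.Lifts n (cs.simple s)) :
    g * n ∈ D.cell .pos w ∨ g * n ∈ D.cell .pos (w * cs.simple s) := by
  by_cases h : cs.length w < cs.length (w * cs.simple s)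
  · exact Or.inr (hD.cell_mul_lift_of_lt hg hn h)
  have h' : cs.length (w * cs.simple s) < cs.length (w * cs.simple s * cs.simple s) := by
    rw [cs.simple_mul_simple_cancel_right]
    have := cs.length_mul_simple_ne w s
    omega
  obtain ⟨b, hb, m, hm, b', hb', rfl⟩ := hg
  obtain ⟨x, hx, c, rfl, hc⟩ := hD.exists_borel_factorization s hb' hn
  have hm1 := hm.mul hn
  have hy := hD.conj_mem hn.inv hx
  rw [inv_inv, cs.inv_simple, simple_smul_simpleRoot] at hy
  have e : b * m * (x * c) * n = b * (m * n * (n⁻¹ * x * n)) * (n⁻¹ * c * n) := by group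
  rw [e]
  by_cases hy1 : n⁻¹ * x * n = 1
  · right
    rw [hy1, mul_one]
    exact cell_mul_mem (mul_mem_cell hb (hm1.mem_cell _)) hc
  · left
    obtain ⟨x1, hx1, x2, hx2, n2, -, -, hn2, e2⟩ := hD.exists_eq_mul_lift_mul hy hy1
    rw [e2]
    have h1 := hD.cell_mul_lift_of_lt (cell_mul_mem (hm1.mem_cell .pos)
      (U_le_borel (cs.one_mem_simpleRoot s) hx1)) hn2 h'
    rw [cs.simple_mul_simple_cancel_right] at h1
    have h2 := cell_mul_mem (mul_mem_cell hb
      (cell_mul_mem h1 (U_le_borel (cs.one_mem_simpleRoot s) hx2))) hc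
    convert h2 using 1
    group

/-- An element of `B_+` that lifts `w` forces `w = 1`: otherwise it would conjugate some
`U_{-α_s}` into `U_+`. -/
theorem IsTRD.eq_one_of_lifts_of_mem_borel {n : G} {w : W} (hn : D.Lifts n w)
    (hb : n ∈ D.borel .pos) : w = 1 := by
  by_contra hne
  obtain ⟨s, hs⟩ := cs.exists_rightDescent_of_ne_one hne
  refine hD.not_le_pos s fun y hy => ?_
  have h1 := hD.conj_mem hn hy
  have h2 : 1 ∈ (w • (-cs.simpleRoot s)).half := by
    rw [smul_neg_root, mem_half_neg, one_mem_smul_simpleRoot_iff]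
    exact not_lt.2 hs.le
  have h3 := hD.borel_conj_unipotent (inv_mem hb) _ (U_le_unipotent_pos h2 h1)
  convert h3 using 1
  group

theorem IsTRD.cell_unique_aux (k : ℕ) : ∀ {w w' : W} {g : G}, cs.length w = k →
    cs.length w ≤ cs.length w' → g ∈ D.cell .pos w → g ∈ D.cell .pos w' → w = w' := by
  induction k with
  | zero =>
    intro w w' g hw _ hg hg'
    rw [cs.length_eq_zero_iff] at hw
    subst hw
    rw [hD.mem_cell_one_iff] at hg
    obtain ⟨b, hb, n, hn, b', hb', rfl⟩ := hg'
    refine (hD.eq_one_of_lifts_of_mem_borel hn ?_).symm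
    convert mul_mem (mul_mem (inv_mem hb) hg) (inv_mem hb') using 1
    group
  | succ k ih =>
    intro w w' g hw hle hg hg'
    obtain ⟨s, hs⟩ := cs.exists_rightDescent_of_ne_one (w := w) (by
      rintro rfl; simp at hw)
    obtain ⟨n, hn⟩ := hD.exists_lifts (cs.simple s)
    obtain ⟨b, hb, m, hm, b', hb', rfl⟩ := hg
    have h1 : m ∈ D.cell .pos w' := by
      convert cell_mul_mem (mul_mem_cell (inv_mem hb) hg') (inv_mem hb') using 1
      group
    have h2 := (hm.mul hn).mem_cell .pos
    rw [cs.isRightDescent_iff] at hs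
    rcases hD.cell_mul_lift h1 hn with h3 | h3
    · have := ih (by omega) (by omega) h2 h3
      rw [← this] at hle
      omega
    · have h4 := cs.length_mul_simple w' s
      have := ih (by omega) (by omega) h2 h3
      exact mul_right_cancel this

theorem IsTRD.cell_pos_unique {w w' : W} {g : G} (hg : g ∈ D.cell .pos w)
    (hg' : g ∈ D.cell .pos w') : w = w' := by
  rcases le_total (cs.length w) (cs.length w') with h | h
  · exact hD.cell_unique_aux _ rfl h hg hg'
  · exact (hD.cell_unique_aux _ rfl h hg' hg).symm

/-- Uniqueness in the Bruhat decomposition. -/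
theorem IsTRD.cell_unique {ε : TwinSign} {w w' : W} {g : G} (hg : g ∈ D.cell ε w)
    (hg' : g ∈ D.cell ε w') : w = w' := by
  cases ε
  · exact hD.cell_pos_unique hg hg'
  · exact hD.flip.cell_pos_unique (by rwa [hD.flip_cell]) (by rwa [hD.flip_cell])

/-- Products of double cosets stay in the same coset of a special subgroup. -/
theorem IsTRD.cell_mul_lift_special {J : Set S} {v w : W} (hw : w ∈ cs.specialSubgroup J) :
    ∀ {g n : G}, g ∈ D.cell .pos v → D.Lifts n w →
      ∃ v', v⁻¹ * v' ∈ cs.specialSubgroup J ∧ g * n ∈ D.cell .pos v' := by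
  have key : ∀ j ∈ J, ∀ v (g n : G), g ∈ D.cell .pos v → D.Lifts n (cs.simple j) →
      ∃ v', v⁻¹ * v' ∈ cs.specialSubgroup J ∧ g * n ∈ D.cell .pos v' := by
    intro j hj v g n hg hn
    rcases hD.cell_mul_lift hg hn with h | h
    · exact ⟨v, by simp [one_mem], h⟩
    · exact ⟨_, by simpa using simple_mem_special hj, h⟩
  induction hw using Subgroup.closure_induction_right with
  | one =>
    intro g n hg hn
    exact ⟨v, by simp [one_mem], cell_mul_mem hg (H_le_borel _ (hD.mem_of_lifts_one hn))⟩
  | mul_right x hx y hy ih =>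
    obtain ⟨j, hj, rfl⟩ := hy
    intro g n hg hn
    obtain ⟨m, hm⟩ := hD.exists_lifts (cs.simple j)
    have hm' := hn.mul hm.inv
    rw [mul_inv_cancel_right] at hm'
    obtain ⟨v', hv', h⟩ := ih hg hm'
    obtain ⟨v'', hv'', h'⟩ := key j hj _ _ m h hm
    refine ⟨v'', ?_, ?_⟩
    · have := mul_mem hv' hv''
      rwa [mul_assoc, mul_inv_cancel_left] at this
    · convert h' using 1
      group
  | mul_inv_cancel x hx y hy ih =>
    obtain ⟨j, hj, rfl⟩ := hy
    intro g n hg hn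
    rw [cs.inv_simple] at hn
    obtain ⟨m, hm⟩ := hD.exists_lifts (cs.simple j)
    have hm' := hn.mul hm.inv
    rw [mul_inv_cancel_right] at hm'
    obtain ⟨v', hv', h⟩ := ih hg hm'
    obtain ⟨v'', hv'', h'⟩ := key j hj _ _ m h hm
    refine ⟨v'', ?_, ?_⟩
    · have := mul_mem hv' hv''
      rwa [mul_assoc, mul_inv_cancel_left] at this
    · convert h' using 1
      group

theorem IsTRD.cell_mul_cell_special {J : Set S} {v w : W} (hw : w ∈ cs.specialSubgroup J)
    {g p : G} (hg : g ∈ D.cell .pos v) (hp : p ∈ D.cell .pos w) :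
      ∃ v', v⁻¹ * v' ∈ cs.specialSubgroup J ∧ g * p ∈ D.cell .pos v' := by
  obtain ⟨b, hb, n, hn, b', hb', rfl⟩ := hp
  obtain ⟨v', hv', h⟩ := hD.cell_mul_lift_special hw (cell_mul_mem hg hb) hn
  refine ⟨v', hv', ?_⟩
  convert cell_mul_mem h hb' using 1
  group

theorem IsTRD.parabolic_mul_mem {ε : TwinSign} {J : Set S} {p q : G} (hp : p ∈ D.parabolic ε J)
    (hq : q ∈ D.parabolic ε J) : p * q ∈ D.parabolic ε J := by
  have key : ∀ {D : RootGroupData cs G}, D.IsTRD → ∀ {p q : G}, p ∈ D.parabolic .pos J →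
      q ∈ D.parabolic .pos J → p * q ∈ D.parabolic .pos J := by
    intro D hD p q hp hq
    rw [mem_parabolic_iff] at hp hq ⊢
    obtain ⟨v, hv, hp⟩ := hp
    obtain ⟨w, hw, hq⟩ := hq
    obtain ⟨v', hv', h⟩ := hD.cell_mul_cell_special hw hp hq
    exact ⟨v', by simpa using mul_mem hv hv', h⟩
  cases ε
  · exact key hD hp hq
  · have h := hD.flip_parabolic .pos J
    rw [show TwinSign.pos.opp = .neg from rfl] at h
    rw [← h] at hp hq ⊢
    exact key hD.flip hp hq

omit hD in
theorem inv_mem_parabolic {ε : TwinSign} {J : Set S} {p : G} (hp : p ∈ D.parabolic ε J) :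
    p⁻¹ ∈ D.parabolic ε J := by
  rw [mem_parabolic_iff] at hp ⊢
  obtain ⟨v, hv, hp⟩ := hp
  exact ⟨v⁻¹, inv_mem hv, inv_mem_cell hp⟩

omit hD in
theorem one_mem_parabolic (ε : TwinSign) (J : Set S) : 1 ∈ D.parabolic ε J :=
  mem_parabolic_iff.2 ⟨1, one_mem _, lifts_one.mem_cell ε⟩

omit hD in
theorem borel_subset_parabolic {ε : TwinSign} {J : Set S} {b : G} (hb : b ∈ D.borel ε) :
    b ∈ D.parabolic ε J :=
  ⟨b, hb, 1, 1, one_mem _, lifts_one, 1, one_mem _, by simp⟩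

omit hD in
theorem Lifts.mem_parabolic {ε : TwinSign} {J : Set S} {n : G} {w : W} (hn : D.Lifts n w)
    (hw : w ∈ cs.specialSubgroup J) : n ∈ D.parabolic ε J :=
  mem_parabolic_iff.2 ⟨w, hw, hn.mem_cell ε⟩

/-- Existence in the Bruhat decomposition. -/
theorem IsTRD.exists_mem_cell (ε : TwinSign) (g : G) : ∃ w, g ∈ D.cell ε w := by
  have key : ∀ {D : RootGroupData cs G}, D.IsTRD → ∀ g, ∃ w, g ∈ D.cell .pos w := by
    intro D hD g
    let P : Subgroup G :=
      { carrier := D.parabolic .pos Set.univ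
        mul_mem' := hD.parabolic_mul_mem
        one_mem' := one_mem_parabolic _ _
        inv_mem' := inv_mem_parabolic }
    have huniv : ∀ w, w ∈ cs.specialSubgroup Set.univ := by
      intro w
      rw [specialSubgroup, Set.image_univ, cs.subgroup_closure_range_simple]
      trivial
    have hP : P = ⊤ := by
      rw [← top_le_iff, ← hD.generated]
      refine sup_le (fun h hh => borel_subset_parabolic (H_le_borel _ hh)) (iSup_le fun α => ?_)
      obtain ⟨w, s, rfl⟩ := cs.exists_eq_smul_simpleRoot α
      obtain ⟨n, hn⟩ := hD.exists_lifts w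
      intro x hx
      have h1 := hD.inv_conj_mem hn hx
      have hnP : n ∈ P := hn.mem_parabolic (huniv w)
      have h2 : n⁻¹ * x * n ∈ P :=
        borel_subset_parabolic (U_le_borel (cs.one_mem_simpleRoot s) h1)
      convert mul_mem (mul_mem hnP h2) (inv_mem hnP) using 1
      group
    have hg : g ∈ P := by rw [hP]; trivial
    obtain ⟨w, -, h⟩ := mem_parabolic_iff.1 hg
    exact ⟨w, h⟩
  cases ε
  · exact key hD g
  · obtain ⟨w, h⟩ := key hD.flip g
    rw [hD.flip_cell] at h
    exact ⟨w, h⟩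

theorem IsTRD.eq_one_of_mem_neg_of_mem_borel {s : S} {y : G} (hy : y ∈ D.U (-cs.simpleRoot s))
    (hb : y ∈ D.borel .pos) : y = 1 := by
  by_contra hne
  obtain ⟨x, hx, x', hx', n, -, -, hn, rfl⟩ := hD.exists_eq_mul_lift_mul hy hne
  have hB := U_le_borel (D := D) (cs.one_mem_simpleRoot s)
  have h1 : n ∈ D.borel .pos := by
    convert mul_mem (mul_mem (inv_mem (hB hx)) hb) (inv_mem (hB hx')) using 1
    group
  have h2 := hD.eq_one_of_lifts_of_mem_borel hn h1
  have h3 := cs.length_simple s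
  rw [h2, cs.length_one] at h3
  omega

end Bruhat
end RootGroupData

/-! ### Segments -/

namespace RootGroupData

section Segment

variable {S : Type*} {W : Type*} [Group W] {M : CoxeterMatrix S} {cs : CoxeterSystem M W}
  {G : Type*} [Group G] {D : RootGroupData cs G}

open CoxeterSystem

variable (D) in
/-- The group generated by the root groups of the roots containing `a` but not `b`. -/
def segment (a b : W) : Subgroup G :=
  ⨆ (α : cs.Root) (_ : a ∈ α.half ∧ b ∉ α.half), D.U α

theorem U_le_segment {α : cs.Root} {a b : W} (ha : a ∈ α.half) (hb : b ∉ α.half) :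
    D.U α ≤ D.segment a b := le_iSup₂_of_le α ⟨ha, hb⟩ le_rfl

theorem segment_self (a : W) : D.segment a a = ⊥ := by
  rw [eq_bot_iff]
  exact iSup₂_le fun α h => absurd h.1 h.2

theorem segment_one_le (b : W) : D.segment 1 b ≤ D.borel .pos :=
  iSup₂_le fun _ h => U_le_borel h.1

theorem notMem_mul_simple {α : cs.Root} {a w : W} {s : S} (has : a ∈ (w • cs.simpleRoot s).half)
    (ha : a ∈ α.half) (hw : w ∉ α.half) : w * cs.simple s ∉ α.half := by
  intro h
  have e := eq_smul_simpleRoot_of_separates (α := α) (w := w * cs.simple s) (s := s) h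
    (by rwa [cs.simple_mul_simple_cancel_right])
  rw [mul_smul, simple_smul_simpleRoot, smul_neg_root] at e
  rw [e] at ha
  exact ha has

theorem mem_smul_simpleRoot_self (w : W) (s : S) : w ∈ (w • cs.simpleRoot s).half := by
  rw [mem_half_smul, inv_mul_cancel]
  exact cs.one_mem_simpleRoot s

theorem mul_simple_notMem_smul_simpleRoot (w : W) (s : S) :
    w * cs.simple s ∉ (w • cs.simpleRoot s).half := by
  rw [mem_half_smul, inv_mul_cancel_left]
  exact cs.simple_notMem_simpleRoot s

theorem segment_le_segment_mul_simple {a w : W} {s : S}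
    (has : a ∈ (w • cs.simpleRoot s).half) : D.segment a w ≤ D.segment a (w * cs.simple s) :=
  iSup₂_le fun _ h => U_le_segment h.1 (notMem_mul_simple has h.1 h.2)

variable (hD : D.IsTRD)
include hD

theorem IsTRD.conj_mem_segment {n : G} {w a b : W} (hn : D.Lifts n w) :
    ∀ x ∈ D.segment a b, n * x * n⁻¹ ∈ D.segment (w * a) (w * b) := by
  rw [← Subgroup.le_comap_conj_iff]
  refine iSup₂_le fun α hα x hx => ?_
  refine U_le_segment (α := w • α) ?_ ?_ (hD.conj_mem hn hx)
  · rw [mem_half_smul, inv_mul_cancel_left]; exact hα.1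
  · rw [mem_half_smul, inv_mul_cancel_left]; exact hα.2

theorem IsTRD.inv_conj_mem_segment {n : G} {w a b : W} (hn : D.Lifts n w) :
    ∀ x ∈ D.segment a b, n⁻¹ * x * n ∈ D.segment (w⁻¹ * a) (w⁻¹ * b) := by
  simpa using hD.conj_mem_segment (a := a) (b := b) hn.inv

/-- The root group of `w α_s` normalizes the group of the roots separating `a` from `w`: the interval
between `w α_s` and such a root consists of roots separating `a` from `w`. -/
theorem IsTRD.exists_segment_factorization {a w : W} {s : S}
    (has : a ∈ (w • cs.simpleRoot s).half) {q : G} (hq : q ∈ D.segment a (w * cs.simple s)) :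
    ∃ p ∈ D.segment a w, ∃ x ∈ D.U (w • cs.simpleRoot s), q = p * x := by
  set β := w • cs.simpleRoot s with hβ
  have hwβ : w ∈ β.half := mem_smul_simpleRoot_self w s
  have hwsβ : w * cs.simple s ∉ β.half := mul_simple_notMem_smul_simpleRoot w s
  have hnorm : ∀ x ∈ D.U β, ∀ p ∈ D.segment a w, x * p * x⁻¹ ∈ D.segment a w := by
    intro x hx
    rw [← Subgroup.le_comap_conj_iff]
    refine iSup₂_le fun α hα p hp => ?_
    show x * p * x⁻¹ ∈ D.segment a w
    have hws := notMem_mul_simple has hα.1 hα.2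
    have h1 := hD.commutator β α (by rintro rfl; exact hα.2 hwβ)
      ⟨⟨a, has, hα.1⟩, ⟨w * cs.simple s, hwsβ, hws⟩⟩
      (Subgroup.commutator_mem_commutator hx hp)
    have h2 : x * p * x⁻¹ * p⁻¹ ∈ D.segment a w := by
      refine (iSup₂_le fun γ hγ => ?_ : _ ≤ D.segment a w) h1
      refine U_le_segment (hγ.1 ⟨has, hα.1⟩) fun hw => hγ.2.2.1 ?_
      exact eq_smul_simpleRoot_of_separates hw (hγ.2.1 ⟨hwsβ, hws⟩)
    simpa using mul_mem h2 (U_le_segment hα.1 hα.2 hp)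
  refine Subgroup.exists_mul_of_mem_sup hnorm ?_
  refine (iSup₂_le fun α hα => ?_ : D.segment a (w * cs.simple s) ≤ _) hq
  by_cases hw : w ∈ α.half
  · rw [eq_smul_simpleRoot_of_separates hw hα.2]
    exact le_sup_right
  · exact (U_le_segment hα.1 hw).trans le_sup_left

/-- `B_+ w B_+ = U_w w B_+`, where `U_w` is generated by the root groups of the positive roots not
containing `w`. -/
theorem IsTRD.exists_eq_segment_mul {w : W} : ∀ {g n : G}, g ∈ D.cell .pos w → D.Lifts n w →
    ∃ q ∈ D.segment 1 w, ∃ b ∈ D.borel .pos, g = q * n * b := by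
  induction hk : cs.length w generalizing w with
  | zero =>
    rw [cs.length_eq_zero_iff] at hk
    subst hk
    intro g n hg hn
    rw [hD.mem_cell_one_iff] at hg
    exact ⟨1, one_mem _, n⁻¹ * g,
      mul_mem (inv_mem (H_le_borel _ (hD.mem_of_lifts_one hn))) hg, by group⟩
  | succ k ih =>
    intro g n hg hn
    obtain ⟨s, hs⟩ := cs.exists_rightDescent_of_ne_one (w := w) (by rintro rfl; simp at hk)
    rw [cs.isRightDescent_iff] at hs
    obtain ⟨w, rfl⟩ : ∃ w1, w = w1 * cs.simple s := ⟨w * cs.simple s, by simp⟩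
    rw [cs.simple_mul_simple_cancel_right] at hs
    obtain ⟨m, hm⟩ := hD.exists_lifts (cs.simple s)
    have hm1 := hn.mul hm.inv
    rw [mul_inv_cancel_right] at hm1
    obtain ⟨b, hb, b', hb', rfl⟩ := hD.exists_eq_mul_of_mem_cell hg hn
    obtain ⟨q, hq, c, hc, e⟩ := ih (by omega) (mul_mem_cell hb (hm1.mem_cell .pos)) hm1
    obtain ⟨x, hx, c', rfl, hc'⟩ := hD.exists_borel_factorization s hc hm
    have h1 : 1 ∈ (w • cs.simpleRoot s).half :=
      (cs.one_mem_smul_simpleRoot_iff w s).2 (by omega)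
    refine ⟨q * (n * m⁻¹ * x * (n * m⁻¹)⁻¹), mul_mem (segment_le_segment_mul_simple h1 hq)
      (U_le_segment h1 (mul_simple_notMem_smul_simpleRoot w s) (hD.conj_mem hm1 hx)),
      m⁻¹ * c' * m * b', mul_mem hc' hb', ?_⟩
    have e2 : b * n * b' = b * (n * m⁻¹) * m * b' := by group
    rw [e2, e]
    group

/-- The group `U_w` generated by the root groups of the positive roots not containing `w` acts
freely on the cell `B_+ w B_+ / B_+`. -/
theorem IsTRD.eq_one_of_mem_segment {w : W} : ∀ {q n : G}, q ∈ D.segment 1 w → D.Lifts n w →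
    n⁻¹ * q * n ∈ D.borel .pos → q = 1 := by
  induction hk : cs.length w generalizing w with
  | zero =>
    rw [cs.length_eq_zero_iff] at hk
    subst hk
    intro q n hq _ _
    rwa [segment_self, Subgroup.mem_bot] at hq
  | succ k ih =>
    intro q n hq hn hc
    obtain ⟨s, hs⟩ := cs.exists_rightDescent_of_ne_one (w := w) (by rintro rfl; simp at hk)
    rw [cs.isRightDescent_iff] at hs
    obtain ⟨w, rfl⟩ : ∃ w1, w = w1 * cs.simple s := ⟨w * cs.simple s, by simp⟩
    rw [cs.simple_mul_simple_cancel_right] at hs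
    obtain ⟨m, hm⟩ := hD.exists_lifts (cs.simple s)
    have hms : D.Lifts m⁻¹ (cs.simple s) := by simpa using hm.inv
    have hm1 := hn.mul hms
    rw [cs.simple_mul_simple_cancel_right] at hm1
    have h1 : 1 ∈ (w • cs.simpleRoot s).half :=
      (cs.one_mem_smul_simpleRoot_iff w s).2 (by omega)
    have hqB := segment_one_le _ hq
    obtain ⟨p, hp, x, hx, rfl⟩ := hD.exists_segment_factorization h1 hq
    set c := n⁻¹ * (p * x) * n with hcdef
    obtain ⟨z, hz, c', hzc, hc'⟩ := hD.exists_borel_factorization s hc hms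
    have hy := hD.conj_mem hm hz
    rw [simple_smul_simpleRoot] at hy
    have e : p * x * (n * m⁻¹) = n * m⁻¹ * (m * z * m⁻¹) * (m⁻¹⁻¹ * c' * m⁻¹) := by
      have : p * x = n * c * n⁻¹ := by rw [hcdef]; group
      rw [this, hzc]
      group
    have hy1 : m * z * m⁻¹ = 1 := by
      by_contra hne
      obtain ⟨x1, hx1, x2, hx2, n2, -, -, hn2, e2⟩ := hD.exists_eq_mul_lift_mul hy hne
      have hB := U_le_borel (D := D) (cs.one_mem_simpleRoot s)
      have h2 : p * x * (n * m⁻¹) ∈ D.cell .pos w := mul_mem_cell hqB (hm1.mem_cell _)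
      have h3 : p * x * (n * m⁻¹) ∈ D.cell .pos (w * cs.simple s) := by
        rw [e, e2]
        refine cell_mul_mem ?_ hc'
        have := cell_mul_mem (hD.cell_mul_lift_of_lt (cell_mul_mem (hm1.mem_cell .pos) (hB hx1))
          hn2 (by omega)) (hB hx2)
        convert this using 1
        group
      have := congrArg cs.length (hD.cell_unique h2 h3)
      omega
    have hxm : (n * m⁻¹)⁻¹ * x * (n * m⁻¹) ∈ D.U (cs.simpleRoot s) := hD.inv_conj_mem hm1 hx
    have hp1 : p = 1 := by
      refine ih (by omega) hp hm1 ?_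
      rw [hy1, mul_one] at e
      have e2 : (n * m⁻¹)⁻¹ * p * (n * m⁻¹) =
          (m⁻¹⁻¹ * c' * m⁻¹) * ((n * m⁻¹)⁻¹ * x * (n * m⁻¹))⁻¹ := by
        have : p = n * m⁻¹ * (m⁻¹⁻¹ * c' * m⁻¹) * (n * m⁻¹)⁻¹ * x⁻¹ := by rw [← e]; group
        rw [this]; group
      rw [e2]
      exact mul_mem hc' (inv_mem (U_le_borel (cs.one_mem_simpleRoot s) hxm))
    rw [hp1, one_mul] at hcdef ⊢
    have h4 := hD.conj_mem hms hxm
    rw [simple_smul_simpleRoot] at h4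
    have h5 : m⁻¹ * ((n * m⁻¹)⁻¹ * x * (n * m⁻¹)) * m⁻¹⁻¹ = c := by rw [hcdef]; group
    rw [h5] at h4
    have h6 := hD.eq_one_of_mem_neg_of_mem_borel h4 hc
    have : x = n * c * n⁻¹ := by rw [hcdef]; group
    rw [this, h6]
    group

/-- If no root separates `x` from both `a` and `w`, the group of the roots separating `a` and
`w` is the product of those for `a`, `x` and for `x`, `w`. -/
theorem IsTRD.exists_segment_mul_segment {a x w : W}
    (h : ∀ β : cs.Root, x ∈ β.half → w ∉ β.half → a ∈ β.half) :
    ∀ {q : G}, q ∈ D.segment a w → ∃ p ∈ D.segment a x, ∃ r ∈ D.segment x w, q = p * r := by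
  induction hk : cs.length (x⁻¹ * w) generalizing w with
  | zero =>
    rw [cs.length_eq_zero_iff, inv_mul_eq_one] at hk
    subst hk
    intro q hq
    exact ⟨q, hq, 1, one_mem _, by simp⟩
  | succ k ih =>
    intro q hq
    obtain ⟨s, hs⟩ := cs.exists_rightDescent_of_ne_one (w := x⁻¹ * w) (by
      intro h; rw [h] at hk; simp at hk)
    rw [cs.isRightDescent_iff] at hs
    obtain ⟨w, rfl⟩ : ∃ w1, w = w1 * cs.simple s := ⟨w * cs.simple s, by simp⟩
    rw [← mul_assoc, cs.simple_mul_simple_cancel_right, mul_assoc] at hs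
    have hx : x ∈ (w • cs.simpleRoot s).half := by
      rw [mem_half_smul, half_simpleRoot, mem_simpleHalf_iff_length, mul_inv_rev, inv_inv,
        mul_assoc]
      omega
    have ha := h _ hx (mul_simple_notMem_smul_simpleRoot w s)
    obtain ⟨p, hp, z, hz, rfl⟩ := hD.exists_segment_factorization ha hq
    obtain ⟨p', hp', r, hr, rfl⟩ := ih
      (fun β h1 h2 => h β h1 (notMem_mul_simple hx h1 h2)) (by omega) hp
    exact ⟨p', hp', r * z, mul_mem (segment_le_segment_mul_simple hx hr)
      (U_le_segment hx (mul_simple_notMem_smul_simpleRoot w s) hz), by group⟩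

end Segment
end RootGroupData

/-! ### A covering of the building -/

namespace CoxeterSystem

section

variable {S : Type*} {W : Type*} [Group W] {M : CoxeterMatrix S} {cs : CoxeterSystem M W}
  {J : Set S}

/-- If `z` is shortest in `z W_J`, the roots separating `z` from other elements of `z W_J` do not
separate it from `1`. -/
theorem IsMinimalIn.one_mem_of_mem {z x : W} (hz : cs.IsMinimalIn J z)
    (hx : z⁻¹ * x ∈ cs.specialSubgroup J) {α : cs.Root} (hzα : z ∈ α.half) (hxα : x ∉ α.half) :
    1 ∈ α.half := by
  obtain ⟨y, hy, j, hj, rfl⟩ := exists_eq_smul_simpleRoot_of_crosses hx hzα hxα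
  set y' := z⁻¹ * y with hy'
  have hyz : y = z * y' := by rw [hy', mul_inv_cancel_left]
  have h2 : 0 ≤ cs.geometricRep y' (Finsupp.single j 1) := by
    rw [geometricRep_nonneg_iff, ← one_mem_smul_simpleRoot_iff, mem_half_smul, mul_one]
    rwa [mem_half_smul, hyz, mul_inv_rev, inv_mul_cancel_right] at hzα
  rw [geometricRep_single_mem_span hy ⟨j, hj⟩, spanEmbedding_nonneg_iff] at h2
  have h3 := hz.geometricRep_nonneg h2
  rw [← geometricRep_single_mem_span hy ⟨j, hj⟩, ← geometricRep_mul_apply, ← hyz,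
    geometricRep_nonneg_iff] at h3
  rwa [one_mem_smul_simpleRoot_iff]

theorem IsMaximalIn.mem_of_mem {v x : W} (hv : cs.IsMaximalIn J v)
    (hx : v⁻¹ * x ∈ cs.specialSubgroup J) {α : cs.Root} (h1 : 1 ∉ α.half) (hxα : x ∈ α.half) :
    v ∈ α.half := by
  by_contra h
  exact hv.notMem_of_notMem hx (α := -α) h1 (fun h' => h' hxα) h

theorem specialSubgroup_mono {I : Set S} (h : I ⊆ J) :
    cs.specialSubgroup I ≤ cs.specialSubgroup J :=
  Subgroup.closure_mono (Set.image_mono h)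

theorem exists_isMaximalIn_singleton (w : W) (s : S) :
    ∃ v, w⁻¹ * v ∈ cs.specialSubgroup {s} ∧ cs.IsMaximalIn {s} v := by
  by_cases h : cs.length w < cs.length (w * cs.simple s)
  · refine ⟨w * cs.simple s, by simpa using simple_mem_special (Set.mem_singleton s), ?_⟩
    intro j hj
    rwa [Set.mem_singleton_iff.1 hj, cs.simple_mul_simple_cancel_right]
  · refine ⟨w, by simp [one_mem], ?_⟩
    intro j hj
    rw [Set.mem_singleton_iff.1 hj]
    have := cs.length_mul_simple_ne w s
    omega

end

end CoxeterSystem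

namespace RootGroupData

section Covering

variable {S : Type*} {W : Type*} [Group W] {M : CoxeterMatrix S} {cs : CoxeterSystem M W}
  {G : Type*} [Group G] {D : RootGroupData cs G} {J : Set S}

open CoxeterSystem

variable (D)

/-- The pair `(w, u)`, standing for the coset `u U_w` of the group `U_w = D.segment w 1`
generated by the root groups of the negative roots containing `w`, is a chamber of the covering
that lies over the chamber `g B_+`. -/
def IsOver (g : G) (w : W) (u : G) : Prop :=
  u ∈ D.unipotent .neg ∧ ∃ n, D.Lifts n w ∧ ∃ b ∈ D.borel .pos, g = u * n * b

/-- The pairs `(w, u)` and `(w', u')` represent the same chamber of the covering. -/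
def SameLift (w : W) (u : G) (w' : W) (u' : G) : Prop :=
  w = w' ∧ u⁻¹ * u' ∈ D.segment w 1

/-- The chambers represented by `(w, u)` and `(w', u')` are in the same residue of type `J` of the
covering. -/
def SameResidue (J : Set S) (w : W) (u : G) (w' : W) (u' : G) : Prop :=
  w⁻¹ * w' ∈ cs.specialSubgroup J ∧ ∃ v, w⁻¹ * v ∈ cs.specialSubgroup J ∧ cs.IsMaximalIn J v ∧
    u⁻¹ * u' ∈ D.segment v 1

variable {D}

theorem segment_le_of_isMaximalIn {v w : W} (hv : cs.IsMaximalIn J v)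
    (hw : v⁻¹ * w ∈ cs.specialSubgroup J) : D.segment w 1 ≤ D.segment v 1 :=
  iSup₂_le fun _ h => U_le_segment (hv.mem_of_mem hw h.2 h.1) h.2

theorem segment_le_unipotent_neg (w : W) : D.segment w 1 ≤ D.unipotent .neg :=
  iSup₂_le fun _ h => U_le_unipotent_neg h.2

theorem SameLift.symm {w w' : W} {u u' : G} (h : D.SameLift w u w' u') :
    D.SameLift w' u' w u := by
  obtain ⟨rfl, h⟩ := h
  exact ⟨rfl, by simpa using inv_mem h⟩

theorem SameLift.trans {w w' w'' : W} {u u' u'' : G} (h : D.SameLift w u w' u')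
    (h' : D.SameLift w' u' w'' u'') : D.SameLift w u w'' u'' := by
  obtain ⟨rfl, h⟩ := h
  obtain ⟨rfl, h'⟩ := h'
  exact ⟨rfl, by simpa [mul_assoc] using mul_mem h h'⟩

theorem SameLift.mul_left {w w' : W} {u u' : G} (h : D.SameLift w u w' u') (x : G) :
    D.SameLift w (x * u) w' (x * u') := ⟨h.1, by simpa [mul_assoc] using h.2⟩

theorem SameResidue.mul_left {w w' : W} {u u' : G} (h : D.SameResidue J w u w' u') (x : G) :
    D.SameResidue J w (x * u) w' (x * u') := by
  obtain ⟨h1, v, h2, h3, h4⟩ := h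
  exact ⟨h1, v, h2, h3, by simpa [mul_assoc] using h4⟩

theorem SameResidue.symm {w w' : W} {u u' : G} (h : D.SameResidue J w u w' u') :
    D.SameResidue J w' u' w u := by
  obtain ⟨h1, v, h2, h3, h4⟩ := h
  refine ⟨by simpa using inv_mem h1, v, ?_, h3, by simpa using inv_mem h4⟩
  simpa [mul_assoc] using mul_mem (inv_mem h1) h2

theorem SameResidue.trans {w w' w'' : W} {u u' u'' : G} (h : D.SameResidue J w u w' u')
    (h' : D.SameResidue J w' u' w'' u'') : D.SameResidue J w u w'' u'' := by
  obtain ⟨h1, v, h2, h3, h4⟩ := h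
  obtain ⟨h1', v', h2', h3', h4'⟩ := h'
  refine ⟨by simpa [mul_assoc] using mul_mem h1 h1', v, h2, h3, ?_⟩
  have h5 : v⁻¹ * v' ∈ cs.specialSubgroup J := by
    have := mul_mem (inv_mem h2) (mul_mem h1 h2')
    simpa [mul_assoc] using this
  simpa [mul_assoc] using mul_mem h4 (segment_le_of_isMaximalIn h3 h5 h4')

theorem SameLift.sameResidue {w w' v : W} {u u' : G} (h : D.SameLift w u w' u')
    (hv : cs.IsMaximalIn J v) (hwv : w⁻¹ * v ∈ cs.specialSubgroup J) :
    D.SameResidue J w u w' u' := by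
  obtain ⟨rfl, h⟩ := h
  exact ⟨by simp [one_mem], v, hwv, hv,
    segment_le_of_isMaximalIn hv (by simpa using inv_mem hwv) h⟩

theorem SameLift.sameResidue_singleton {w w' : W} {u u' : G} (h : D.SameLift w u w' u') (s : S) :
    D.SameResidue {s} w u w' u' := by
  obtain ⟨v, hv, hvm⟩ := exists_isMaximalIn_singleton (cs := cs) w s
  exact h.sameResidue hvm hv

theorem SameResidue.mono {I : Set S} {w w' v : W} {u u' : G} (h : D.SameResidue I w u w' u')
    (hI : I ⊆ J) (hv : cs.IsMaximalIn J v) (hwv : w⁻¹ * v ∈ cs.specialSubgroup J) :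
    D.SameResidue J w u w' u' := by
  obtain ⟨h1, v', h2, h3, h4⟩ := h
  refine ⟨specialSubgroup_mono hI h1, v, hwv, hv, segment_le_of_isMaximalIn hv ?_ h4⟩
  have := mul_mem (inv_mem hwv) (specialSubgroup_mono hI h2)
  simpa [mul_assoc] using this

theorem IsOver.mul_borel {g : G} {w : W} {u b : G} (h : D.IsOver g w u) (hb : b ∈ D.borel .pos) :
    D.IsOver (g * b) w u := by
  obtain ⟨hu, n, hn, c, hc, rfl⟩ := h
  exact ⟨hu, n, hn, c * b, mul_mem hc hb, by group⟩

theorem IsOver.mul_left {g : G} {w : W} {u x : G} (h : D.IsOver g w u)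
    (hx : x ∈ D.unipotent .neg) : D.IsOver (x * g) w (x * u) := by
  obtain ⟨hu, n, hn, c, hc, rfl⟩ := h
  exact ⟨mul_mem hx hu, n, hn, c, hc, by group⟩

variable (hD : D.IsTRD)
include hD

/-- Residues with a longest element lift isomorphically to the covering. -/
theorem IsTRD.sameLift_of_sameResidue {g : G} {w w' : W} {u u' : G}
    (h : D.SameResidue J w u w' u') (hg : D.IsOver g w u) (hg' : D.IsOver g w' u') :
    D.SameLift w u w' u' := by
  obtain ⟨h1, v, h2, h3, h4⟩ := h
  obtain ⟨-, n1, hn1, b1, hb1, e1⟩ := hg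
  obtain ⟨-, n2, hn2, b2, hb2, e2⟩ := hg'
  obtain ⟨n, hn⟩ := hD.exists_lifts v
  have hq := hD.inv_conj_mem_segment hn _ h4
  rw [inv_mul_cancel, mul_one] at hq
  have hm1 := hn.inv.mul hn1
  have hm2 := hn.inv.mul hn2
  have e : n⁻¹ * n1 * b1 = n⁻¹ * (u⁻¹ * u') * n * (n⁻¹ * n2) * b2 := by
    have : n1 * b1 = u⁻¹ * (u' * n2 * b2) := by rw [← e2, e1]; group
    rw [mul_assoc, this]
    group
  have hx : v⁻¹ * w = v⁻¹ * w' := by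
    refine hD.cell_unique (cell_mul_mem (hm1.mem_cell .pos) hb1) ?_
    rw [e]
    exact cell_mul_mem (mul_mem_cell (segment_one_le _ hq) (hm2.mem_cell .pos)) hb2
  have hw : w = w' := mul_left_cancel hx
  subst hw
  refine ⟨rfl, ?_⟩
  have hvw : v⁻¹ * w ∈ cs.specialSubgroup J := by simpa using inv_mem h2
  obtain ⟨p, hp, r, hr, hpr⟩ := hD.exists_segment_mul_segment (x := v⁻¹ * w) (fun β hx1 hx2 => by
    have := h3.mem_of_mem hvw (α := v • β) (by rwa [mem_half_smul, mul_one])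
      (by rwa [mem_half_smul])
    rwa [mem_half_smul, inv_mul_cancel] at this) hq
  have hr' := hD.inv_conj_mem_segment hm1 r hr
  rw [inv_mul_cancel] at hr'
  have hp1 : p = 1 := by
    refine hD.eq_one_of_mem_segment hp hm1 ?_
    have e3 : (n⁻¹ * n1)⁻¹ * p * (n⁻¹ * n1) =
        b1 * b2⁻¹ * ((n⁻¹ * n1)⁻¹ * (n⁻¹ * n2))⁻¹ *
          ((n⁻¹ * n1)⁻¹ * r * (n⁻¹ * n1))⁻¹ := by
      have : p = n⁻¹ * n1 * b1 * b2⁻¹ * (n⁻¹ * n2)⁻¹ * r⁻¹ := by rw [e, hpr]; group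
      rw [this]
      group
    rw [e3]
    exact mul_mem (mul_mem (mul_mem hb1 (inv_mem hb2))
      (inv_mem (H_le_borel _ (hD.lifts_inv_mul_mem hm1 hm2))))
      (inv_mem (segment_one_le _ hr'))
  have h5 := hD.conj_mem_segment hn r hr
  rw [mul_inv_cancel_left, mul_inv_cancel] at h5
  convert h5 using 1
  rw [hp1, one_mul] at hpr
  rw [← hpr]
  group

theorem IsTRD.exists_isOver {g p : G} {w v : W} {u : G} (hg : D.IsOver g w u)
    (hp : p ∈ D.parabolic .pos J) (hv : cs.IsMaximalIn J v)
    (hwv : w⁻¹ * v ∈ cs.specialSubgroup J) :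
    ∃ w' u', D.IsOver (g * p) w' u' ∧ D.SameResidue J w u w' u' := by
  obtain ⟨hu, n1, hn1, b, hb, rfl⟩ := hg
  obtain ⟨n, hn⟩ := hD.exists_lifts v
  have hvw : v⁻¹ * w ∈ cs.specialSubgroup J := by simpa using inv_mem hwv
  have h1 : n⁻¹ * n1 * b * p ∈ D.parabolic .pos J :=
    hD.parabolic_mul_mem (hD.parabolic_mul_mem ((hn.inv.mul hn1).mem_parabolic hvw)
      (borel_subset_parabolic hb)) hp
  obtain ⟨x, hx, h2⟩ := mem_parabolic_iff.1 h1
  obtain ⟨m, hm⟩ := hD.exists_lifts x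
  obtain ⟨q, hq, b', hb', e⟩ := hD.exists_eq_segment_mul h2 hm
  have h3 := hD.conj_mem_segment hn q hq
  rw [mul_one] at h3
  have h4 : n * q * n⁻¹ ∈ D.segment v 1 := by
    refine (iSup₂_le fun β hβ => U_le_segment hβ.1 fun h1' => ?_ : D.segment v (v * x) ≤ _) h3
    exact hv.notMem_of_notMem (by simpa using hx) h1' hβ.2 hβ.1
  refine ⟨v * x, u * (n * q * n⁻¹), ⟨mul_mem hu (segment_le_unipotent_neg _ h4), n * m,
    hn.mul hm, b', hb', ?_⟩, ?_, v, hwv, hv, by simpa using h4⟩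
  · have : u * n1 * b * p = u * n * (n⁻¹ * n1 * b * p) := by group
    rw [this, e]
    group
  · rw [← mul_assoc]
    exact mul_mem hwv hx

omit hD in
variable (D) in
/-- `D.Reach v g w u`: the chamber `(w, u)` of the covering is the end of a lift, starting at
`(1, 1)`, of a minimal gallery from `B_+` to `g B_+` in the building, where
`g ∈ B_+ v B_+`. -/
inductive Reach : W → G → W → G → Prop
  | base {g : G} (hg : g ∈ D.borel .pos) : Reach 1 g 1 1
  | step {v : W} {g : G} {w : W} {u : G} {v' : W} {g' : G} {w' : W} {u' : G}
      (h : Reach v g w u) (s : S) (hv : v' = v * cs.simple s) (hl : cs.length v < cs.length v')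
      (hp : g⁻¹ * g' ∈ D.parabolic .pos {s}) (hg' : g' ∈ D.cell .pos v')
      (ho : D.IsOver g' w' u') (hr : D.SameResidue {s} w u w' u') : Reach v' g' w' u'

omit hD in
theorem Reach.isOver {v : W} {g : G} {w : W} {u : G} (h : D.Reach v g w u) :
    D.IsOver g w u := by
  cases h with
  | base hg => exact ⟨one_mem _, 1, lifts_one, g, hg, by simp⟩
  | step h s hv hl hp hg' ho hr => exact ho

theorem IsTRD.reach_mem_cell {v : W} {g : G} {w : W} {u : G} (h : D.Reach v g w u) :
    g ∈ D.cell .pos v := by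
  cases h with
  | base hg => exact hD.mem_cell_one_iff.2 hg
  | step h s hv hl hp hg' ho hr => exact hg'

theorem IsTRD.reach_mul_borel {v : W} {g : G} {w : W} {u : G} (h : D.Reach v g w u) {b : G}
    (hb : b ∈ D.borel .pos) : D.Reach v (g * b) w u := by
  cases h with
  | base hg => exact .base (mul_mem hg hb)
  | step h s hv hl hp hg' ho hr =>
    refine .step h s hv hl ?_ (cell_mul_mem hg' hb) (ho.mul_borel hb) hr
    rw [← mul_assoc]
    exact hD.parabolic_mul_mem hp (borel_subset_parabolic hb)

/-- Galleries descend: each chamber at a position with right descent `s` is adjacent to one at the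
shorter position. -/
theorem IsTRD.exists_descending {v : W} {s : S} {g : G} (hg : g ∈ D.cell .pos v) :
    ∃ g', g' ∈ D.cell .pos (v * cs.simple s) ∧ g'⁻¹ * g ∈ D.parabolic .pos {s} := by
  obtain ⟨b, hb, n, hn, b', hb', rfl⟩ := hg
  obtain ⟨m, hm⟩ := hD.exists_lifts (cs.simple s)
  refine ⟨b * (n * m), mul_mem_cell hb ((hn.mul hm).mem_cell _), ?_⟩
  have e : (b * (n * m))⁻¹ * (b * n * b') = m⁻¹ * b' := by group
  rw [e]
  exact hD.parabolic_mul_mem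
    (inv_mem_parabolic (hm.mem_parabolic (simple_mem_special (Set.mem_singleton s))))
    (borel_subset_parabolic hb')

theorem IsTRD.exists_step {v w : W} {s : S} {g g' u : G} (h : D.Reach v g w u)
    (hl : cs.length v < cs.length (v * cs.simple s)) (hp : g⁻¹ * g' ∈ D.parabolic .pos {s})
    (hg' : g' ∈ D.cell .pos (v * cs.simple s)) :
    ∃ w' u', D.Reach (v * cs.simple s) g' w' u' ∧ D.SameResidue {s} w u w' u' := by
  obtain ⟨x, hx, hxm⟩ := exists_isMaximalIn_singleton (cs := cs) w s
  obtain ⟨w', u', h1, h2⟩ := hD.exists_isOver h.isOver hp hxm hx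
  rw [mul_inv_cancel_left] at h1
  exact ⟨w', u', .step h s rfl hl hp hg' h1 h2, h2⟩

theorem IsTRD.exists_reach {v : W} : ∀ {g : G}, g ∈ D.cell .pos v → ∃ w u, D.Reach v g w u := by
  induction hk : cs.length v generalizing v with
  | zero =>
    rw [cs.length_eq_zero_iff] at hk
    subst hk
    intro g hg
    exact ⟨1, 1, .base (hD.mem_cell_one_iff.1 hg)⟩
  | succ k ih =>
    intro g hg
    obtain ⟨s, hs⟩ := cs.exists_rightDescent_of_ne_one (w := v) (by rintro rfl; simp at hk)
    rw [cs.isRightDescent_iff] at hs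
    obtain ⟨g', hg', hp⟩ := hD.exists_descending (s := s) hg
    obtain ⟨w, u, h⟩ := ih (by omega) hg'
    obtain ⟨w', u', h', -⟩ := hD.exists_step h (s := s) (g' := g)
      (by rw [cs.simple_mul_simple_cancel_right]; omega) hp
      (by rwa [cs.simple_mul_simple_cancel_right])
    rw [cs.simple_mul_simple_cancel_right] at h'
    exact ⟨w', u', h'⟩

/-- If `z` is shortest in `z W_J`, then `B_+ z B_+ x B_+ = B_+ zx B_+` for `x ∈ W_J`. -/
theorem IsTRD.mul_mem_cell_of_isMinimalIn {z x : W} (hz : cs.IsMinimalIn J z)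
    (hx : x ∈ cs.specialSubgroup J) {g p : G} (hg : g ∈ D.cell .pos z) (hp : p ∈ D.cell .pos x) :
    g * p ∈ D.cell .pos (z * x) := by
  obtain ⟨c, hc, n, hn, c', hc', rfl⟩ := hg
  obtain ⟨m, hm⟩ := hD.exists_lifts x
  obtain ⟨q, hq, b, hb, e⟩ := hD.exists_eq_segment_mul (mul_mem_cell hc' hp) hm
  have h1 := hD.conj_mem_segment hn q hq
  rw [mul_one] at h1
  have h2 : n * q * n⁻¹ ∈ D.borel .pos := by
    refine (iSup₂_le fun β hβ => U_le_borel ?_ : D.segment z (z * x) ≤ _) h1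
    exact hz.one_mem_of_mem (by simpa using hx) hβ.1 hβ.2
  refine ⟨c * (n * q * n⁻¹), mul_mem hc h2, n * m, hn.mul hm, b, hb, ?_⟩
  have : c * n * c' * p = c * n * (c' * p) := by group
  rw [this, e]
  group

theorem IsTRD.mem_borel_of_mem_cell_of_isMinimalIn {z : W} (hz : cs.IsMinimalIn J z) {g g' : G}
    (hg : g ∈ D.cell .pos z) (hg' : g' ∈ D.cell .pos z) (hp : g⁻¹ * g' ∈ D.parabolic .pos J) :
    g⁻¹ * g' ∈ D.borel .pos := by
  obtain ⟨x, hx, h⟩ := mem_parabolic_iff.1 hp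
  have h1 := hD.mul_mem_cell_of_isMinimalIn hz hx hg h
  rw [mul_inv_cancel_left] at h1
  have h2 := hD.cell_unique h1 hg'
  rw [mul_eq_left] at h2
  rwa [h2, hD.mem_cell_one_iff] at h

/-- The building is simply connected with respect to its residues of rank two: the lift of a
minimal gallery depends only on its end. -/
theorem IsTRD.reach_unique {v : W} : ∀ {g : G} {w w' : W} {u u' : G}, D.Reach v g w u →
    D.Reach v g w' u' → D.SameLift w u w' u' := by
  induction hk : cs.length v using Nat.strong_induction_on generalizing v with
  | _ k ih =>
  subst hk
  intro g w w' u u' h h'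
  cases h with
  | base hg =>
    generalize hv : (1 : W) = v at h'
    cases h' with
    | base _ => exact ⟨rfl, by simp [one_mem]⟩
    | step _ s _ hl _ _ _ _ => rw [← hv, cs.length_one] at hl; omega
  | @step v1 g1 w1 u1 _ _ _ _ h1 s hv1 hl1 hp1 hg ho hr1 =>
    generalize hv : v = v0 at h'
    cases h' with
    | base _ => rw [hv, cs.length_one] at hl1; omega
    | @step v2 g2 w2 u2 _ _ _ _ h2 t hv2 hl2 hp2 hg' ho' hr2 =>
      subst hv
      set J : Set S := {s, t} with hJ
      have hmax : cs.IsMaximalIn J v := by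
        rintro j (rfl | rfl)
        · rwa [hv1, cs.simple_mul_simple_cancel_right, ← hv1]
        · rwa [hv2, cs.simple_mul_simple_cancel_right, ← hv2]
      obtain ⟨z, hz, hzm⟩ := exists_isMinimalIn (cs := cs) J v
      have hmax' := fun w => hmax.exists_in_coset w
      obtain ⟨b, hb, n, hn, b', hb', e⟩ := hg
      obtain ⟨m, hm⟩ := hD.exists_lifts z
      have hg0 : b * m ∈ D.cell .pos z := mul_mem_cell hb (hm.mem_cell _)
      have hg0p : (b * m)⁻¹ * g ∈ D.parabolic .pos J := by
        have e2 : (b * m)⁻¹ * g = m⁻¹ * n * b' := by rw [e]; group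
        rw [e2]
        exact hD.parabolic_mul_mem ((hm.inv.mul hn).mem_parabolic hz) (borel_subset_parabolic hb')
      obtain ⟨w0, u0, h0⟩ := hD.exists_reach hg0
      have hsub : ∀ j ∈ J, ∀ p ∈ D.parabolic .pos {j}, p ∈ D.parabolic .pos J := by
        intro j hj p hp
        obtain ⟨x, hx, h⟩ := mem_parabolic_iff.1 hp
        exact mem_parabolic_iff.2 ⟨x, specialSubgroup_mono (by simpa using hj) hx, h⟩
      -- lifts to the residue of shorter positions agree with the lift of its shortest chamber
      have claim : ∀ k y, y ∈ cs.specialSubgroup J → cs.length (z * y) = k →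
          cs.length (z * y) < cs.length v → ∀ {g' : G} {w' : W} {u' : G},
          (b * m)⁻¹ * g' ∈ D.parabolic .pos J → D.Reach (z * y) g' w' u' →
          D.SameResidue J w0 u0 w' u' := by
        intro k
        induction k using Nat.strong_induction_on with
        | _ k ihk =>
        intro y hy hky hlt g' w' u' hp' hR
        obtain ⟨x, hx, hxm⟩ := hmax' w0
        by_cases hy1 : y = 1
        · subst hy1
          rw [mul_one] at hR hlt
          have h3 := hD.mem_borel_of_mem_cell_of_isMinimalIn hzm hg0 (hD.reach_mem_cell hR) hp'
          have h4 := hD.reach_mul_borel h0 h3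
          rw [mul_inv_cancel_left] at h4
          exact (ih _ hlt rfl h4 hR).sameResidue hxm hx
        · obtain ⟨j, hj, hlj⟩ := hzm.exists_descent hy hy1
          obtain ⟨g'', hg'', hpj⟩ := hD.exists_descending (s := j) (hD.reach_mem_cell hR)
          obtain ⟨w'', u'', hR''⟩ := hD.exists_reach hg''
          rw [mul_assoc z y] at hR''
          have hp'' : (b * m)⁻¹ * g'' ∈ D.parabolic .pos J := by
            have := hD.parabolic_mul_mem hp' (inv_mem_parabolic (hsub j hj _ hpj))
            convert this using 1
            group
          have h3 := ihk _ (by rw [← hky, ← mul_assoc]; exact hlj) (y * cs.simple j)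
            (mul_mem hy (simple_mem_special hj)) rfl (by rw [← mul_assoc]; omega) hp'' hR''
          rw [← mul_assoc] at hR''
          obtain ⟨w3, u3, hR3, h5⟩ := hD.exists_step hR'' (s := j) (g' := g')
            (by rwa [cs.simple_mul_simple_cancel_right]) hpj
            (by rw [cs.simple_mul_simple_cancel_right]; exact hD.reach_mem_cell hR)
          rw [cs.simple_mul_simple_cancel_right] at hR3
          obtain ⟨x', hx', hxm'⟩ := hmax' w''
          obtain ⟨x3, hx3, hxm3⟩ := hmax' w3
          exact (h3.trans (h5.mono (by simpa using hj) hxm' hx')).trans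
            ((ih _ hlt rfl hR3 hR).sameResidue hxm3 hx3)
      have main : ∀ v1 g1 w1 u1 j, j ∈ J → D.Reach v1 g1 w1 u1 → v = v1 * cs.simple j →
          cs.length v1 < cs.length v → g1⁻¹ * g ∈ D.parabolic .pos {j} →
          D.SameResidue J w0 u0 w1 u1 := by
        intro v1 g1 w1 u1 j hj hR hv1 hl1 hp1
        have hy : z⁻¹ * v1 ∈ cs.specialSubgroup J := by
          have : z⁻¹ * v1 = z⁻¹ * v * cs.simple j := by rw [hv1]; simp [mul_assoc]
          rw [this]
          exact mul_mem hz (simple_mem_special hj)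
        refine claim _ (z⁻¹ * v1) hy rfl (by rwa [mul_inv_cancel_left]) ?_
          (by rwa [mul_inv_cancel_left])
        convert hD.parabolic_mul_mem hg0p (inv_mem_parabolic (hsub j hj _ hp1)) using 1
        group
      have m1 := main _ _ _ _ s (by simp [hJ]) h1 hv1 hl1 hp1
      have m2 := main _ _ _ _ t (by simp [hJ]) h2 hv2 hl2 hp2
      obtain ⟨x1, hx1, hxm1⟩ := hmax' w1
      obtain ⟨x2, hx2, hxm2⟩ := hmax' w2
      refine hD.sameLift_of_sameResidue (J := J) ?_ ho ho'
      exact ((m1.trans (hr1.mono (by simp [hJ]) hxm1 hx1)).symm).trans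
        (m2.trans (hr2.mono (by simp [hJ]) hxm2 hx2))

end Covering
end RootGroupData

/-! ### The Birkhoff decomposition -/

namespace CoxeterSystem

variable {S : Type*} {W : Type*} [Group W] {M : CoxeterMatrix S} {cs : CoxeterSystem M W}

theorem Root.exists_mem (β : cs.Root) : ∃ w, w ∈ β.half := by
  obtain ⟨w, s, rfl⟩ := cs.exists_eq_smul_simpleRoot β
  exact ⟨w, RootGroupData.mem_smul_simpleRoot_self w s⟩

end CoxeterSystem

namespace RootGroupData

section Birkhoff

variable {S : Type*} {W : Type*} [Group W] {M : CoxeterMatrix S} {cs : CoxeterSystem M W}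
  {G : Type*} [Group G] {D : RootGroupData cs G} {J : Set S}

open CoxeterSystem

theorem sameResidue_one_one {w w' : W} {s : S} (h : w⁻¹ * w' ∈ cs.specialSubgroup {s}) :
    D.SameResidue {s} w 1 w' 1 := by
  obtain ⟨v, hv, hvm⟩ := exists_isMaximalIn_singleton (cs := cs) w s
  exact ⟨h, v, hv, hvm, by simp [one_mem]⟩

variable (D) in
/-- `(w, u)` represents the chamber of the covering that the section of the covering, given by
lifting minimal galleries, assigns to `g B_+`. -/
def IsSection (g : G) (w : W) (u : G) : Prop := ∃ v, D.Reach v g w u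

theorem IsSection.isOver {g : G} {w : W} {u : G} (h : D.IsSection g w u) : D.IsOver g w u :=
  h.elim fun _ h => h.isOver

variable (hD : D.IsTRD)
include hD

theorem IsTRD.isSection_mul_borel {g : G} {w : W} {u : G} (h : D.IsSection g w u) {b : G}
    (hb : b ∈ D.borel .pos) : D.IsSection (g * b) w u :=
  h.elim fun v h => ⟨v, hD.reach_mul_borel h hb⟩

theorem IsTRD.exists_isSection (g : G) : ∃ w u, D.IsSection g w u := by
  obtain ⟨v, hv⟩ := hD.exists_mem_cell .pos g
  obtain ⟨w, u, h⟩ := hD.exists_reach hv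
  exact ⟨w, u, v, h⟩

theorem IsTRD.isSection_unique {g : G} {w w' : W} {u u' : G} (h : D.IsSection g w u)
    (h' : D.IsSection g w' u') : D.SameLift w u w' u' := by
  obtain ⟨v, h⟩ := h
  obtain ⟨v', h'⟩ := h'
  obtain rfl := hD.cell_unique (hD.reach_mem_cell h) (hD.reach_mem_cell h')
  exact hD.reach_unique h h'

/-- The section of the covering preserves adjacency. -/
theorem IsTRD.isSection_sameResidue {g g' : G} {w w' : W} {u u' : G} {s : S}
    (h : D.IsSection g w u) (h' : D.IsSection g' w' u') (hp : g⁻¹ * g' ∈ D.parabolic .pos {s}) :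
    D.SameResidue {s} w u w' u' := by
  have up : ∀ {v : W} {g g' : G} {w w' : W} {u u' : G}, D.Reach v g w u →
      D.Reach (v * cs.simple s) g' w' u' → cs.length v < cs.length (v * cs.simple s) →
      g⁻¹ * g' ∈ D.parabolic .pos {s} → D.SameResidue {s} w u w' u' := by
    intro v g g' w w' u u' h h' hl hp
    obtain ⟨w2, u2, h2, h3⟩ := hD.exists_step h hl hp (hD.reach_mem_cell h')
    exact h3.trans ((hD.reach_unique h2 h').sameResidue_singleton s)
  have hp' : g'⁻¹ * g ∈ D.parabolic .pos {s} := by simpa using inv_mem_parabolic hp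
  obtain ⟨v, h⟩ := h
  obtain ⟨v', h'⟩ := h'
  obtain ⟨x, hx, hxp⟩ := mem_parabolic_iff.1 hp
  obtain ⟨v'', hv'', h2⟩ := hD.cell_mul_cell_special hx (hD.reach_mem_cell h) hxp
  rw [mul_inv_cancel_left] at h2
  obtain rfl := hD.cell_unique h2 (hD.reach_mem_cell h')
  have hne := cs.length_mul_simple_ne v s
  rcases mem_specialSubgroup_singleton hv'' with e | e
  · rw [inv_mul_eq_one] at e
    subst e
    rcases hne.lt_or_gt with hl | hl
    · obtain ⟨g2, hg2, hp2⟩ := hD.exists_descending (s := s) (hD.reach_mem_cell h)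
      obtain ⟨w2, u2, h2⟩ := hD.exists_reach hg2
      have hl' : cs.length (v * cs.simple s) < cs.length (v * cs.simple s * cs.simple s) := by
        rwa [cs.simple_mul_simple_cancel_right]
      rw [← cs.simple_mul_simple_cancel_right (w := v) s] at h h'
      refine (up h2 h hl' hp2).symm.trans (up h2 h' hl' ?_)
      convert hD.parabolic_mul_mem hp2 hp using 1
      group
    · have hm : cs.IsMinimalIn {s} v := by
        intro j hj
        rwa [Set.mem_singleton_iff.1 hj]
      have h3 := hD.mem_borel_of_mem_cell_of_isMinimalIn hm (hD.reach_mem_cell h)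
        (hD.reach_mem_cell h') hp
      have h4 := hD.reach_mul_borel h h3
      rw [mul_inv_cancel_left] at h4
      exact (hD.reach_unique h4 h').sameResidue_singleton s
  · rw [inv_mul_eq_iff_eq_mul] at e
    subst e
    rcases hne.lt_or_gt with hl | hl
    · rw [← cs.simple_mul_simple_cancel_right (w := v) s] at h
      exact (up h' h (by rwa [cs.simple_mul_simple_cancel_right]) hp').symm
    · exact up h h' hl hp

/-- The section of the covering maps `w B_+` to the pair `(w, 1)`. -/
theorem IsTRD.isSection_of_lifts {w : W} : ∀ {n : G}, D.Lifts n w → D.IsSection n w 1 := by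
  suffices H : ∀ {n : G}, D.Lifts n w → D.Reach w n w 1 from fun {_} hn => ⟨w, H hn⟩
  induction hk : cs.length w generalizing w with
  | zero =>
    rw [cs.length_eq_zero_iff] at hk
    subst hk
    exact fun hn => .base (H_le_borel _ (hD.mem_of_lifts_one hn))
  | succ k ih =>
    intro n hn
    obtain ⟨s, hs⟩ := cs.exists_rightDescent_of_ne_one (w := w) (by rintro rfl; simp at hk)
    rw [cs.isRightDescent_iff] at hs
    obtain ⟨m, hm⟩ := hD.exists_lifts (cs.simple s)
    have hss : cs.simple s ∈ cs.specialSubgroup {s} := simple_mem_special (Set.mem_singleton s)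
    have h1 := ih (w := w * cs.simple s) (by omega) (hn.mul hm)
    refine .step h1 s (by rw [cs.simple_mul_simple_cancel_right]) (by omega) ?_ (hn.mem_cell _)
      ⟨one_mem _, n, hn, 1, one_mem _, by simp⟩ (sameResidue_one_one (by simpa using hss))
    rw [mul_inv_rev, inv_mul_cancel_right]
    exact inv_mem_parabolic (hm.mem_parabolic hss)

/-- The section of the covering is equivariant under `U_-`. -/
theorem IsTRD.isSection_smul {x : G} (hx : x ∈ D.unipotent .neg) : ∀ {g : G} {w w' : W} {u u' : G},
    D.IsSection g w u → D.IsSection (x * g) w' u' → D.SameLift w (x * u) w' u' := by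
  let E : Subgroup G :=
    { carrier := {x | ∀ g w w' u u',
        D.IsSection g w u → D.IsSection (x * g) w' u' → D.SameLift w (x * u) w' u'}
      one_mem' := by
        intro g w w' u u' h h'
        rw [one_mul] at h' ⊢
        exact hD.isSection_unique h h'
      mul_mem' := by
        intro x y hx hy g w w' u u' h h'
        obtain ⟨w2, u2, h2⟩ := hD.exists_isSection (y * g)
        have h3 := (hy _ _ _ _ _ h h2).mul_left x
        rw [← mul_assoc] at h3
        exact h3.trans (hx _ _ _ _ _ h2 (by rwa [← mul_assoc]))
      inv_mem' := by
        intro x hx g w w' u u' h h'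
        simpa using ((hx _ _ _ _ _ h' (by rwa [mul_inv_cancel_left])).mul_left x⁻¹).symm }
  suffices H : D.unipotent .neg ≤ E from fun {_ _ _ _ _} h h' => H hx _ _ _ _ _ h h'
  refine iSup₂_le fun β (hβ : 1 ∉ β.half) x hx => ?_
  have hxu := U_le_unipotent_neg hβ hx
  have key : ∀ {v : W} {h : G}, h ∈ D.cell .pos v → ∀ g,
      (∀ w w' u u', D.IsSection g w u → D.IsSection (x * g) w' u' → D.SameLift w (x * u) w' u') →
      ∀ w w' u u', D.IsSection (g * h) w u → D.IsSection (x * (g * h)) w' u' →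
        D.SameLift w (x * u) w' u' := by
    intro v
    induction hk : cs.length v generalizing v with
    | zero =>
      rw [cs.length_eq_zero_iff] at hk
      subst hk
      intro h hh g hg w w' u u' h1 h2
      rw [hD.mem_cell_one_iff] at hh
      have h1' := hD.isSection_mul_borel h1 (inv_mem hh)
      have h2' := hD.isSection_mul_borel h2 (inv_mem hh)
      rw [← mul_assoc] at h2'
      rw [mul_inv_cancel_right] at h1' h2'
      exact hg _ _ _ _ h1' h2'
    | succ k ih =>
      intro h hh g hg w w' u u' h1 h2
      obtain ⟨s, hs⟩ := cs.exists_rightDescent_of_ne_one (w := v) (by rintro rfl; simp at hk)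
      rw [cs.isRightDescent_iff] at hs
      obtain ⟨h', hh', hp⟩ := hD.exists_descending (s := s) hh
      have hg' := ih (by omega) hh' g hg
      obtain ⟨w3, u3, h3⟩ := hD.exists_isSection (g * h')
      obtain ⟨w4, u4, h4⟩ := hD.exists_isSection (x * (g * h'))
      have e1 := hD.isSection_sameResidue h3 h1 (s := s) (by convert hp using 1; group)
      have e2 := hD.isSection_sameResidue h4 h2 (s := s) (by convert hp using 1; group)
      have e3 := (hg' _ _ _ _ h3 h4).sameResidue_singleton s
      exact hD.sameLift_of_sameResidue (((e1.mul_left x).symm.trans e3).trans e2)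
        (h1.isOver.mul_left hxu) h2.isOver
  intro g w w' u u' h1 h2
  -- `x` fixes the chambers of the standard apartment in `β`
  obtain ⟨w0, hw0⟩ := β.exists_mem
  obtain ⟨n, hn⟩ := hD.exists_lifts w0
  obtain ⟨v, hv⟩ := hD.exists_mem_cell .pos (n⁻¹ * g)
  have hns := hD.isSection_of_lifts hn
  have hb : n⁻¹ * x * n ∈ D.borel .pos := by
    refine U_le_borel (α := w0⁻¹ • β) ?_ (hD.inv_conj_mem hn (by rwa [smul_inv_smul]))
    rw [mem_half_smul, inv_inv, mul_one]
    exact hw0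
  refine key hv n ?_ w w' u u' (by rwa [mul_inv_cancel_left]) (by rwa [mul_inv_cancel_left])
  intro w w' u u' h1 h2
  have h3 := hD.isSection_mul_borel hns hb
  have e : n * (n⁻¹ * x * n) = x * n := by group
  rw [e] at h3
  have h4 : D.SameLift w0 (x * 1) w0 1 :=
    ⟨rfl, by simpa using inv_mem (U_le_segment hw0 hβ hx)⟩
  exact (((hD.isSection_unique h1 hns).mul_left x).trans h4).trans (hD.isSection_unique h3 h2)

theorem IsTRD.sameLift_of_isOver {g : G} {w w' : W} {u u' : G} (h : D.IsOver g w u)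
    (h' : D.IsOver g w' u') : D.SameLift w u w' u' := by
  obtain ⟨w0, u0, h0⟩ := hD.exists_isSection g
  have key : ∀ {w u}, D.IsOver g w u → D.SameLift w u w0 u0 := by
    rintro w u ⟨hu, n, hn, b, hb, rfl⟩
    have h1 := hD.isSection_mul_borel (hD.isSection_of_lifts hn) hb
    simpa using hD.isSection_smul hu h1 (by rwa [← mul_assoc])
  exact (key h).trans (key h').symm

/-- Uniqueness in the Birkhoff decomposition, refined by the coset of the element of `U_-`. -/
theorem IsTRD.birkhoff_unique_neg {u u' n n' b b' : G} {w w' : W} (hu : u ∈ D.unipotent .neg)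
    (hu' : u' ∈ D.unipotent .neg) (hn : D.Lifts n w) (hn' : D.Lifts n' w')
    (hb : b ∈ D.borel .pos) (hb' : b' ∈ D.borel .pos) (e : u * n * b = u' * n' * b') :
    w = w' ∧ u⁻¹ * u' ∈ D.segment w 1 :=
  hD.sameLift_of_isOver ⟨hu, n, hn, b, hb, rfl⟩ ⟨hu', n', hn', b', hb', e⟩

theorem IsTRD.eq_one_of_mem_unipotent_neg_of_mem_borel {x : G} (hx : x ∈ D.unipotent .neg)
    (hb : x ∈ D.borel .pos) : x = 1 := by
  obtain ⟨-, h⟩ := hD.birkhoff_unique_neg hx (one_mem _) lifts_one lifts_one (one_mem _) hb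
    (by simp)
  rwa [segment_self, Subgroup.mem_bot, mul_one, inv_eq_one] at h

theorem IsTRD.eq_one_of_mem_unipotent_of_mem_borel {ε : TwinSign} {x : G}
    (hx : x ∈ D.unipotent ε) (hb : x ∈ D.borel ε.opp) : x = 1 := by
  cases ε
  · exact hD.flip.eq_one_of_mem_unipotent_neg_of_mem_borel (by rwa [flip_unipotent])
      (by rwa [flip_borel])
  · exact hD.eq_one_of_mem_unipotent_neg_of_mem_borel hx hb

theorem IsTRD.eq_one_of_mem_unipotent_of_mem_H {ε : TwinSign} {x : G} (hx : x ∈ D.unipotent ε)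
    (hH : x ∈ D.H) : x = 1 := hD.eq_one_of_mem_unipotent_of_mem_borel hx (H_le_borel _ hH)

/-- `B_+ ∩ B_- = H`. -/
theorem IsTRD.mem_H_of_mem_borel {ε : TwinSign} {x : G} (hx : x ∈ D.borel ε)
    (hx' : x ∈ D.borel ε.opp) : x ∈ D.H := by
  obtain ⟨u, hu, h, hh, rfl⟩ := hD.exists_unipotent_mul_H hx
  have h1 := hD.eq_one_of_mem_unipotent_of_mem_borel hu
    (by simpa using mul_mem hx' (inv_mem (H_le_borel ε.opp hh)))
  rwa [h1, one_mul]

/-- Uniqueness in the Birkhoff decomposition. -/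
theorem IsTRD.birkhoff_unique {ε : TwinSign} {a a' n n' b b' : G} {w w' : W}
    (ha : a ∈ D.borel ε.opp) (ha' : a' ∈ D.borel ε.opp) (hn : D.Lifts n w) (hn' : D.Lifts n' w')
    (hb : b ∈ D.borel ε) (hb' : b' ∈ D.borel ε) (e : a * n * b = a' * n' * b') : w = w' := by
  have key : ∀ {D : RootGroupData cs G}, D.IsTRD → ∀ {a a' n n' b b' : G} {w w' : W},
      a ∈ D.borel .neg → a' ∈ D.borel .neg → D.Lifts n w → D.Lifts n' w' → b ∈ D.borel .pos →
      b' ∈ D.borel .pos → a * n * b = a' * n' * b' → w = w' := by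
    intro D hD a a' n n' b b' w w' ha ha' hn hn' hb hb' e
    obtain ⟨u, hu, h, hh, rfl⟩ := hD.exists_unipotent_mul_H ha
    obtain ⟨u', hu', h', hh', rfl⟩ := hD.exists_unipotent_mul_H ha'
    have h1 := (lifts_of_mem hh).mul hn
    have h2 := (lifts_of_mem hh').mul hn'
    rw [one_mul] at h1 h2
    exact (hD.birkhoff_unique_neg hu hu' h1 h2 hb hb' (by simpa [mul_assoc] using e)).1
  cases ε
  · exact key hD ha ha' hn hn' hb hb' e
  · refine key hD.flip ?_ ?_ (hD.flip_lifts.2 hn) (hD.flip_lifts.2 hn') ?_ ?_ e <;>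
      rwa [flip_borel]

/-- Existence in the Birkhoff decomposition. -/
theorem IsTRD.exists_birkhoff (ε : TwinSign) (g : G) : ∃ u ∈ D.unipotent ε.opp, ∃ n w,
    D.Lifts n w ∧ ∃ b ∈ D.borel ε, g = u * n * b := by
  have key : ∀ {D : RootGroupData cs G}, D.IsTRD → ∃ u ∈ D.unipotent .neg, ∃ n w,
      D.Lifts n w ∧ ∃ b ∈ D.borel .pos, g = u * n * b := by
    intro D hD
    obtain ⟨w, u, h⟩ := hD.exists_isSection g
    obtain ⟨hu, n, hn, b, hb, e⟩ := h.isOver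
    exact ⟨u, hu, n, w, hn, b, hb, e⟩
  cases ε
  · exact key hD
  · obtain ⟨u, hu, n, w, hn, b, hb, e⟩ := key hD.flip
    rw [flip_unipotent] at hu
    rw [flip_borel] at hb
    exact ⟨u, hu, n, w, hD.flip_lifts.1 hn, b, hb, e⟩

end Birkhoff
end RootGroupData

/-! ### Levi factors -/

namespace CoxeterSystem

section Traces

variable {S : Type*} {W : Type*} [Group W] {M : CoxeterMatrix S} {cs : CoxeterSystem M W}
  {J : Set S}

/-- The root `β` of `W_J` is the trace on `W_J` of the root `α` of `W`. -/
def Root.IsTrace (α : cs.Root) (β : (cs.specialSystem J).Root) : Prop :=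
  Subtype.val ⁻¹' α.half = β.half

theorem Root.IsTrace.crosses {α : cs.Root} {β : (cs.specialSystem J).Root} (h : α.IsTrace β) :
    α.Crosses J := crosses_of_preimage_half_eq h

theorem Root.IsTrace.mem_iff {α : cs.Root} {β : (cs.specialSystem J).Root} (h : α.IsTrace β)
    (x : cs.specialSubgroup J) : (x : W) ∈ α.half ↔ x ∈ β.half := by
  rw [← h]
  rfl

theorem Root.IsTrace.neg {α : cs.Root} {β : (cs.specialSystem J).Root} (h : α.IsTrace β) :
    (-α).IsTrace (-β) := by
  rw [IsTrace, half_neg, half_neg, ← h, Set.preimage_compl]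

theorem Root.IsTrace.smul {α : cs.Root} {β : (cs.specialSystem J).Root} (h : α.IsTrace β)
    (y : cs.specialSubgroup J) : ((y : W) • α).IsTrace (y • β) := by
  ext x
  rw [Set.mem_preimage, mem_half_smul, mem_half_smul, ← h.mem_iff]
  rfl

theorem isTrace_simpleRoot (j : J) :
    (cs.simpleRoot j).IsTrace ((cs.specialSystem J).simpleRoot j) := by
  have := half_specialSystem (cs := cs) (1 : cs.specialSubgroup J) j
  rw [one_smul, OneMemClass.coe_one, one_smul] at this
  exact this.symm

theorem Root.IsTrace.unique_left {α α' : cs.Root} {β : (cs.specialSystem J).Root}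
    (h : α.IsTrace β) (h' : α'.IsTrace β) : α = α' :=
  h.crosses.eq_of_forall fun x hx => (h.mem_iff ⟨x, hx⟩).trans (h'.mem_iff ⟨x, hx⟩).symm

theorem Root.IsTrace.unique_right {α : cs.Root} {β β' : (cs.specialSystem J).Root}
    (h : α.IsTrace β) (h' : α.IsTrace β') : β = β' :=
  Root.ext_half (h.symm.trans h')

theorem Root.exists_isTrace (β : (cs.specialSystem J).Root) : ∃ α : cs.Root, α.IsTrace β :=
  (exists_crosses_of_specialRoot β).imp fun _ h => h.2

theorem Root.Crosses.exists_isTrace {α : cs.Root} (h : α.Crosses J) :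
    ∃ β : (cs.specialSystem J).Root, α.IsTrace β := exists_specialRoot_of_crosses h

theorem Prenilpotent.of_isTrace {α β : cs.Root} {α' β' : (cs.specialSystem J).Root}
    (hα : α.IsTrace α') (hβ : β.IsTrace β') (h : (cs.specialSystem J).Prenilpotent α' β') :
    cs.Prenilpotent α β := by
  obtain ⟨⟨x, hx, hx'⟩, z, hz, hz'⟩ := h
  exact ⟨⟨x, (hα.mem_iff x).2 hx, (hβ.mem_iff x).2 hx'⟩, z, (hα.neg.mem_iff z).2 hz,
    (hβ.neg.mem_iff z).2 hz'⟩

/-- An interval bounded by roots crossing `W_J` whose traces form a prenilpotent pair consists of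
roots crossing `W_J`. -/
theorem exists_isTrace_of_mem_openInterval {α β γ : cs.Root} {α' β' : (cs.specialSystem J).Root}
    (hα : α.IsTrace α') (hβ : β.IsTrace β') (h : (cs.specialSystem J).Prenilpotent α' β')
    (hγ : γ ∈ cs.openInterval α β) :
    ∃ γ' ∈ (cs.specialSystem J).openInterval α' β', γ.IsTrace γ' := by
  obtain ⟨h1, h2, h3, h4⟩ := hγ
  have hγc : γ.Crosses J := by
    obtain ⟨⟨x, hx, hx'⟩, z, hz, hz'⟩ := h
    exact ⟨⟨x, x.2, h1 ⟨(hα.mem_iff x).2 hx, (hβ.mem_iff x).2 hx'⟩⟩, z, z.2,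
      h2 ⟨(hα.neg.mem_iff z).2 hz, (hβ.neg.mem_iff z).2 hz'⟩⟩
  obtain ⟨γ', hγ'⟩ := hγc.exists_isTrace
  refine ⟨γ', ⟨fun x hx => ?_, fun x hx => ?_, ?_, ?_⟩, hγ'⟩
  · exact (hγ'.mem_iff x).1 (h1 ⟨(hα.mem_iff x).2 hx.1, (hβ.mem_iff x).2 hx.2⟩)
  · exact (hγ'.neg.mem_iff x).1 (h2 ⟨(hα.neg.mem_iff x).2 hx.1, (hβ.neg.mem_iff x).2 hx.2⟩)
  · rintro rfl
    exact h3 (hγ'.unique_left hα)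
  · rintro rfl
    exact h4 (hγ'.unique_left hβ)

end Traces

end CoxeterSystem

namespace RootGroupData

section Levi

variable {S : Type*} {W : Type*} [Group W] {M : CoxeterMatrix S} {cs : CoxeterSystem M W}
  {G : Type*} [Group G] {J : Set S}

open CoxeterSystem

/-- The standard Levi factor of type `J`. -/
def levi (D : RootGroupData cs G) (J : Set S) : Subgroup G :=
  D.H ⊔ ⨆ (α : cs.Root) (_ : α.Crosses J), D.U α

/-- `f` identifies the group `K`, with the root data `D'`, with the standard Levi factor of type
`J`. -/
structure IsLeviModel (D : RootGroupData cs G) {K : Type*} [Group K] (f : K →* G)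
    (D' : RootGroupData (cs.specialSystem J) K) : Prop where
  injective : Function.Injective f
  range_eq : f.range = D.levi J
  mem_H_iff : ∀ x, x ∈ D'.H ↔ f x ∈ D.H
  mem_U_iff {α β} : Root.IsTrace α β → ∀ x, x ∈ D'.U β ↔ f x ∈ D.U α

variable {D : RootGroupData cs G} {K : Type*} [Group K] {f : K →* G}
  {D' : RootGroupData (cs.specialSystem J) K}

theorem H_le_levi : D.H ≤ D.levi J := le_sup_left

theorem U_le_levi {α : cs.Root} (h : α.Crosses J) : D.U α ≤ D.levi J :=
  (le_iSup₂_of_le α h le_rfl : D.U α ≤ ⨆ (α : cs.Root) (_ : α.Crosses J), D.U α).trans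
    le_sup_right

namespace IsLeviModel

variable (hf : D.IsLeviModel f D')
include hf

theorem exists_eq_of_mem {x : G} (hx : x ∈ D.levi J) : ∃ y, f y = x := by
  rwa [← hf.range_eq] at hx

theorem map_mem_levi (y : K) : f y ∈ D.levi J := hf.range_eq ▸ ⟨y, rfl⟩

theorem exists_eq_of_mem_U {α : cs.Root} {β} (h : α.IsTrace β) {x : G} (hx : x ∈ D.U α) :
    ∃ y ∈ D'.U β, f y = x := by
  obtain ⟨y, rfl⟩ := hf.exists_eq_of_mem (U_le_levi h.crosses hx)
  exact ⟨y, (hf.mem_U_iff h y).2 hx, rfl⟩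

theorem map_U {α : cs.Root} {β} (h : α.IsTrace β) : (D'.U β).map f = D.U α := by
  ext x
  constructor
  · rintro ⟨y, hy, rfl⟩
    exact (hf.mem_U_iff h y).1 hy
  · intro hx
    obtain ⟨y, hy, rfl⟩ := hf.exists_eq_of_mem_U h hx
    exact ⟨y, hy, rfl⟩

theorem map_H : D'.H.map f = D.H := by
  ext x
  constructor
  · rintro ⟨y, hy, rfl⟩
    exact (hf.mem_H_iff y).1 hy
  · intro hx
    obtain ⟨y, rfl⟩ := hf.exists_eq_of_mem (H_le_levi hx)
    exact ⟨y, (hf.mem_H_iff y).2 hx, rfl⟩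

theorem conj_smul_iff {α α₁ : cs.Root} {β β₁} (h : α.IsTrace β) (h₁ : α₁.IsTrace β₁) (m : K) :
    MulAut.conj m • D'.U β = D'.U β₁ ↔ MulAut.conj (f m) • D.U α = D.U α₁ := by
  constructor
  · intro e
    rw [← hf.map_U h, ← hf.map_U h₁, ← e]
    ext x
    rw [MulAut.mem_conj_smul_iff]
    constructor
    · rintro ⟨y, hy, e⟩
      refine ⟨m * y * m⁻¹, MulAut.conj_mul_mem_conj_smul hy, ?_⟩
      simp only [map_mul, map_inv, e]
      group
    · rintro ⟨y, hy, rfl⟩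
      exact ⟨m⁻¹ * y * m, MulAut.mem_conj_smul_iff.1 hy, by simp⟩
  · intro e
    ext x
    rw [MulAut.mem_conj_smul_iff, hf.mem_U_iff h, hf.mem_U_iff h₁, ← e,
      MulAut.mem_conj_smul_iff]
    simp

theorem map_ne_one {x : K} (hx : x ≠ 1) : f x ≠ 1 := by
  rwa [Ne, map_eq_one_iff f hf.injective]

theorem map_unipotent_le (ε : TwinSign) : (D'.unipotent ε).map f ≤ D.unipotent ε := by
  simp only [unipotent, Subgroup.map_iSup]
  refine iSup₂_le fun β hβ => ?_
  obtain ⟨α, h⟩ := Root.exists_isTrace β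
  rw [hf.map_U h]
  refine le_iSup₂_of_le α ?_ le_rfl
  cases ε
  · exact (h.mem_iff 1).2 hβ
  · exact fun h' => hβ ((h.mem_iff 1).1 h')

theorem map_borel_le (ε : TwinSign) : (D'.borel ε).map f ≤ D.borel ε := by
  rw [borel, Subgroup.map_sup, hf.map_H]
  exact sup_le_sup_left (hf.map_unipotent_le ε) _

theorem map_mem_borel {ε : TwinSign} {b : K} (hb : b ∈ D'.borel ε) : f b ∈ D.borel ε :=
  hf.map_borel_le ε ⟨b, hb, rfl⟩

theorem map_unipotent_pos : (D'.unipotent .pos).map f = D.leviUnipotent J := by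
  apply le_antisymm
  · simp only [unipotent, Subgroup.map_iSup]
    refine iSup₂_le fun β hβ => ?_
    obtain ⟨α, h⟩ := Root.exists_isTrace β
    rw [hf.map_U h]
    exact U_le_leviUnipotent h.crosses ((h.mem_iff 1).2 hβ)
  · refine iSup₂_le fun α hα => ?_
    obtain ⟨β, h⟩ := hα.1.exists_isTrace
    rw [← hf.map_U h]
    exact Subgroup.map_mono (U_le_unipotent_pos ((h.mem_iff 1).1 hα.2))

variable (hD : D.IsTRD)
include hD

/-- The pair of (TRD2) may be computed in `G`. -/
theorem exists_isReflectionPair {j : J} {u : K} (hu : u ∈ D'.U ((cs.specialSystem J).simpleRoot j))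
    (hu1 : u ≠ 1) : ∃ x, D'.IsReflectionPair j u x ∧
      D.IsReflectionPair j (f u) (f x.1, f x.2) := by
  have hj := isTrace_simpleRoot (cs := cs) j
  obtain ⟨⟨a, b⟩, hab, -⟩ := hD.existsUnique_reflection j (f u) ((hf.mem_U_iff hj u).1 hu)
    (hf.map_ne_one hu1)
  obtain ⟨ha, ha1, hb, hb1, h⟩ := hab
  obtain ⟨a, ha', rfl⟩ := hf.exists_eq_of_mem_U hj.neg ha
  obtain ⟨b, hb', rfl⟩ := hf.exists_eq_of_mem_U hj.neg hb
  refine ⟨(a, b), ⟨ha', ?_, hb', ?_, fun β => ?_⟩, ha, ha1, hb, hb1, h⟩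
  · rintro rfl
    simp at ha1
  · rintro rfl
    simp at hb1
  · obtain ⟨α, hα⟩ := Root.exists_isTrace β
    rw [hf.conj_smul_iff hα (hα.smul _), coe_specialSystem_simple]
    simpa using h α

theorem isReflectionPair_unique {j : J} {u : K} {x x' : K × K}
    (hx : D'.IsReflectionPair j u x) (hx' : D'.IsReflectionPair j u x') : x = x' := by
  have hj := isTrace_simpleRoot (cs := cs) j
  obtain ⟨h1, -, h2, -, h3⟩ := hx
  obtain ⟨h1', -, h2', -, h3'⟩ := hx'
  have key : ∀ {x : K × K}, (∀ β, MulAut.conj (x.1 * u * x.2) • D'.U β =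
      D'.U ((cs.specialSystem J).simple j • β)) →
      MulAut.conj (f x.1 * f u * f x.2) • D.U (cs.simpleRoot j) = D.U (-cs.simpleRoot j) ∧
      MulAut.conj (f x.1 * f u * f x.2) • D.U (-cs.simpleRoot j) = D.U (cs.simpleRoot j) := by
    intro x h
    have e1 := h ((cs.specialSystem J).simpleRoot j)
    have e2 := h (-(cs.specialSystem J).simpleRoot j)
    rw [simple_smul_simpleRoot, hf.conj_smul_iff hj hj.neg] at e1
    rw [simple_smul_neg_simpleRoot, hf.conj_smul_iff hj.neg hj] at e2
    simpa using And.intro e1 e2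
  have e := hD.reflectionPair_unique ((hf.mem_U_iff hj.neg _).1 h1)
    ((hf.mem_U_iff hj.neg _).1 h2) ((hf.mem_U_iff hj.neg _).1 h1') ((hf.mem_U_iff hj.neg _).1 h2')
    (key h3).1 (key h3).2 (key h3').1 (key h3').2
  exact Prod.ext (hf.injective e.1) (hf.injective e.2)

theorem map_isReflectionLift {j : J} {u m : K} (h : D'.IsReflectionLift j u m) :
    D.IsReflectionLift j (f u) (f m) := by
  have hj := isTrace_simpleRoot (cs := cs) j
  obtain ⟨hu, hu1, x, hx, rfl⟩ := h
  obtain ⟨x', hx', h'⟩ := hf.exists_isReflectionPair hD hu hu1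
  obtain rfl := hf.isReflectionPair_unique hD hx hx'
  exact ⟨(hf.mem_U_iff hj u).1 hu, hf.map_ne_one hu1, _, h', by simp⟩

omit hD in
theorem commutator_le {α β : (cs.specialSystem J).Root} {I : Set (cs.specialSystem J).Root}
    {I' : cs.Root → cs.Root → Set cs.Root} (hne : α ≠ β)
    (hcomm : ∀ α β, α ≠ β → cs.Prenilpotent α β → ⁅D.U α, D.U β⁆ ≤ ⨆ γ ∈ I' α β, D.U γ)
    (h : (cs.specialSystem J).Prenilpotent α β)
    (hI : ∀ {α₁ β₁}, Root.IsTrace α₁ α → Root.IsTrace β₁ β → ∀ γ ∈ I' α₁ β₁, ∃ γ' ∈ I,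
      Root.IsTrace γ γ') : ⁅D'.U α, D'.U β⁆ ≤ ⨆ γ ∈ I, D'.U γ := by
  obtain ⟨α₁, hα⟩ := Root.exists_isTrace α
  obtain ⟨β₁, hβ⟩ := Root.exists_isTrace β
  rw [← Subgroup.map_le_map_iff_of_injective hf.injective, Subgroup.map_commutator,
    hf.map_U hα, hf.map_U hβ]
  refine (hcomm α₁ β₁ ?_ (h.of_isTrace hα hβ)).trans (iSup₂_le fun γ hγ => ?_)
  · rintro rfl
    exact hne (hα.unique_right hβ)
  obtain ⟨γ', hγ', hγt⟩ := hI hα hβ γ hγ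
  rw [← hf.map_U hγt]
  exact Subgroup.map_mono (le_iSup₂_of_le γ' hγ' le_rfl)

theorem isTRD : D'.IsTRD where
  nontrivial β h := by
    obtain ⟨α, hα⟩ := Root.exists_isTrace β
    apply hD.nontrivial α
    rw [← hf.map_U hα, h, Subgroup.map_bot]
  normalized β h hh := by
    obtain ⟨α, hα⟩ := Root.exists_isTrace β
    rw [Subgroup.mem_normalizer_iff]
    intro x
    have := Subgroup.mem_normalizer_iff.1 (hD.normalized α ((hf.mem_H_iff h).1 hh)) (f x)
    change x ∈ D'.U β ↔ _ ∈ D'.U β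
    rw [hf.mem_U_iff hα, hf.mem_U_iff hα]
    simpa using this
  commutator α β hne h := hf.commutator_le hne hD.commutator h
    fun hα hβ _ hγ => exists_isTrace_of_mem_openInterval hα hβ h hγ
  existsUnique_reflection j u hu hu1 := by
    obtain ⟨x, hx, -⟩ := hf.exists_isReflectionPair hD hu hu1
    exact ⟨x, hx, fun y hy => hf.isReflectionPair_unique hD hy hx⟩
  reflection_coset j u v m m' h h' := by
    rw [hf.mem_H_iff]
    simpa using hD.reflection_coset _ _ _ _ _ (hf.map_isReflectionLift hD h)
      (hf.map_isReflectionLift hD h')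
  not_le_neg j h := by
    apply hD.not_le_neg j
    rw [← hf.map_U (isTrace_simpleRoot j)]
    exact (Subgroup.map_mono h).trans (hf.map_unipotent_le _)
  not_le_pos j h := by
    apply hD.not_le_pos j
    rw [← hf.map_U (isTrace_simpleRoot j).neg]
    exact (Subgroup.map_mono h).trans (hf.map_unipotent_le _)
  generated := by
    rw [eq_top_iff, ← Subgroup.map_le_map_iff_of_injective hf.injective, ← MonoidHom.range_eq_map,
      hf.range_eq, Subgroup.map_sup, hf.map_H, Subgroup.map_iSup]
    refine sup_le_sup_left (iSup₂_le fun α hα => ?_) _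
    obtain ⟨β, h⟩ := hα.exists_isTrace
    exact le_iSup_of_le β (hf.map_U h).ge

omit hD in
theorem isTRDLin (hL : D.IsTRDLin) : D'.IsTRDLin where
  toIsTRD := hf.isTRD hL.toIsTRD
  commutator_lin _ _ hne h := hf.commutator_le hne hL.commutator_lin h
    fun hα hβ _ hγ => exists_mem_openLinearInterval_special hα hβ hγ

theorem map_lifts {n : K} {y : cs.specialSubgroup J} (hn : D'.Lifts n y) : D.Lifts (f n) y := by
  have : D'.weylGraph ≤ D.weylGraph.comap (f.prodMap (cs.specialSubgroup J).subtype) := by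
    rw [weylGraph, Subgroup.closure_le]
    rintro ⟨m, x⟩ (⟨h1, h2⟩ | ⟨j, u, h1, h2⟩)
    · obtain rfl : x = 1 := h2
      exact lifts_of_mem ((hf.mem_H_iff m).1 h1)
    · obtain rfl : x = _ := h2
      have := (hf.map_isReflectionLift hD h1).lifts
      rw [← coe_specialSystem_simple] at this
      exact this
  exact this hn

theorem lifts_of_map {n : K} {y : cs.specialSubgroup J} (hn : D.Lifts (f n) y) :
    D'.Lifts n y := by
  obtain ⟨m, hm⟩ := (hf.isTRD hD).exists_lifts y
  have h := hD.lifts_inv_mul_mem (hf.map_lifts hD hm) hn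
  rw [← map_inv, ← map_mul, ← hf.mem_H_iff] at h
  simpa using hm.mul (lifts_of_mem h)

theorem exists_map_eq_of_lifts {n : G} {y : W} (hn : D.Lifts n y) (hy : y ∈ cs.specialSubgroup J) :
    ∃ m, D'.Lifts m ⟨y, hy⟩ ∧ f m = n := by
  obtain ⟨m, hm⟩ := (hf.isTRD hD).exists_lifts ⟨y, hy⟩
  have h := hD.lifts_inv_mul_mem (hf.map_lifts hD hm) hn
  obtain ⟨h', e⟩ := hf.exists_eq_of_mem (H_le_levi h)
  refine ⟨m * h', hf.lifts_of_map hD ?_, ?_⟩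
  · rw [map_mul, e, mul_inv_cancel_left]
    exact hn
  · rw [map_mul, e, mul_inv_cancel_left]

theorem map_mem_cell {ε : TwinSign} {x : K} {y : cs.specialSubgroup J} (hx : x ∈ D'.cell ε y) :
    f x ∈ D.cell ε y := by
  obtain ⟨b, hb, n, hn, b', hb', rfl⟩ := hx
  exact ⟨f b, hf.map_mem_borel hb, f n, hf.map_lifts hD hn, f b', hf.map_mem_borel hb', by simp⟩

end IsLeviModel

/-- Conjugates of the standard Levi factor, with their induced root data, are models of it. -/
theorem isLeviModel_conj (D : RootGroupData cs G) (J : Set S) (g : G) {L : Subgroup G}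
    (hL : L = MulAut.conj g • D.levi J) :
    D.IsLeviModel ((MulAut.conj g⁻¹).toMonoidHom.comp L.subtype)
      (D.leviData J (cs.specialSystem J) g L) where
  injective := (MulAut.conj g⁻¹).injective.comp Subtype.val_injective
  range_eq := by
    subst hL
    ext x
    constructor
    · rintro ⟨y, rfl⟩
      simpa using MulAut.mem_conj_smul_iff.1 y.2
    · intro hx
      exact ⟨⟨g * x * g⁻¹, MulAut.conj_mul_mem_conj_smul hx⟩, by simp [mul_assoc]⟩
  mem_H_iff x := by
    simp [leviData, Subgroup.mem_subgroupOf, MulAut.mem_conj_smul_iff]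
  mem_U_iff {α β} h x := by
    have e : (⨆ (α : cs.Root) (_ : Subtype.val ⁻¹' α.half = β.half),
        MulAut.conj g • D.U α) = MulAut.conj g • D.U α := by
      apply le_antisymm
      · refine iSup₂_le fun α' h' => ?_
        rw [h.unique_left (α' := α') h']
      · exact le_iSup₂_of_le α h le_rfl
    rw [leviData, Subgroup.mem_subgroupOf, e, MulAut.mem_conj_smul_iff]
    simp

end Levi

end RootGroupData

/-! ### Parabolic subgroups -/

namespace RootGroupData

section Parabolic

variable {S : Type*} {W : Type*} [Group W] {M : CoxeterMatrix S} {cs : CoxeterSystem M W}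
  {G : Type*} [Group G] {D : RootGroupData cs G} {J : Set S}

open CoxeterSystem

theorem exists_isLeviModel (D : RootGroupData cs G) (J : Set S) :
    ∃ (f : D.levi J →* G) (D' : RootGroupData (cs.specialSystem J) (D.levi J)),
      D.IsLeviModel f D' := ⟨_, _, D.isLeviModel_conj J 1 (by simp)⟩

variable (hD : D.IsTRD)
include hD

theorem IsTRD.lifts_conj_radical (hJ : D.LeviCondition J) {w : W}
    (hw : w ∈ cs.specialSubgroup J) : ∀ {n : G}, D.Lifts n w →
      ∀ v ∈ D.radical J, n * v * n⁻¹ ∈ D.radical J := by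
  obtain ⟨f, D', hf⟩ := exists_isLeviModel D J
  have hD' := hf.isTRD hD
  have hsimple : ∀ j : J, ∀ n, D.Lifts n (cs.simple j) →
      ∀ v ∈ D.radical J, n * v * n⁻¹ ∈ D.radical J := by
    intro j n hn
    refine hD.lifts_simple_conj_radical hJ j.2 hn fun x hx => ?_
    rw [← hf.map_unipotent_pos] at hx ⊢
    obtain ⟨x, hx, rfl⟩ := hx
    obtain ⟨a, ha, v, hv, e⟩ := exists_root_mul_radical j (inv_mem hx)
    obtain ⟨m, hm, rfl⟩ := hf.exists_map_eq_of_lifts hD hn (simple_mem_special j.2)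
    have e1 : (⟨cs.simple j, simple_mem_special j.2⟩ : cs.specialSubgroup J) =
        (cs.specialSystem J).simple j := Subtype.ext (coe_specialSystem_simple _ _ _).symm
    rw [e1] at hm
    refine ⟨f v⁻¹, ⟨m * v⁻¹ * m⁻¹, ?_, by simp⟩, f a⁻¹,
      (hf.mem_U_iff (isTrace_simpleRoot j) _).1 (inv_mem ha), ?_⟩
    · exact radical_le (hD'.lifts_conj_radical_singleton hm _ (inv_mem hv))
    · rw [← map_mul, ← mul_inv_rev, ← e, inv_inv]
  suffices H : ∀ (y : cs.specialSubgroup J) (n : G), D.Lifts n y →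
      ∀ v ∈ D.radical J, n * v * n⁻¹ ∈ D.radical J from fun {n} hn => H ⟨w, hw⟩ n hn
  intro y
  induction y using (cs.specialSystem J).simple_induction_left with
  | one => exact fun n hn => hD.H_conj_radical (hD.mem_of_lifts_one hn)
  | mul_simple_left y j ih =>
    intro n hn v hv
    rw [Subgroup.coe_mul, coe_specialSystem_simple] at hn
    obtain ⟨m, hm⟩ := hD.exists_lifts (cs.simple j)
    have h1 := ih (m⁻¹ * n) (by simpa using hm.inv.mul hn) v hv
    convert hsimple j m hm _ h1 using 1
    group

/-- The radical is normalized by the Levi factor. -/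
theorem IsTRD.levi_conj_radical (hJ : D.LeviCondition J) {x : G} (hx : x ∈ D.levi J) :
    ∀ v ∈ D.radical J, x * v * x⁻¹ ∈ D.radical J := by
  obtain ⟨f, D', hf⟩ := exists_isLeviModel D J
  have hD' := hf.isTRD hD
  have hB : ∀ b ∈ D'.borel .pos, ∀ v ∈ D.radical J, f b * v * (f b)⁻¹ ∈ D.radical J := by
    intro b hb v hv
    obtain ⟨u, hu, h, hh, rfl⟩ := hD'.exists_unipotent_mul_H hb
    have h1 := hD.H_conj_radical ((hf.mem_H_iff h).1 hh) v hv
    convert leviUnipotent_conj_radical (hf.map_unipotent_pos.le ⟨u, hu, rfl⟩) _ h1 using 1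
    rw [map_mul]
    group
  obtain ⟨x, rfl⟩ := hf.exists_eq_of_mem hx
  obtain ⟨y, b, hb, n, hn, b', hb', rfl⟩ := hD'.exists_mem_cell .pos x
  intro v hv
  convert hB b hb _ (hD.lifts_conj_radical hJ y.2 (hf.map_lifts hD hn) _ (hB b' hb' v hv)) using 1
  simp only [map_mul]
  group

theorem IsTRD.levi_subset_parabolic (ε : TwinSign) {x : G} (hx : x ∈ D.levi J) :
    x ∈ D.parabolic ε J := by
  obtain ⟨f, D', hf⟩ := exists_isLeviModel D J
  obtain ⟨x, rfl⟩ := hf.exists_eq_of_mem hx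
  obtain ⟨y, hy⟩ := (hf.isTRD hD).exists_mem_cell ε x
  exact mem_parabolic_iff.2 ⟨y, y.2, hf.map_mem_cell hD hy⟩

theorem IsTRD.lifts_mem_levi {n : G} {w : W} (hn : D.Lifts n w)
    (hw : w ∈ cs.specialSubgroup J) : n ∈ D.levi J := by
  obtain ⟨f, D', hf⟩ := exists_isLeviModel D J
  obtain ⟨m, -, rfl⟩ := hf.exists_map_eq_of_lifts hD hn hw
  exact hf.map_mem_levi m

omit hD in
theorem leviUnipotent_le_levi : D.leviUnipotent J ≤ D.levi J :=
  iSup₂_le fun _ h => U_le_levi h.1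

/-- `P_J = L V`, since `L` normalizes `V` and both `B_+` and the lifts of elements of `W_J` lie in
`L V`. -/
theorem IsTRD.exists_levi_mul_radical_of_mem_parabolic (hJ : D.LeviCondition J) {p : G}
    (hp : p ∈ D.parabolic .pos J) : ∃ x ∈ D.levi J, ∃ v ∈ D.radical J, p = x * v := by
  refine Subgroup.exists_mul_of_mem_sup' (fun _ ha => hD.levi_conj_radical hJ ha) ?_
  have hB : D.borel .pos ≤ D.radical J ⊔ D.levi J := by
    rw [borel, unipotent_eq_sup (J := J)]
    exact sup_le (H_le_levi.trans le_sup_right)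
      (sup_le_sup_left leviUnipotent_le_levi _)
  obtain ⟨b, hb, n, w, hw, hn, b', hb', rfl⟩ := hp
  exact mul_mem (mul_mem (hB hb) (Subgroup.mem_sup_right (hD.lifts_mem_levi hn hw))) (hB hb')

theorem IsTRD.radical_normal (hJ : D.LeviCondition J) {p : G} (hp : p ∈ D.parabolic .pos J) :
    ∀ v ∈ D.radical J, p * v * p⁻¹ ∈ D.radical J := by
  obtain ⟨x, hx, v, hv, rfl⟩ := hD.exists_levi_mul_radical_of_mem_parabolic hJ hp
  intro u hu
  convert hD.levi_conj_radical hJ hx _ (mul_mem (mul_mem hv hu) (inv_mem hv)) using 1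
  group

/-- All conjugates under the Levi factor `L` of an element `k` of the radical that lies in `L` are
in the positive Borel subgroup of `L`. Writing `k = b n b'` with `b, b'` in the negative Borel
subgroup, the conjugate `b' b n` and the Birkhoff decomposition of `L` give `n ∈ H`, so that `k`
lies in both Borel subgroups, whence in `H`. -/
theorem IsTRD.eq_one_of_mem_levi_of_mem_radical (hJ : D.LeviCondition J) {k : G}
    (hk : k ∈ D.levi J) (hk' : k ∈ D.radical J) : k = 1 := by
  obtain ⟨f, D', hf⟩ := exists_isLeviModel D J
  have hD' := hf.isTRD hD
  obtain ⟨k, rfl⟩ := hf.exists_eq_of_mem hk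
  have hB : ∀ x : D.levi J, x⁻¹ * k * x ∈ D'.borel .pos := by
    intro x
    have h1 : f (x⁻¹ * k * x) ∈ D.borel .pos := by
      have := hD.levi_conj_radical hJ (hf.map_mem_levi x⁻¹) _ hk'
      refine unipotent_le_borel _ (radical_le (J := J) ?_)
      convert this using 1
      simp
    obtain ⟨y, hy⟩ := hD'.exists_mem_cell .pos (x⁻¹ * k * x)
    have h2 := hD.cell_unique (hf.map_mem_cell hD hy) (hD.mem_cell_one_iff.2 h1)
    obtain rfl : y = 1 := Subtype.ext h2
    exact hD'.mem_cell_one_iff.1 hy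
  have h1 := hB 1
  rw [inv_one, one_mul, mul_one] at h1
  obtain ⟨y, b, hb, n, hn, b', hb', e⟩ := hD'.exists_mem_cell .neg k
  have h2 := hB (b * n)
  have e2 : b' * b * n * 1 = 1 * 1 * ((b * n)⁻¹ * k * (b * n)) := by rw [e]; group
  have hy := hD'.birkhoff_unique (ε := .pos) (mul_mem hb' hb) (one_mem _) hn lifts_one (one_mem _)
    h2 e2
  subst hy
  have h3 : k ∈ D'.borel .neg := by
    rw [e]
    exact mul_mem (mul_mem hb (H_le_borel _ (hD'.mem_of_lifts_one hn))) hb'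
  exact hD.eq_one_of_mem_unipotent_of_mem_H (radical_le hk')
    ((hf.mem_H_iff k).1 (hD'.mem_H_of_mem_borel h1 h3))

omit hD in
theorem flip_levi : D.flip.levi J = D.levi J := by
  apply le_antisymm <;> refine sup_le_sup_left (iSup₂_le fun α hα => ?_) _
  · exact le_iSup₂_of_le (-α) hα.neg le_rfl
  · exact le_iSup₂_of_le (-α) hα.neg (by rw [flip_U, neg_neg])

omit hD in
variable (D) in
/-- The unipotent radical of the standard parabolic subgroup `P_{ε,J}`. -/
def radicalOf (J : Set S) : TwinSign → Subgroup G
  | .pos => D.radical J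
  | .neg => D.flip.radical J

theorem IsTRD.leviCondition_of_or (h : Finite (cs.specialSubgroup J) ∨ D.IsTRDLin) :
    D.LeviCondition J :=
  h.elim (fun _ => hD.leviCondition_of_finite) fun h => h.leviCondition

theorem IsTRD.flip_leviCondition_of_or (h : Finite (cs.specialSubgroup J) ∨ D.IsTRDLin) :
    D.flip.LeviCondition J := hD.flip.leviCondition_of_or (h.imp_right fun h => h.flip)

variable (h : Finite (cs.specialSubgroup J) ∨ D.IsTRDLin) {ε : TwinSign}

omit hD in
theorem radicalOf_le : D.radicalOf J ε ≤ D.unipotent ε := by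
  cases ε
  · exact radical_le
  · exact radical_le.trans (flip_unipotent _).le

include h

theorem IsTRD.exists_levi_mul_radicalOf {p : G} (hp : p ∈ D.parabolic ε J) :
    ∃ x ∈ D.levi J, ∃ v ∈ D.radicalOf J ε, p = x * v := by
  cases ε
  · exact hD.exists_levi_mul_radical_of_mem_parabolic (hD.leviCondition_of_or h) hp
  · rw [← flip_levi]
    exact hD.flip.exists_levi_mul_radical_of_mem_parabolic (hD.flip_leviCondition_of_or h)
      (by rwa [hD.flip_parabolic])

theorem IsTRD.radicalOf_normal {p : G} (hp : p ∈ D.parabolic ε J) :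
    ∀ v ∈ D.radicalOf J ε, p * v * p⁻¹ ∈ D.radicalOf J ε := by
  cases ε
  · exact hD.radical_normal (hD.leviCondition_of_or h) hp
  · exact hD.flip.radical_normal (hD.flip_leviCondition_of_or h) (by rwa [hD.flip_parabolic])

theorem IsTRD.eq_one_of_mem_levi_of_mem_radicalOf {k : G} (hk : k ∈ D.levi J)
    (hk' : k ∈ D.radicalOf J ε) : k = 1 := by
  cases ε
  · exact hD.eq_one_of_mem_levi_of_mem_radical (hD.leviCondition_of_or h) hk hk'
  · exact hD.flip.eq_one_of_mem_levi_of_mem_radical (hD.flip_leviCondition_of_or h)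
      (by rwa [flip_levi]) hk'

omit hD h in
theorem radicalOf_subset_parabolic {v : G} (hv : v ∈ D.radicalOf J ε) :
    v ∈ D.parabolic ε J :=
  borel_subset_parabolic (unipotent_le_borel _ (radicalOf_le hv))

/-- Two opposite parabolic subgroups intersect in their common Levi factor. -/
theorem IsTRD.mem_levi_of_mem_parabolic {p : G} (hp : p ∈ D.parabolic ε J)
    (hp' : p ∈ D.parabolic ε.opp J) : p ∈ D.levi J := by
  obtain ⟨x, hx, v, hv, rfl⟩ := hD.exists_levi_mul_radicalOf h hp
  have h1 := hD.parabolic_mul_mem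
    (inv_mem_parabolic (hD.levi_subset_parabolic ε.opp hx)) hp'
  rw [inv_mul_cancel_left] at h1
  obtain ⟨l, hl, v', hv', e⟩ := hD.exists_levi_mul_radicalOf h h1
  obtain ⟨f, D', hf⟩ := exists_isLeviModel D J
  have hD' := hf.isTRD hD
  obtain ⟨l, rfl⟩ := hf.exists_eq_of_mem hl
  obtain ⟨u, hu, n, y, hn, b, hb, rfl⟩ := hD'.exists_birkhoff ε.opp l
  rw [TwinSign.opp_opp] at hu
  have hfu : f u ∈ D.unipotent ε := hf.map_unipotent_le _ ⟨u, hu, rfl⟩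
  have huv : (f u)⁻¹ * v ∈ D.unipotent ε := mul_mem (inv_mem hfu) (radicalOf_le hv)
  have hbv : f b * v' ∈ D.borel ε.opp :=
    mul_mem (hf.map_mem_borel hb) (unipotent_le_borel _ (radicalOf_le hv'))
  have e1 : (f u)⁻¹ * v * 1 * 1 = 1 * f n * (f b * v') := by rw [e]; simp [mul_assoc]
  have hy := hD.birkhoff_unique (ε := ε.opp)
    (by rw [TwinSign.opp_opp]; exact unipotent_le_borel _ huv) (one_mem _) lifts_one
    (hf.map_lifts hD hn) (one_mem _) hbv e1
  have hn1 : f n ∈ D.H := by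
    apply hD.mem_of_lifts_one
    rw [hy]
    exact hf.map_lifts hD hn
  have h2 := hD.eq_one_of_mem_unipotent_of_mem_borel huv (by
    have e2 : (f u)⁻¹ * v = f n * (f b * v') := by simpa using e1
    rw [e2]
    exact mul_mem (H_le_borel _ hn1) hbv)
  have hvu : v = f u := (inv_mul_eq_one.1 h2).symm
  have hv1 := hD.eq_one_of_mem_levi_of_mem_radicalOf h
    (hvu ▸ hf.map_mem_levi u) hv
  rwa [hv1, mul_one]

/-- The radical is the normal closure in the parabolic subgroup of the root groups of the roots
containing the facet. -/
theorem IsTRD.radicalOf_eq_closure : D.radicalOf J ε = Subgroup.closure {y | ∃ p ∈ D.parabolic ε J,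
    ∃ α : cs.Root, (∀ w ∈ cs.specialSubgroup J, α.Contains ε w) ∧ ∃ x ∈ D.U α,
      y = p * x * p⁻¹} := by
  have key : ∀ {D : RootGroupData cs G}, D.IsTRD → D.LeviCondition J → D.radical J =
      Subgroup.closure {y | ∃ p ∈ D.parabolic .pos J, ∃ α : cs.Root,
        (∀ w ∈ cs.specialSubgroup J, α.Contains .pos w) ∧ ∃ x ∈ D.U α, y = p * x * p⁻¹} := by
    intro D hD hJ
    apply le_antisymm
    · rw [radical, Subgroup.closure_le]
      rintro _ ⟨x, hx, u, hu, rfl⟩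
      revert u
      change ∀ u ∈ D.outerUnipotent J, x * u * x⁻¹ ∈ Subgroup.closure _
      rw [← Subgroup.le_comap_conj_iff]
      exact iSup₂_le fun α hα u hu => Subgroup.subset_closure
        ⟨x, hD.levi_subset_parabolic _ (leviUnipotent_le_levi hx), α, hα, u, hu, rfl⟩
    · rw [Subgroup.closure_le]
      rintro _ ⟨p, hp, α, hα, x, hx, rfl⟩
      exact hD.radical_normal hJ hp _ (outerUnipotent_le_radical (U_le_outerUnipotent hα hx))
  cases ε
  · exact key hD (hD.leviCondition_of_or h)
  · refine (key hD.flip (hD.flip_leviCondition_of_or h)).trans ?_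
    rw [hD.flip_parabolic]
    congr 1
    ext y
    constructor
    · rintro ⟨p, hp, α, hα, x, hx, rfl⟩
      exact ⟨p, hp, -α, fun w hw => Root.contains_neg.2 (hα w hw), x, hx, rfl⟩
    · rintro ⟨p, hp, α, hα, x, hx, rfl⟩
      exact ⟨p, hp, -α, fun w hw => Root.contains_neg.2 (hα w hw), x, by rwa [flip_U, neg_neg],
        rfl⟩

end Parabolic

end RootGroupData

/-! ### Codistance -/

namespace RootGroupData

section Apartments

variable {S : Type*} {W : Type*} [Group W] {M : CoxeterMatrix S} {cs : CoxeterSystem M W}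
  {G : Type*} [Group G] {D : RootGroupData cs G}

open CoxeterSystem

variable (D) in
/-- The double coset `B_{-ε} w B_ε`: its elements `g` are those for which `B_{-ε}` and `g B_ε`
are at codistance `w`. -/
def oppCell (ε : TwinSign) (w : W) : Set G :=
  {g | ∃ a ∈ D.borel ε.opp, ∃ n, D.Lifts n w ∧ ∃ b ∈ D.borel ε, g = a * n * b}

theorem mul_mem_oppCell {ε : TwinSign} {w : W} {a g : G} (ha : a ∈ D.borel ε.opp)
    (hg : g ∈ D.oppCell ε w) : a * g ∈ D.oppCell ε w := by
  obtain ⟨c, hc, n, hn, b, hb, rfl⟩ := hg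
  exact ⟨a * c, mul_mem ha hc, n, hn, b, hb, by group⟩

theorem oppCell_mul_mem {ε : TwinSign} {w : W} {b g : G} (hg : g ∈ D.oppCell ε w)
    (hb : b ∈ D.borel ε) : g * b ∈ D.oppCell ε w := by
  obtain ⟨c, hc, n, hn, b', hb', rfl⟩ := hg
  exact ⟨c, hc, n, hn, b' * b, mul_mem hb' hb, by group⟩

theorem inv_mem_oppCell {ε : TwinSign} {w : W} {g : G} (hg : g ∈ D.oppCell ε w) :
    g⁻¹ ∈ D.oppCell ε.opp w⁻¹ := by
  obtain ⟨c, hc, n, hn, b, hb, rfl⟩ := hg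
  exact ⟨b⁻¹, inv_mem (by rwa [TwinSign.opp_opp]), n⁻¹, hn.inv, c⁻¹, inv_mem hc, by group⟩

theorem mem_oppCell_one_of_mem {ε : TwinSign} {b : G} (hb : b ∈ D.borel ε) :
    b ∈ D.oppCell ε 1 := ⟨1, one_mem _, 1, lifts_one, b, hb, by simp⟩

variable (hD : D.IsTRD)
include hD

theorem IsTRD.oppCell_unique {ε : TwinSign} {w w' : W} {g : G} (hg : g ∈ D.oppCell ε w)
    (hg' : g ∈ D.oppCell ε w') : w = w' := by
  obtain ⟨a, ha, n, hn, b, hb, rfl⟩ := hg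
  obtain ⟨a', ha', n', hn', b', hb', e⟩ := hg'
  exact hD.birkhoff_unique ha ha' hn hn' hb hb' e

theorem IsTRD.flip_oppCell (ε : TwinSign) (w : W) :
    D.flip.oppCell ε w = D.oppCell ε.opp w := by
  simp only [oppCell, flip_borel, hD.flip_lifts]

theorem IsTRD.mem_oppCell_one_iff {ε : TwinSign} {g : G} :
    g ∈ D.oppCell ε 1 ↔ g ∈ (D.borel ε.opp : Set G) * (D.borel ε : Set G) := by
  constructor
  · rintro ⟨a, ha, n, hn, b, hb, rfl⟩
    exact ⟨a * n, mul_mem ha (H_le_borel _ (hD.mem_of_lifts_one hn)), b, hb, rfl⟩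
  · rintro ⟨a, ha, b, hb, rfl⟩
    exact mul_mem_oppCell ha (mem_oppCell_one_of_mem hb)

theorem IsTRD.oppCell_mul_lift_of_lt {w : W} {s : S} {g n : G} (hg : g ∈ D.oppCell .pos w)
    (hn : D.Lifts n (cs.simple s)) (h : cs.length (w * cs.simple s) < cs.length w) :
    g * n ∈ D.oppCell .pos (w * cs.simple s) := by
  obtain ⟨a, ha, m, hm, b, hb, rfl⟩ := hg
  obtain ⟨x, hx, c, rfl, hc⟩ := hD.exists_borel_factorization s hb hn
  refine ⟨a * (m * x * m⁻¹), mul_mem ha (unipotent_le_borel _ (U_le_unipotent_neg ?_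
    (hD.conj_mem hm hx))), m * n, hm.mul hn, _, hc, by group⟩
  rw [one_mem_smul_simpleRoot_iff]
  omega

theorem IsTRD.oppCell_mul_lift {w : W} {s : S} {g n : G} (hg : g ∈ D.oppCell .pos w)
    (hn : D.Lifts n (cs.simple s)) :
    g * n ∈ D.oppCell .pos w ∨ g * n ∈ D.oppCell .pos (w * cs.simple s) := by
  have hne := cs.length_mul_simple_ne w s
  by_cases h : cs.length (w * cs.simple s) < cs.length w
  · exact Or.inr (hD.oppCell_mul_lift_of_lt hg hn h)
  obtain ⟨a, ha, m, hm, b, hb, rfl⟩ := hg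
  obtain ⟨x, hx, c, rfl, hc⟩ := hD.exists_borel_factorization s hb hn
  obtain rfl | hx1 := eq_or_ne x 1
  · exact Or.inr ⟨a, ha, m * n, hm.mul hn, _, hc, by group⟩
  obtain ⟨y, hy, y', hy', n', -, -, hn', rfl⟩ := hD.exists_eq_mul_lift_mul' hx hx1
  left
  refine ⟨a * (m * y * m⁻¹), mul_mem ha (unipotent_le_borel _ (U_le_unipotent_neg ?_
    (hD.conj_mem hm hy))), m * (n' * n), ?_, n⁻¹ * y' * n * (n⁻¹ * c * n), ?_, by group⟩
  · rw [smul_neg_root]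
    intro h'
    rw [mem_half_neg, one_mem_smul_simpleRoot_iff] at h'
    omega
  · simpa using hm.mul (hn'.mul hn)
  · rw [← simple_smul_simpleRoot] at hy'
    exact mul_mem (U_le_borel (cs.one_mem_simpleRoot s) (hD.inv_conj_mem hn hy')) hc

theorem IsTRD.lift_mul_oppCell {w : W} {s : S} {g n : G} (hg : g ∈ D.oppCell .pos w)
    (hn : D.Lifts n (cs.simple s)) :
    n * g ∈ D.oppCell .pos w ∨ n * g ∈ D.oppCell .pos (cs.simple s * w) := by
  have h1 : g⁻¹ ∈ D.flip.oppCell .pos w⁻¹ := by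
    rw [hD.flip_oppCell]
    exact inv_mem_oppCell hg
  have h2 : D.flip.Lifts n⁻¹ (cs.simple s) := by
    rw [hD.flip_lifts]
    simpa using hn.inv
  rcases hD.flip.oppCell_mul_lift h1 h2 with h | h <;>
    rw [hD.flip_oppCell, ← mul_inv_rev] at h <;> have h := inv_mem_oppCell h <;>
    rw [inv_inv, TwinSign.opp_opp] at h
  · exact Or.inl (by rwa [inv_inv] at h)
  · exact Or.inr (by rwa [mul_inv_rev, inv_inv, cs.inv_simple] at h)

/-- Codistances do not exceed distances. -/
theorem IsTRD.length_le_of_mem_oppCell {w : W} : ∀ {v : W} {g : G}, g ∈ D.cell .pos w →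
    g ∈ D.oppCell .pos v → cs.length v ≤ cs.length w := by
  induction hk : cs.length w generalizing w with
  | zero =>
    rw [cs.length_eq_zero_iff] at hk
    subst hk
    intro v g hg hv
    rw [hD.mem_cell_one_iff] at hg
    rw [hD.oppCell_unique hv (mem_oppCell_one_of_mem hg), cs.length_one]
  | succ k ih =>
    intro v g hg hv
    obtain ⟨s, hs⟩ := cs.exists_rightDescent_of_ne_one (w := w) (by rintro rfl; simp at hk)
    rw [cs.isRightDescent_iff] at hs
    obtain ⟨n, hn⟩ := hD.exists_lifts w
    obtain ⟨m, hm⟩ := hD.exists_lifts (cs.simple s)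
    obtain ⟨b, hb, b', hb', rfl⟩ := hD.exists_eq_mul_of_mem_cell hg hn
    have hv' : b * n ∈ D.oppCell .pos v := by
      simpa using oppCell_mul_mem hv (inv_mem hb')
    have h1 : b * n * m ∈ D.cell .pos (w * cs.simple s) := by
      rw [mul_assoc]
      exact mul_mem_cell hb ((hn.mul hm).mem_cell _)
    have hl := cs.length_simple s
    rcases hD.oppCell_mul_lift hv' hm with h2 | h2
    · have := ih (by omega) h1 h2
      omega
    · have := ih (by omega) h1 h2
      have := cs.length_mul_simple v s
      omega

/-- `B_+ w B_+ ∩ B_- w B_+ = w B_+`. -/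
theorem IsTRD.inv_mul_mul_mem_borel_of_mem_oppCell {w : W} : ∀ {n b : G}, D.Lifts n w →
    b ∈ D.borel .pos → b * n ∈ D.oppCell .pos w → n⁻¹ * b * n ∈ D.borel .pos := by
  induction hk : cs.length w generalizing w with
  | zero =>
    rw [cs.length_eq_zero_iff] at hk
    subst hk
    intro n b hn hb _
    have h := H_le_borel .pos (hD.mem_of_lifts_one hn)
    exact mul_mem (mul_mem (inv_mem h) hb) h
  | succ k ih =>
    intro n b hn hb hbn
    obtain ⟨s, hs⟩ := cs.exists_leftDescent_of_ne_one (w := w) (by rintro rfl; simp at hk)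
    rw [cs.isLeftDescent_iff] at hs
    obtain ⟨m, hm⟩ := hD.exists_lifts (cs.simple s)
    have hmn : D.Lifts (m⁻¹ * n) (cs.simple s * w) := by simpa using hm.inv.mul hn
    obtain ⟨x, hx, c, rfl, hc⟩ := hD.exists_borel_factorization s hb hm
    have hcell := mul_mem_cell hc (hmn.mem_cell .pos)
    obtain rfl | hx1 := eq_or_ne x 1
    · rw [one_mul] at hbn ⊢
      obtain ⟨u, hu, n', u', hn', b', hb', e⟩ := hD.exists_birkhoff .pos (m⁻¹ * c * m * (m⁻¹ * n))
      have hv : m⁻¹ * c * m * (m⁻¹ * n) ∈ D.oppCell .pos u' :=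
        ⟨u, unipotent_le_borel _ hu, n', hn', b', hb', e⟩
      have hle := hD.length_le_of_mem_oppCell hcell hv
      have e2 : m * (m⁻¹ * c * m * (m⁻¹ * n)) = c * n := by group
      have hu' : cs.simple s * w = u' := by
        rcases hD.lift_mul_oppCell hv hm with h | h
        · rw [e2] at h
          have := hD.oppCell_unique h hbn
          rw [this] at hle
          omega
        · rw [e2] at h
          rw [hD.oppCell_unique hbn h, cs.simple_mul_simple_cancel_left]
      rw [← hu'] at hv
      have := ih (by omega) hmn hc hv
      convert this using 1
      group
    · exfalso
      obtain ⟨y, hy, y', hy', n', -, -, hn', rfl⟩ := hD.exists_eq_mul_lift_mul' hx hx1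
      rw [← simple_smul_simpleRoot] at hy'
      have h1 : n' * m ∈ D.H := hD.mem_of_lifts_one (by simpa using hn'.mul hm)
      have h2 : y⁻¹ ∈ D.borel .neg := inv_mem (unipotent_le_borel _ (U_le_unipotent_neg
        (fun h' => by rw [mem_half_neg] at h'; exact h' (cs.one_mem_simpleRoot s)) hy))
      have h3 := mul_mem_oppCell (ε := .pos) (H_le_borel _ (inv_mem h1))
        (mul_mem_oppCell (ε := .pos) h2 hbn)
      have e : (n' * m)⁻¹ * (y⁻¹ * (y * n' * y' * c * n)) =
          m⁻¹ * y' * m * (m⁻¹ * c * m * (m⁻¹ * n)) := by group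
      rw [e] at h3
      have := hD.length_le_of_mem_oppCell (mul_mem_cell
        (U_le_borel (cs.one_mem_simpleRoot s) (hD.inv_conj_mem hm hy')) hcell) h3
      omega

/-- If `b ∈ B_+` and `B_+` is the only chamber of the apartment `{b w B_+}` opposite to `B_-`, then
this apartment is the standard one: by descending induction, `b w B_+` is at codistance `w`
from `B_-`. -/
theorem IsTRD.inv_mul_mul_mem_borel_of_forall {b : G} (hb : b ∈ D.borel .pos)
    (h : ∀ n w, D.Lifts n w → b * n ∈ D.oppCell .pos 1 → w = 1) {n : G} {w : W}
    (hn : D.Lifts n w) : n⁻¹ * b * n ∈ D.borel .pos := by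
  have key : ∀ (k : ℕ) (y w : W) (n : G), cs.length y = k → D.Lifts n w →
      b * n ∈ D.oppCell .pos y → y = w := by
    intro k
    induction k with
    | zero =>
      intro y w n hy hn hbn
      rw [cs.length_eq_zero_iff] at hy
      subst hy
      exact (h n w hn hbn).symm
    | succ k ih =>
      intro y w n hy hn hbn
      obtain ⟨s, hs⟩ := cs.exists_rightDescent_of_ne_one (w := y) (by rintro rfl; simp at hy)
      rw [cs.isRightDescent_iff] at hs
      obtain ⟨m, hm⟩ := hD.exists_lifts (cs.simple s)
      have h1 := hD.oppCell_mul_lift_of_lt hbn hm (by omega)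
      rw [mul_assoc] at h1
      exact mul_right_cancel (ih _ _ _ (by omega) (hn.mul hm) h1)
  obtain ⟨u, hu, n', y, hn', b', hb', e⟩ := hD.exists_birkhoff .pos (b * n)
  have hy : b * n ∈ D.oppCell .pos y := ⟨u, unipotent_le_borel _ hu, n', hn', b', hb', e⟩
  obtain rfl := key _ y w n rfl hn hy
  exact hD.inv_mul_mul_mem_borel_of_mem_oppCell hn hb hy

end Apartments

end RootGroupData

/-! ### Opposite apartments -/

namespace RootGroupData

section OppositeApartments

variable {S : Type*} {W : Type*} [Group W] {M : CoxeterMatrix S} {cs : CoxeterSystem M W}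
  {G : Type*} [Group G] {D : RootGroupData cs G} {ε : TwinSign} {J : Set S}

open CoxeterSystem

theorem chamber_eq_iff {x y : G} : D.chamber ε x = D.chamber ε y ↔ x⁻¹ * y ∈ D.borel ε :=
  leftCoset_eq_iff _

theorem mem_chamber_self (x : G) : x ∈ D.chamber ε x := ⟨1, one_mem _, mul_one x⟩

theorem smul_chamber (g x : G) : g • D.chamber ε x = D.chamber ε (g * x) := smul_smul _ _ _

theorem mem_smul_stdApartment {g : G} {c : Set G} :
    c ∈ g • D.stdApartment ε ↔ ∃ n w, D.Lifts n w ∧ c = D.chamber ε (g * n) := by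
  constructor
  · rintro ⟨_, ⟨n, w, hn, rfl⟩, rfl⟩
    exact ⟨n, w, hn, smul_chamber g n⟩
  · rintro ⟨n, w, hn, rfl⟩
    exact ⟨_, ⟨n, w, hn, rfl⟩, smul_chamber g n⟩

theorem Lifts.mul_smul_stdApartment {n : G} {w : W} (hn : D.Lifts n w) (g : G) :
    (g * n) • D.stdApartment ε = g • D.stdApartment ε := by
  ext c
  rw [mem_smul_stdApartment, mem_smul_stdApartment]
  constructor
  · rintro ⟨m, v, hm, rfl⟩
    exact ⟨n * m, _, hn.mul hm, by rw [mul_assoc]⟩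
  · rintro ⟨m, v, hm, rfl⟩
    exact ⟨n⁻¹ * m, _, hn.inv.mul hm, by rw [mul_assoc, mul_inv_cancel_left]⟩

theorem chambersOpposite_iff {x y : G} :
    D.ChambersOpposite ε (D.chamber ε x) (D.chamber ε.opp y) ↔
      x⁻¹ * y ∈ (D.borel ε : Set G) * (D.borel ε.opp : Set G) := by
  constructor
  · rintro ⟨g, h, hg, hh, b, hb, c, hc, e⟩
    rw [chamber_eq_iff] at hg hh
    refine ⟨x⁻¹ * g * b, mul_mem hg hb, c * (y⁻¹ * h)⁻¹, mul_mem hc (inv_mem hh), ?_⟩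
    have e' : b * c = g⁻¹ * h := e
    calc x⁻¹ * g * b * (c * (y⁻¹ * h)⁻¹) = x⁻¹ * g * (b * c) * (y⁻¹ * h)⁻¹ := by group
      _ = x⁻¹ * y := by rw [e']; group
  · exact fun h => ⟨x, y, rfl, rfl, h⟩

variable (hD : D.IsTRD)
include hD

/-- Each pair of opposite apartments is a translate of the standard one. -/
theorem IsTRD.exists_isTranslateOfStd {A : TwinSign → Set (Set G)}
    (hA : D.IsOppositeApartments A) : ∃ g, D.IsTranslateOfStd A g := by
  obtain ⟨hA, hopp⟩ := hA
  obtain ⟨x, hx⟩ := hA .pos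
  obtain ⟨y, hy⟩ := hA .neg
  have hxA : ∀ n w, D.Lifts n w → D.chamber .pos (x * n) ∈ A .pos := fun n w hn => by
    rw [hx]; exact mem_smul_stdApartment.2 ⟨n, w, hn, rfl⟩
  have hx0 := hxA 1 1 lifts_one
  rw [mul_one] at hx0
  obtain ⟨d, ⟨hd, hxd⟩, hdu⟩ := hopp .pos _ hx0
  have hd' : d ∈ A .neg := hd
  rw [hy] at hd'
  obtain ⟨m, v, hm, rfl⟩ := mem_smul_stdApartment.1 hd'
  rw [← hm.mul_smul_stdApartment] at hy
  set z := y * m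
  have hzA : ∀ n w, D.Lifts n w → D.chamber .neg (z * n) ∈ A .neg := fun n w hn => by
    rw [hy]; exact mem_smul_stdApartment.2 ⟨n, w, hn, rfl⟩
  obtain ⟨b, hb, c, hc, e⟩ := chambersOpposite_iff.1 hxd
  have e : b * c = x⁻¹ * z := e
  have hb : b ∈ D.borel .pos := hb
  have hc : c ∈ D.borel .neg := hc
  -- for `g = x b = z c⁻¹`, the chambers `g B_+` and `g B_-` belong to the two apartments
  have hxb : x = x * b * b⁻¹ := by group
  have hzc : z = x * b * c := by rw [mul_assoc, e]; group
  have hwp : ∀ {n : G} {w : W}, D.Lifts n w → n ∈ D.borel .pos → w = 1 :=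
    hD.eq_one_of_lifts_of_mem_borel
  have hwn : ∀ {n : G} {w : W}, D.Lifts n w → n ∈ D.borel .neg → w = 1 := fun hn h =>
    hD.flip.eq_one_of_lifts_of_mem_borel (hD.flip_lifts.2 hn) (by rwa [flip_borel])
  have h1 : ∀ n w, D.Lifts n w → b⁻¹ * n ∈ D.oppCell .pos 1 → w = 1 := by
    intro n w hn h
    rw [hD.mem_oppCell_one_iff] at h
    have hz := hzA 1 1 lifts_one
    rw [mul_one] at hz
    have hu := (hopp .neg _ hz).unique (y₁ := D.chamber .pos (x * n)) (y₂ := D.chamber .pos x)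
      ⟨hxA n w hn, ?_⟩ ⟨hx0, ?_⟩
    · rw [chamber_eq_iff] at hu
      refine hwp hn ?_
      simpa using inv_mem hu
    · refine chambersOpposite_iff.2 ?_
      obtain ⟨a, ha, a', ha', e'⟩ := h
      refine ⟨c⁻¹ * a, mul_mem (inv_mem hc) ha, a', ha', ?_⟩
      have e' : a * a' = b⁻¹ * n := e'
      change c⁻¹ * a * a' = z⁻¹ * (x * n)
      rw [mul_assoc, e', hzc]
      group
    · refine chambersOpposite_iff.2 ⟨c⁻¹, inv_mem hc, b⁻¹, inv_mem hb, ?_⟩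
      change c⁻¹ * b⁻¹ = _
      rw [hzc]
      group
  have h2 : ∀ n w, D.flip.Lifts n w → c * n ∈ D.flip.oppCell .pos 1 → w = 1 := by
    intro n w hn h
    rw [hD.flip_lifts] at hn
    rw [hD.flip_oppCell, hD.mem_oppCell_one_iff] at h
    have hu := (hopp .pos _ hx0).unique (y₁ := D.chamber .neg (z * n)) (y₂ := D.chamber .neg z)
      ⟨hzA n w hn, ?_⟩ ⟨hd, hxd⟩
    · rw [chamber_eq_iff] at hu
      refine hwn hn ?_
      simpa using inv_mem hu
    · refine chambersOpposite_iff.2 ?_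
      obtain ⟨a, ha, a', ha', e'⟩ := h
      refine ⟨b * a, mul_mem hb ha, a', ha', ?_⟩
      have e' : a * a' = c * n := e'
      change b * a * a' = x⁻¹ * (z * n)
      rw [mul_assoc, e', hzc]
      group
  have key : ∀ {ε : TwinSign} {p : G}, (∀ n w, D.Lifts n w → n⁻¹ * p * n ∈ D.borel ε) →
      ∀ g : G, (g * p) • D.stdApartment ε = g • D.stdApartment ε := by
    intro ε p hp g
    have : ∀ n w, D.Lifts n w → D.chamber ε (g * p * n) = D.chamber ε (g * n) := by
      intro n w hn
      rw [chamber_eq_iff]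
      convert inv_mem (hp n w hn) using 1
      group
    ext a
    rw [mem_smul_stdApartment, mem_smul_stdApartment]
    constructor
    · rintro ⟨n, w, hn, rfl⟩
      exact ⟨n, w, hn, this n w hn⟩
    · rintro ⟨n, w, hn, rfl⟩
      exact ⟨n, w, hn, (this n w hn).symm⟩
  refine ⟨x * b, fun ε => ?_⟩
  cases ε
  · rw [hx]
    nth_rewrite 1 [hxb]
    exact key (fun n w hn => hD.inv_mul_mul_mem_borel_of_forall (inv_mem hb) h1 hn) _
  · rw [hy, hzc]
    refine key (fun n w hn => ?_) _
    have := hD.flip.inv_mul_mul_mem_borel_of_forall (by rwa [flip_borel]) h2 (hD.flip_lifts.2 hn)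
    rwa [flip_borel] at this

theorem IsTRD.mem_specialSubgroup_of_mem_parabolic {n : G} {w : W} (hn : D.Lifts n w)
    (h : n ∈ D.parabolic ε J) : w ∈ cs.specialSubgroup J := by
  obtain ⟨v, hv, h⟩ := mem_parabolic_iff.1 h
  rwa [hD.cell_unique (hn.mem_cell ε) h]

theorem IsTRD.mul_smul_parabolic {p : G} (hp : p ∈ D.parabolic ε J) (g : G) :
    (g * p) • D.parabolic ε J = g • D.parabolic ε J := by
  rw [mul_smul]
  congr 1
  ext x
  rw [Set.mem_smul_set_iff_inv_smul_mem, smul_eq_mul]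
  constructor
  · intro h
    simpa using hD.parabolic_mul_mem hp h
  · exact hD.parabolic_mul_mem (inv_mem_parabolic hp)

theorem IsTRD.chamber_subset_smul_parabolic_iff {g x : G} :
    D.chamber ε x ⊆ g • D.parabolic ε J ↔ g⁻¹ * x ∈ D.parabolic ε J := by
  constructor
  · intro h
    simpa [Set.mem_smul_set_iff_inv_smul_mem] using h (mem_chamber_self x)
  · rintro h _ ⟨b, hb, rfl⟩
    rw [Set.mem_smul_set_iff_inv_smul_mem, smul_eq_mul]
    have := hD.parabolic_mul_mem h (borel_subset_parabolic hb)
    rwa [mul_assoc] at this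

theorem IsTRD.smul_parabolic_eq_iff {g x : G} :
    x • D.parabolic ε J = g • D.parabolic ε J ↔ g⁻¹ * x ∈ D.parabolic ε J := by
  constructor
  · intro h
    have : x ∈ g • D.parabolic ε J := by
      rw [← h]
      exact ⟨1, one_mem_parabolic _ _, mul_one x⟩
    simpa [Set.mem_smul_set_iff_inv_smul_mem] using this
  · intro h
    have := hD.mul_smul_parabolic h g
    rwa [mul_inv_cancel_left] at this

theorem IsTRD.mem_fixator_iff {g x : G} :
    x ∈ D.fixator (g • D.parabolic ε J) ↔ g⁻¹ * x * g ∈ D.parabolic ε J := by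
  rw [fixator, MulAction.mem_stabilizer_iff, ← mul_smul, hD.smul_parabolic_eq_iff, mul_assoc]

/-- The chambers of the apartments `g A_std` having the facet `F = g n P_{ε,J}` as a face. -/
theorem IsTRD.chamber_subset_iff {g n m : G} {w v : W} (hn : D.Lifts n w) (hm : D.Lifts m v) :
    D.chamber ε (g * m) ⊆ (g * n) • D.parabolic ε J ↔ w⁻¹ * v ∈ cs.specialSubgroup J := by
  have e : (g * n)⁻¹ * (g * m) = n⁻¹ * m := by group
  rw [hD.chamber_subset_smul_parabolic_iff, e]
  exact ⟨hD.mem_specialSubgroup_of_mem_parabolic (hn.inv.mul hm),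
    (hn.inv.mul hm).mem_parabolic⟩

theorem IsTRD.wallContains_iff {g n : G} {w : W} (hn : D.Lifts n w) {α : cs.Root} :
    D.WallContains g ε α ((g * n) • D.parabolic ε J) ↔ (w⁻¹ • α).Crosses J := by
  have key : ∀ p : W → Prop, (∃ m v, D.Lifts m v ∧
      D.chamber ε (g * m) ⊆ (g * n) • D.parabolic ε J ∧ p v) ↔
        ∃ x ∈ cs.specialSubgroup J, p (w * x) := by
    intro p
    constructor
    · rintro ⟨m, v, hm, hc, h⟩
      exact ⟨w⁻¹ * v, (hD.chamber_subset_iff hn hm).1 hc, by rwa [mul_inv_cancel_left]⟩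
    · rintro ⟨x, hx, h⟩
      obtain ⟨m, hm⟩ := hD.exists_lifts (w * x)
      exact ⟨m, _, hm, (hD.chamber_subset_iff hn hm).2 (by rwa [inv_mul_cancel_left]), h⟩
  rw [WallContains, key, key (fun v => ¬ α.Contains ε v), Root.Crosses]
  simp only [mem_half_smul, inv_inv]
  cases ε
  · exact Iff.rfl
  · simp only [Root.Contains, not_not]
    exact and_comm

theorem IsTRD.rootContains_iff {g n : G} {w : W} (hn : D.Lifts n w) {α : cs.Root} :
    D.RootContains g ε α ((g * n) • D.parabolic ε J) ↔
      ∀ x ∈ cs.specialSubgroup J, (w⁻¹ • α).Contains ε x := by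
  simp only [Root.contains_smul, inv_inv]
  constructor
  · intro h x hx
    obtain ⟨m, hm⟩ := hD.exists_lifts (w * x)
    exact h m _ hm ((hD.chamber_subset_iff hn hm).2 (by rwa [inv_mul_cancel_left]))
  · intro h m v hm hc
    simpa using h _ ((hD.chamber_subset_iff hn hm).1 hc)

theorem IsTRD.conj_mul_smul_U {n : G} {w : W} (hn : D.Lifts n w) (g : G) (α : cs.Root) :
    MulAut.conj (g * n) • D.U (w⁻¹ • α) = MulAut.conj g • D.U α := by
  rw [map_mul, mul_smul, hD.conj_smul hn, smul_inv_smul]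

theorem IsTRD.conj_mul_smul_H {n : G} {w : W} (hn : D.Lifts n w) (g : G) :
    MulAut.conj (g * n) • D.H = MulAut.conj g • D.H := by
  rw [map_mul, mul_smul]
  congr 1
  ext x
  rw [MulAut.mem_conj_smul_iff]
  constructor
  · intro h
    convert hD.lifts_conj_mem_H hn h using 1
    group
  · intro h
    simpa using hD.lifts_conj_mem_H hn.inv h

theorem IsTRD.conj_smul_levi {g n : G} {w : W} (hn : D.Lifts n w) :
    MulAut.conj (g * n) • D.levi J = MulAut.conj g • D.H ⊔ ⨆ (α : cs.Root)
      (_ : D.WallContains g ε α ((g * n) • D.parabolic ε J)), MulAut.conj g • D.U α := by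
  have e : MulAut.conj (g * n) • D.levi J = MulAut.conj (g * n) • D.H ⊔
      ⨆ (α : cs.Root) (_ : α.Crosses J), MulAut.conj (g * n) • D.U α := by
    have hmap : ∀ K : Subgroup G, MulAut.conj (g * n) • K =
        K.map (MulAut.conj (g * n)).toMonoidHom := fun _ => rfl
    simp only [hmap, levi, Subgroup.map_sup, Subgroup.map_iSup]
  rw [e, hD.conj_mul_smul_H hn]
  congr 1
  apply le_antisymm
  · refine iSup₂_le fun α hα => le_iSup₂_of_le (w • α) ?_ ?_
    · rwa [hD.wallContains_iff hn, inv_smul_smul]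
    · have := hD.conj_mul_smul_U hn g (w • α)
      rw [inv_smul_smul] at this
      exact this.le
  · refine iSup₂_le fun α hα => le_iSup₂_of_le (w⁻¹ • α) ((hD.wallContains_iff hn).1 hα) ?_
    rw [hD.conj_mul_smul_U hn]

end OppositeApartments

end RootGroupData

theorem isInternalSemidirectProduct_of_forall {G : Type*} [Group G] {P L U : Subgroup G}
    (hL : L ≤ P) (hU : U ≤ P) (hn : ∀ p ∈ P, ∀ u ∈ U, p * u * p⁻¹ ∈ U)
    (hd : ∀ x ∈ L, x ∈ U → x = 1) (hm : ∀ p ∈ P, ∃ l ∈ L, ∃ u ∈ U, p = l * u) :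
    IsInternalSemidirectProduct P L U := by
  refine ⟨hL, hU, ⟨fun u hu p => hn p p.2 u hu⟩,
    Subgroup.isComplement'_of_disjoint_and_mul_eq_univ ?_ ?_⟩
  · rw [Subgroup.disjoint_def]
    exact fun {x} hx hx' => Subtype.ext (hd x hx hx')
  · rw [Set.eq_univ_iff_forall]
    rintro ⟨p, hp⟩
    obtain ⟨l, hl, u, hu, rfl⟩ := hm p hp
    exact ⟨⟨l, hL hl⟩, hl, ⟨u, hU hu⟩, hu, rfl⟩

/-! ### The Levi decomposition -/

namespace RootGroupData

section LeviDecomposition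

variable {S : Type*} {W : Type*} [Group W] {M : CoxeterMatrix S} {cs : CoxeterSystem M W}
  {G : Type*} [Group G] {D : RootGroupData cs G} {ε : TwinSign} {J : Set S}

open CoxeterSystem

variable (hD : D.IsTRD)
include hD

/-- A facet of a translate `g A_std` of the standard pair of apartments is of the form
`g n P_{ε,J}` with `n ∈ N`. -/
theorem IsTRD.exists_lifts_of_facetIn {A : TwinSign → Set (Set G)} {F : Set G} {g : G}
    (hg : D.IsTranslateOfStd A g) (hF : D.IsFacet ε J F) (hA : FacetIn A ε F) :
    ∃ n w, D.Lifts n w ∧ F = (g * n) • D.parabolic ε J := by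
  obtain ⟨x, rfl⟩ := hF
  obtain ⟨c, hc, hcF⟩ := hA
  rw [hg, mem_smul_stdApartment] at hc
  obtain ⟨n, w, hn, rfl⟩ := hc
  refine ⟨n, w, hn, ?_⟩
  rw [eq_comm, hD.smul_parabolic_eq_iff]
  exact hD.chamber_subset_smul_parabolic_iff.1 hcF

omit hD in
theorem isOppositeFacet_of_isTranslateOfStd {A : TwinSign → Set (Set G)} {g : G}
    (hg : D.IsTranslateOfStd A g) :
    D.IsOppositeFacet A ε J (g • D.parabolic ε J) (g • D.parabolic ε.opp J) := by
  have hc : ∀ ε, D.chamber ε g ∈ A ε := fun ε => by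
    rw [hg, mem_smul_stdApartment]
    exact ⟨1, 1, lifts_one, by rw [mul_one]⟩
  have hs : ∀ ε, D.chamber ε g ⊆ g • D.parabolic ε J := fun ε =>
    Set.smul_set_mono fun _ => borel_subset_parabolic
  exact ⟨⟨g, rfl⟩, _, hc _, _, hc _, hs _, hs _,
    chambersOpposite_iff.2 ⟨1, one_mem _, 1, one_mem _, by simp⟩⟩

/-- Opposite chambers of opposite apartments have the same position. -/
theorem IsTRD.eq_of_chambersOpposite {g n m : G} {w v : W} (hn : D.Lifts n w) (hm : D.Lifts m v)
    (h : D.ChambersOpposite ε (D.chamber ε (g * n)) (D.chamber ε.opp (g * m))) : w = v := by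
  obtain ⟨b, hb, c, hc, e⟩ := chambersOpposite_iff.1 h
  have e : b * c = (g * n)⁻¹ * (g * m) := e
  have h1 := hD.birkhoff_unique (ε := ε.opp) (by rwa [TwinSign.opp_opp]) (one_mem _) lifts_one
    (hn.inv.mul hm) hc (one_mem _) (show b * 1 * c = 1 * (n⁻¹ * m) * 1 by
      rw [mul_one, e]; group)
  exact inv_mul_eq_one.1 h1.symm

theorem IsTRD.isOppositeFacet_unique {A : TwinSign → Set (Set G)} {g : G} {F : Set G}
    (hg : D.IsTranslateOfStd A g) (hF : D.IsOppositeFacet A ε J (g • D.parabolic ε J) F) :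
    F = g • D.parabolic ε.opp J := by
  obtain ⟨⟨x, rfl⟩, c, hc, d, hd, hcF, hdF, hcd⟩ := hF
  rw [hg, mem_smul_stdApartment] at hc hd
  obtain ⟨n, w, hn, rfl⟩ := hc
  obtain ⟨m, v, hm, rfl⟩ := hd
  obtain rfl := hD.eq_of_chambersOpposite hn hm hcd
  rw [hD.chamber_subset_smul_parabolic_iff, inv_mul_cancel_left] at hcF
  have h1 := hm.mem_parabolic (ε := ε.opp) (hD.mem_specialSubgroup_of_mem_parabolic hn hcF)
  rw [hD.smul_parabolic_eq_iff]
  have h2 := hD.parabolic_mul_mem h1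
    (inv_mem_parabolic (hD.chamber_subset_smul_parabolic_iff.1 hdF))
  convert h2 using 1
  group

variable (h : Finite (cs.specialSubgroup J) ∨ D.IsTRDLin)
include h

theorem IsTRD.fixator_inf_fixator (g : G) :
    D.fixator (g • D.parabolic ε J) ⊓ D.fixator (g • D.parabolic ε.opp J) =
      MulAut.conj g • D.levi J := by
  ext x
  rw [Subgroup.mem_inf, hD.mem_fixator_iff, hD.mem_fixator_iff, MulAut.mem_conj_smul_iff]
  exact ⟨fun hx => hD.mem_levi_of_mem_parabolic h hx.1 hx.2,
    fun hx => ⟨hD.levi_subset_parabolic _ hx, hD.levi_subset_parabolic _ hx⟩⟩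

theorem IsTRD.isInternalSemidirectProduct (g : G) :
    IsInternalSemidirectProduct (D.fixator (g • D.parabolic ε J)) (MulAut.conj g • D.levi J)
      (MulAut.conj g • D.radicalOf J ε) := by
  refine isInternalSemidirectProduct_of_forall ?_ ?_ ?_ ?_ ?_
  · intro x hx
    rw [MulAut.mem_conj_smul_iff] at hx
    exact hD.mem_fixator_iff.2 (hD.levi_subset_parabolic _ hx)
  · intro x hx
    rw [MulAut.mem_conj_smul_iff] at hx
    exact hD.mem_fixator_iff.2 (radicalOf_subset_parabolic hx)
  · intro p hp u hu
    rw [MulAut.mem_conj_smul_iff] at hu ⊢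
    convert hD.radicalOf_normal h (hD.mem_fixator_iff.1 hp) _ hu using 1
    group
  · intro x hx hx'
    rw [MulAut.mem_conj_smul_iff] at hx hx'
    have := hD.eq_one_of_mem_levi_of_mem_radicalOf h hx hx'
    by_contra hne
    exact inv_mul_mul_ne_one hne this
  · intro p hp
    obtain ⟨l, hl, v, hv, e⟩ := hD.exists_levi_mul_radicalOf h (hD.mem_fixator_iff.1 hp)
    refine ⟨_, MulAut.conj_mul_mem_conj_smul hl, _, MulAut.conj_mul_mem_conj_smul hv, ?_⟩
    have : p = g * (g⁻¹ * p * g) * g⁻¹ := by group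
    rw [this, e]
    group

theorem IsTRD.conj_smul_radicalOf_eq {g g' : G}
    (hgg : g • D.parabolic ε J = g' • D.parabolic ε J) :
    MulAut.conj g • D.radicalOf J ε = MulAut.conj g' • D.radicalOf J ε := by
  have key : ∀ {g g' : G}, g • D.parabolic ε J = g' • D.parabolic ε J →
      MulAut.conj g • D.radicalOf J ε ≤ MulAut.conj g' • D.radicalOf J ε := by
    intro g g' hgg x hx
    rw [MulAut.mem_conj_smul_iff] at hx ⊢
    convert hD.radicalOf_normal h (hD.smul_parabolic_eq_iff.1 hgg) _ hx using 1
    group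
  exact le_antisymm (key hgg) (key hgg.symm)

theorem IsTRD.conj_smul_radicalOf_eq_closure {g n : G} {w : W} (hn : D.Lifts n w) :
    MulAut.conj (g * n) • D.radicalOf J ε =
      Subgroup.closure {y | ∃ p ∈ D.fixator ((g * n) • D.parabolic ε J), ∃ α : cs.Root,
        D.RootContains g ε α ((g * n) • D.parabolic ε J) ∧
          ∃ x ∈ MulAut.conj g • D.U α, y = p * x * p⁻¹} := by
  rw [hD.radicalOf_eq_closure h, Subgroup.smul_closure]
  congr 1
  ext y
  constructor
  · rintro ⟨_, ⟨p, hp, α, hα, x, hx, rfl⟩, rfl⟩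
    refine ⟨g * n * p * (g * n)⁻¹, ?_, w • α, ?_, g * n * x * (g * n)⁻¹, ?_, ?_⟩
    · rw [hD.mem_fixator_iff]
      convert hp using 1
      group
    · rwa [hD.rootContains_iff hn, inv_smul_smul]
    · have := hD.conj_mul_smul_U hn g (w • α)
      rw [inv_smul_smul] at this
      rw [← this]
      exact MulAut.conj_mul_mem_conj_smul hx
    · simp [MulAut.smul_def, mul_assoc]
  · rintro ⟨p, hp, α, hα, x, hx, rfl⟩
    rw [← hD.conj_mul_smul_U hn, MulAut.mem_conj_smul_iff] at hx
    refine ⟨_, ⟨_, hD.mem_fixator_iff.1 hp, _, (hD.rootContains_iff hn).1 hα, _, hx, rfl⟩, ?_⟩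
    simp only [MulAut.smul_def, MulAut.conj_apply]
    group

end LeviDecomposition

end RootGroupData

theorem mainTheorem8 {S : Type*} [Finite S] {W : Type*} [Group W] {M : CoxeterMatrix S}
    (cs : CoxeterSystem M W) {G : Type*} [Group G] (D : RootGroupData cs G) (hD : D.IsTRD)
    (ε : TwinSign) (J : Set S) (F : Set G) (hF : D.IsFacet ε J F)
    (h : Finite (cs.specialSubgroup J) ∨ D.IsTRDLin) :
    ∃ U : Subgroup G, ∀ A : TwinSign → Set (Set G),
      D.IsOppositeApartments A → RootGroupData.FacetIn A ε F →
      ∃ F' : Set G, D.IsOppositeFacet A ε J F F' ∧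
        (∀ F'', D.IsOppositeFacet A ε J F F'' → F'' = F') ∧
        IsInternalSemidirectProduct (D.fixator F) (D.fixator F ⊓ D.fixator F') U ∧
        (∀ g, D.IsTranslateOfStd A g →
          D.fixator F ⊓ D.fixator F' =
            MulAut.conj g • D.H ⊔
              ⨆ (α : cs.Root) (_ : D.WallContains g ε α F), MulAut.conj g • D.U α) ∧
        (∀ g, D.IsTranslateOfStd A g →
          U = Subgroup.closure {y | ∃ p ∈ D.fixator F, ∃ α : cs.Root, D.RootContains g ε α F ∧
            ∃ x ∈ MulAut.conj g • D.U α, y = p * x * p⁻¹}) ∧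
        (∃ g, D.IsTranslateOfStd A g ∧ F = g • D.parabolic ε J) ∧
        ∀ g, D.IsTranslateOfStd A g → F = g • D.parabolic ε J →
          ∃ csJ : CoxeterSystem (M.restrict J) (cs.specialSubgroup J),
            (∀ s : J, (csJ.simple s : W) = cs.simple s) ∧
            (D.leviData J csJ g (D.fixator F ⊓ D.fixator F')).IsTRD ∧
            (D.IsTRDLin →
              (D.leviData J csJ g (D.fixator F ⊓ D.fixator F')).IsTRDLin) := by
  obtain ⟨x, hx⟩ := hF
  refine ⟨MulAut.conj x • D.radicalOf J ε, fun A hA hFA => ?_⟩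
  obtain ⟨g₀, hg₀⟩ := hD.exists_isTranslateOfStd hA
  have hgn : ∀ g, D.IsTranslateOfStd A g → ∃ n w, D.Lifts n w ∧
      D.IsTranslateOfStd A (g * n) ∧ F = (g * n) • D.parabolic ε J := by
    intro g hg
    obtain ⟨n, w, hn, e⟩ := hD.exists_lifts_of_facetIn hg ⟨x, hx⟩ hFA
    exact ⟨n, w, hn, fun ε => by rw [hn.mul_smul_stdApartment, hg], e⟩
  obtain ⟨n₀, w₀, hn₀, hk, hkF⟩ := hgn g₀ hg₀
  set k := g₀ * n₀
  have hL : ∀ g, D.IsTranslateOfStd A g → F = g • D.parabolic ε J →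
      D.fixator F ⊓ D.fixator (k • D.parabolic ε.opp J) = MulAut.conj g • D.levi J := by
    intro g hg hgF
    have h1 := RootGroupData.isOppositeFacet_of_isTranslateOfStd (ε := ε) (J := J) hk
    rw [← hkF, hgF] at h1
    rw [hD.isOppositeFacet_unique hg h1, hgF, hD.fixator_inf_fixator h]
  have hU : ∀ g, F = g • D.parabolic ε J →
      MulAut.conj x • D.radicalOf J ε = MulAut.conj g • D.radicalOf J ε :=
    fun g hgF => hD.conj_smul_radicalOf_eq h (hx.symm.trans hgF)
  refine ⟨k • D.parabolic ε.opp J, ?_, ?_, ?_, ?_, ?_, ⟨k, hk, hkF⟩, ?_⟩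
  · rw [hkF]
    exact RootGroupData.isOppositeFacet_of_isTranslateOfStd hk
  · intro F'' hF''
    rw [hkF] at hF''
    exact hD.isOppositeFacet_unique hk hF''
  · rw [hL k hk hkF, hU k hkF, hkF]
    exact hD.isInternalSemidirectProduct h k
  · intro g hg
    obtain ⟨n, w, hn, hgn, e⟩ := hgn g hg
    rw [hL _ hgn e, hD.conj_smul_levi (ε := ε) hn, ← e]
  · intro g hg
    obtain ⟨n, w, hn, hgn, e⟩ := hgn g hg
    rw [hU _ e, hD.conj_smul_radicalOf_eq_closure h hn, ← e]
  · intro g hg hgF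
    have hf := D.isLeviModel_conj J g (hL g hg hgF)
    exact ⟨cs.specialSystem J, cs.coe_specialSystem_simple J, hf.isTRD hD, hf.isTRDLin⟩
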